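/- Let $k$ be a field and let $A=kQ/I$ be a Nakayama algebra: $Q$ is either the linearly oriented line $1\to 2\to\cdots\to N$ or the linearly oriented cycle $1\to 2\to\cdots\to N\to 1$ for some $N\ge 1$ (for $N=1$ the cycle is a single loop), and $I$ is an admissible ideal of the path algebra $kQ$, i.e. a two-sided ideal with $J^m\subseteq I\subseteq J^2$ for some $m\ge 2$, where $J$ is the ideal generated by the arrows. Paths are composed from left to right, and modules are finite-dimensional right $A$-modules. Let $0\to A_A\to I^0\to I^1\to\cdots$ be a minimal injective resolution of the regular module. The algebra $A$ is called $n$-Gorenstein ($n\ge1$) if $\operatorname{pdim} I^i\le i$ for all $0\le i<n$, and Auslander-Gorenstein if it is $n$-Gorenstein for all $n\ge 1$ and $\operatorname{idim} A_A<\infty$. The algebra $A$ has a well-defined Auslander-Reiten map if every indecomposable injective $A$-module $M$ has a finite minimal projective resolution whose last non-zero term is indecomposable. In this case the Auslander-Reiten map $\psi_A$, from isomorphism classes of indecomposable injective $A$-modules to isomorphism classes of indecomposable projective $A$-modules, sends $M$ to $\Omega^{\operatorname{pdim}M}(M)$, the last non-zero term of its minimal projective resolution. Theorem. $A$ is Auslander-Gorenstein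 if and only if $\psi_A$ is well-defined and bijective. -/

import Mathlib

open CategoryTheory

universe u v w

namespace QuiverAlg

/-! ### Path algebras of finite quivers -/

section PathAlgebra

variable (k : Type u) [Field k] (V : Type v) [Quiver.{w} V]

/-- A path in a quiver, together with its start and its end vertex. -/
abbrev TotalPath : Type (max v w) := Σ a : V, Σ b : V, Quiver.Path a b

variable {V} in
/-- The number of arrows of a path. -/
def TotalPath.length (p : TotalPath V) : ℕ := p.2.2.length

/-- The underlying space of the path algebra `kQ`: the `k`-vector space on all paths of `Q`,
including the paths of length zero. -/
def PathAlgebra : Type (max u v w) := TotalPath V →₀ k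

namespace PathAlgebra

noncomputable instance : AddCommGroup (PathAlgebra k V) :=
  inferInstanceAs (AddCommGroup (TotalPath V →₀ k))

noncomputable instance : Module k (PathAlgebra k V) :=
  inferInstanceAs (Module k (TotalPath V →₀ k))

/-- The paths form a basis of the path algebra. -/
noncomputable def basis : Module.Basis (TotalPath V) k (PathAlgebra k V) :=
  Module.Basis.ofRepr (LinearEquiv.refl k (TotalPath V →₀ k))

variable {V} in
/-- The basis element of `kQ` given by a path. -/
noncomputable def ofPath (p : TotalPath V) : PathAlgebra k V := basis k V p

variable {k V} in
theorem induction_on {P : PathAlgebra k V → Prop} (x : PathAlgebra k V) (zero : P 0)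
    (add : ∀ x y, P x → P y → P (x + y)) (path : ∀ (c : k) p, P (c • ofPath k p)) : P x := by
  rw [← (basis k V).linearCombination_repr x, Finsupp.linearCombination_apply]
  exact Finset.sum_induction _ P add zero fun p _ => path _ p

variable [DecidableEq V]

variable {V} in
/-- The product of two paths: the concatenation (first `p`, then `q`) if `p` ends where `q`
starts, and zero otherwise. -/
noncomputable def pathMul (p q : TotalPath V) : PathAlgebra k V :=
  if h : q.1 = p.2.1 then ofPath k ⟨p.1, q.2.1, p.2.2.comp (q.2.2.cast h rfl)⟩ else 0

/-- The bilinear extension of `pathMul`. -/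
noncomputable def mulHom : PathAlgebra k V →ₗ[k] PathAlgebra k V →ₗ[k] PathAlgebra k V :=
  (basis k V).constr k fun p => (basis k V).constr k fun q => pathMul k p q

noncomputable instance : Mul (PathAlgebra k V) := ⟨fun x y => mulHom k V x y⟩

variable {V} in
theorem ofPath_mul_ofPath (p q : TotalPath V) : ofPath k p * ofPath k q = pathMul k p q := by
  change mulHom k V (basis k V p) (basis k V q) = _
  rw [mulHom, Module.Basis.constr_basis, Module.Basis.constr_basis]

variable {k V}

theorem add_mul' (x y z : PathAlgebra k V) : (x + y) * z = x * z + y * z :=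
  (mulHom k V).map_add₂ x y z

theorem mul_add' (x y z : PathAlgebra k V) : x * (y + z) = x * y + x * z :=
  (mulHom k V x).map_add y z

theorem smul_mul' (c : k) (x y : PathAlgebra k V) : (c • x) * y = c • (x * y) :=
  (mulHom k V).map_smul₂ c x y

theorem mul_smul' (c : k) (x y : PathAlgebra k V) : x * (c • y) = c • (x * y) :=
  (mulHom k V x).map_smul c y

theorem zero_mul' (x : PathAlgebra k V) : 0 * x = 0 := (mulHom k V).map_zero₂ x

theorem mul_zero' (x : PathAlgebra k V) : x * 0 = 0 := (mulHom k V x).map_zero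

theorem mul_assoc' (x y z : PathAlgebra k V) : x * y * z = x * (y * z) := by
  induction x using induction_on with
  | zero => simp only [zero_mul']
  | add x x' hx hx' => simp only [add_mul', hx, hx']
  | path c p =>
  induction y using induction_on with
  | zero => simp only [zero_mul', mul_zero']
  | add y y' hy hy' => simp only [add_mul', mul_add', hy, hy']
  | path d q =>
  induction z using induction_on with
  | zero => simp only [mul_zero']
  | add z z' hz hz' => simp only [mul_add', hz, hz']
  | path e r =>
  simp only [smul_mul', mul_smul', ofPath_mul_ofPath]
  congr 3
  obtain ⟨a, b, p⟩ := p
  obtain ⟨b', c', q⟩ := q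
  obtain ⟨c'', d', r⟩ := r
  by_cases h1 : b' = b
  · subst h1
    by_cases h2 : c'' = c'
    · subst h2
      simp [pathMul, ofPath_mul_ofPath]
    · simp [pathMul, ofPath_mul_ofPath, h2, mul_zero']
  · by_cases h2 : c'' = c'
    · subst h2
      simp [pathMul, ofPath_mul_ofPath, h1, zero_mul']
    · simp [pathMul, h1, h2, mul_zero', zero_mul']

variable [Fintype V]

/-- The unit of `kQ` is the sum of the trivial paths. -/
noncomputable instance : One (PathAlgebra k V) :=
  ⟨∑ a : V, ofPath k ⟨a, a, Quiver.Path.nil⟩⟩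

theorem one_mul' (x : PathAlgebra k V) : 1 * x = x := by
  induction x using induction_on with
  | zero => exact mul_zero' 1
  | add x y hx hy => rw [mul_add', hx, hy]
  | path c p =>
  rw [mul_smul']
  congr 1
  change mulHom k V (∑ a : V, ofPath k ⟨a, a, Quiver.Path.nil⟩) (ofPath k p) = _
  rw [map_sum, LinearMap.sum_apply, Finset.sum_eq_single p.1]
  · refine (ofPath_mul_ofPath k _ _).trans ?_
    simp [pathMul]
  · intro a _ ha
    refine (ofPath_mul_ofPath k _ _).trans ?_
    simp [pathMul, ha.symm]
  · simp

theorem mul_one' (x : PathAlgebra k V) : x * 1 = x := by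
  induction x using induction_on with
  | zero => exact zero_mul' 1
  | add x y hx hy => rw [add_mul', hx, hy]
  | path c p =>
  rw [smul_mul']
  congr 1
  change mulHom k V (ofPath k p) (∑ a : V, ofPath k ⟨a, a, Quiver.Path.nil⟩) = _
  rw [map_sum, Finset.sum_eq_single p.2.1]
  · refine (ofPath_mul_ofPath k _ _).trans ?_
    simp [pathMul]
  · intro a _ ha
    refine (ofPath_mul_ofPath k _ _).trans ?_
    simp [pathMul, ha]
  · simp

noncomputable instance : Ring (PathAlgebra k V) :=
  { (inferInstance : AddCommGroup (PathAlgebra k V)) with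
    left_distrib := mul_add'
    right_distrib := add_mul'
    zero_mul := zero_mul'
    mul_zero := mul_zero'
    mul_assoc := mul_assoc'
    one_mul := one_mul'
    mul_one := mul_one' }

noncomputable instance : Algebra k (PathAlgebra k V) :=
  Algebra.ofModule smul_mul' fun c x y => mul_smul' c x y

end PathAlgebra

variable {V} in
/-- The `n`-th power of the arrow ideal of `kQ`: the span of all paths of length at least `n`. -/
noncomputable def arrowIdealPow (n : ℕ) : Submodule k (PathAlgebra k V) :=
  Submodule.span k {x | ∃ p : TotalPath V, n ≤ p.length ∧ x = PathAlgebra.ofPath k p}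

variable {k V} in
/-- A two-sided ideal `I` of `kQ` is admissible if `J ^ m ⊆ I ⊆ J ^ 2` for some `m ≥ 2`, where `J`
is the arrow ideal. -/
def IsAdmissible [Fintype V] [DecidableEq V] (I : Ideal (PathAlgebra k V))
    [I.IsTwoSided] : Prop :=
  (∃ m : ℕ, 2 ≤ m ∧ arrowIdealPow k m ≤ I.restrictScalars k) ∧
    I.restrictScalars k ≤ arrowIdealPow k 2

end PathAlgebra

/-! ### The quivers of Nakayama algebras -/

section Quivers

variable (V : Type v) [Quiver.{w} V]

/-- `Q` is the linearly oriented line `1 → 2 → ⋯ → N` for some `N ≥ 1`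
(with vertices numbered from `0` to `N - 1`). -/
def IsLinearQuiver : Prop :=
  ∃ N : ℕ, 1 ≤ N ∧ ∃ e : Fin N ≃ V, ∀ i j : Fin N,
    Nonempty ((e i ⟶ e j) ≃ PLift ((i : ℕ) + 1 = j))

/-- `Q` is the linearly oriented cycle `1 → 2 → ⋯ → N → 1` for some `N ≥ 1`
(with vertices numbered from `0` to `N - 1`). -/
def IsCyclicQuiver : Prop :=
  ∃ N : ℕ, 1 ≤ N ∧ ∃ e : Fin N ≃ V, ∀ i j : Fin N,
    Nonempty ((e i ⟶ e j) ≃ PLift (((i : ℕ) + 1) % N = j))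

end Quivers

/-! ### Minimal resolutions -/

section Resolutions

variable {R : Type u} [Ring R]

/-- A submodule `N` of `M` is superfluous if `N + L = M` only for `L = M`. -/
def IsSuperfluous {M : Type v} [AddCommGroup M] [Module R M] (N : Submodule R M) : Prop :=
  ∀ L : Submodule R M, N ⊔ L = ⊤ → L = ⊤

/-- A submodule `N` of `M` is essential if it meets every nonzero submodule nontrivially. -/
def IsEssential {M : Type v} [AddCommGroup M] [Module R M] (N : Submodule R M) : Prop :=
  ∀ L : Submodule R M, N ⊓ L = ⊥ → L = ⊥

/-- A projective resolution `⋯ → P₁ → P₀ → M → 0` by finitely generated modules is minimal if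
every image `Im (Pₙ₊₁ → Pₙ)` is superfluous in `Pₙ`; that is, if `P₀ → M` and all
`Pₙ₊₁ → Im (Pₙ₊₁ → Pₙ)` are projective covers. -/
structure IsMinimalProjectiveResolution {M : ModuleCat.{u} R} (P : ProjectiveResolution M) :
    Prop where
  finite : ∀ n, Module.Finite R (P.complex.X n)
  superfluous : ∀ n, IsSuperfluous (LinearMap.range (P.complex.d (n + 1) n).hom)

/-- An injective resolution `0 → M → I⁰ → I¹ → ⋯` by finitely generated modules is minimal if
every kernel `Ker (Iⁿ → Iⁿ⁺¹)` is essential in `Iⁿ`; that is, if `I⁰` is an injective envelope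
of `M` and all `Iⁿ⁺¹` are injective envelopes of `Im (Iⁿ → Iⁿ⁺¹)`. -/
structure IsMinimalInjectiveResolution {M : ModuleCat.{u} R} (I : InjectiveResolution M) :
    Prop where
  finite : ∀ n, Module.Finite R (I.cocomplex.X n)
  essential : ∀ n, IsEssential (LinearMap.ker (I.cocomplex.d n (n + 1)).hom)

/-- `P_d` is the last nonzero term of the resolution. -/
def IsLastNonzeroTerm {M : ModuleCat.{u} R} (P : ProjectiveResolution M) (d : ℕ) : Prop :=
  ¬ Limits.IsZero (P.complex.X d) ∧ ∀ n, d < n → Limits.IsZero (P.complex.X n)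

/-! Minimal projective resolutions are unique up to isomorphism. -/

theorem IsSuperfluous.map {M N : Type v} [AddCommGroup M] [Module R M] [AddCommGroup N]
    [Module R N] {S : Submodule R M} (hS : IsSuperfluous S) (f : M →ₗ[R] N) :
    IsSuperfluous (S.map f) := by
  intro L hL
  have h1 : S ⊔ L.comap f = ⊤ := by
    rw [eq_top_iff]
    intro x _
    have hx : f x ∈ S.map f ⊔ L := hL ▸ Submodule.mem_top
    obtain ⟨_, ⟨s, hs, rfl⟩, l, hl, hsl⟩ := Submodule.mem_sup.1 hx
    refine Submodule.mem_sup.2 ⟨s, hs, x - s, ?_, by abel⟩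
    rw [Submodule.mem_comap, map_sub, ← hsl]
    simpa using hl
  have h2 := hS _ h1
  have h3 : S.map f ≤ L := by
    rintro _ ⟨s, -, rfl⟩
    have : s ∈ L.comap f := h2 ▸ Submodule.mem_top
    exact this
  rwa [sup_eq_right.2 h3] at hL

theorem IsSuperfluous.sup {M : Type v} [AddCommGroup M] [Module R M] {S T : Submodule R M}
    (hS : IsSuperfluous S) (hT : IsSuperfluous T) : IsSuperfluous (S ⊔ T) := by
  intro L hL
  exact hT _ (hS _ (by rw [← sup_assoc, hL]))

theorem IsSuperfluous.mono {M : Type v} [AddCommGroup M] [Module R M] {S T : Submodule R M}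
    (hT : IsSuperfluous T) (h : S ≤ T) : IsSuperfluous S := by
  intro L hL
  exact hT _ (eq_top_iff.2 (hL ▸ sup_le_sup_right h L))

/-- An endomorphism of a minimal projective resolution which is homotopic to the identity differs
from it by a map with superfluous image. -/
theorem superfluous_of_homotopy {M : ModuleCat.{u} R} {P : ProjectiveResolution M}
    (hP : IsMinimalProjectiveResolution P) {f : P.complex ⟶ P.complex}
    (h : Homotopy f (𝟙 P.complex)) (n : ℕ) :
    ∃ S : Submodule R (P.complex.X n), IsSuperfluous S ∧ ∀ x, (f.f n).hom x - x ∈ S := by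
  have hc := h.comm n
  have h1 : IsSuperfluous (LinearMap.range (prevD n h.hom).hom) := by
    rw [Homotopy.prevD_chainComplex]
    refine (hP.superfluous n).mono ?_
    rintro _ ⟨x, rfl⟩
    exact ⟨_, rfl⟩
  have h2 : IsSuperfluous (LinearMap.range (dNext n h.hom).hom) := by
    cases n with
    | zero =>
      rw [Homotopy.dNext_zero_chainComplex]
      intro L hL
      rw [eq_top_iff, ← hL]
      refine sup_le ?_ le_rfl
      rintro _ ⟨x, rfl⟩
      exact L.zero_mem
    | succ m =>
      rw [Homotopy.dNext_succ_chainComplex]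
      refine ((hP.superfluous m).map (h.hom m (m + 1)).hom).mono ?_
      rintro _ ⟨x, rfl⟩
      exact ⟨_, ⟨x, rfl⟩, rfl⟩
  refine ⟨_, h2.sup h1, fun x => ?_⟩
  have hx : (f.f n).hom x = (dNext n h.hom).hom x + (prevD n h.hom).hom x + x := by
    rw [hc]; rfl
  rw [hx, add_sub_cancel_right]
  exact Submodule.add_mem_sup ⟨x, rfl⟩ ⟨x, rfl⟩

theorem iso_of_minimal {M M' : ModuleCat.{u} R} (e : M ≅ M') {P : ProjectiveResolution M}
    {P' : ProjectiveResolution M'} (hP : IsMinimalProjectiveResolution P)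
    (hP' : IsMinimalProjectiveResolution P') (n : ℕ) :
    Nonempty (P.complex.X n ≅ P'.complex.X n) := by
  let f := ProjectiveResolution.lift e.hom P P'
  let g := ProjectiveResolution.lift e.inv P' P
  have hgf : Homotopy (f ≫ g) (𝟙 P.complex) :=
    ((ProjectiveResolution.liftCompHomotopy e.hom e.inv P P' P).symm.trans
      (Homotopy.ofEq (by rw [e.hom_inv_id]))).trans (ProjectiveResolution.liftIdHomotopy M P)
  have hfg : Homotopy (g ≫ f) (𝟙 P'.complex) :=
    ((ProjectiveResolution.liftCompHomotopy e.inv e.hom P' P P').symm.trans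
      (Homotopy.ofEq (by rw [e.inv_hom_id]))).trans (ProjectiveResolution.liftIdHomotopy M' P')
  obtain ⟨S, hS, hSx⟩ := superfluous_of_homotopy hP hgf n
  obtain ⟨T, hT, hTx⟩ := superfluous_of_homotopy hP' hfg n
  have hfs : Function.Surjective (f.f n).hom := by
    rw [← LinearMap.range_eq_top]
    refine hT _ (eq_top_iff.2 fun x _ => ?_)
    refine Submodule.mem_sup.2 ⟨-((f.f n).hom ((g.f n).hom x) - x), T.neg_mem (hTx x),
      (f.f n).hom ((g.f n).hom x), ⟨_, rfl⟩, by abel⟩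
  have : Module.Projective R (P'.complex.X n) :=
    (IsProjective.iff_projective _).2 (P'.projective n)
  obtain ⟨s, hs⟩ := Module.projective_lifting_property (f.f n).hom LinearMap.id hfs
  have hs' : ∀ y, (f.f n).hom (s y) = y := fun y => LinearMap.congr_fun hs y
  have hss : LinearMap.range s = ⊤ := by
    refine hS _ (eq_top_iff.2 fun x _ => ?_)
    refine Submodule.mem_sup.2 ⟨x - s ((f.f n).hom x), ?_, _, ⟨(f.f n).hom x, rfl⟩, by abel⟩
    have h0 : (f.f n).hom (x - s ((f.f n).hom x)) = 0 := by rw [map_sub, hs', sub_self]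
    have h1 : (g.f n).hom ((f.f n).hom (x - s ((f.f n).hom x))) - (x - s ((f.f n).hom x)) ∈ S :=
      hSx _
    rw [h0, map_zero, zero_sub] at h1
    simpa using S.neg_mem h1
  have hsb : Function.Bijective s :=
    ⟨fun a b hab => by rw [← hs' a, hab, hs' b], LinearMap.range_eq_top.1 hss⟩
  exact ⟨(LinearEquiv.ofBijective s hsb).symm.toModuleIso⟩

theorem lastNonzeroTerm_iso {M M' : ModuleCat.{u} R} (e : M ≅ M') {P : ProjectiveResolution M}
    {P' : ProjectiveResolution M'} (hP : IsMinimalProjectiveResolution P)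
    (hP' : IsMinimalProjectiveResolution P') {d d' : ℕ} (hd : IsLastNonzeroTerm P d)
    (hd' : IsLastNonzeroTerm P' d') : Nonempty (P.complex.X d ≅ P'.complex.X d') := by
  have h : d = d' := by
    rcases lt_trichotomy d d' with h | h | h
    · obtain ⟨i⟩ := iso_of_minimal e hP hP' d'
      exact absurd ((hd.2 d' h).of_iso i.symm) hd'.1
    · exact h
    · obtain ⟨i⟩ := iso_of_minimal e hP hP' d
      exact absurd ((hd'.2 d h).of_iso i) hd.1
  subst h
  exact iso_of_minimal e hP hP' d

end Resolutions

/-! ### Auslander-Gorenstein algebras and the Auslander-Reiten map -/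

section AuslanderReiten

variable (A : Type u) [Ring A]

/-- Right `A`-modules. -/
abbrev RightModuleCat := ModuleCat.{u} Aᵐᵒᵖ

/-- The regular representation `A_A`. -/
abbrev regularRep : RightModuleCat A := ModuleCat.of Aᵐᵒᵖ A

/-- `A` is `n`-Gorenstein if `pdim Iⁱ ≤ i` for all `0 ≤ i < n`, where `0 → A_A → I⁰ → I¹ → ⋯` is
a minimal injective resolution of the regular representation. -/
def IsNGorenstein (n : ℕ) : Prop :=
  ∃ I : InjectiveResolution (regularRep A), IsMinimalInjectiveResolution I ∧
    ∀ i : ℕ, i < n → projectiveDimension (I.cocomplex.X i) ≤ i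

/-- `A` is Auslander-Gorenstein if it is `n`-Gorenstein for all `n ≥ 1` and `idim A_A < ∞`. -/
def IsAuslanderGorenstein : Prop :=
  (∀ n : ℕ, 1 ≤ n → IsNGorenstein A n) ∧ injectiveDimension (regularRep A) < ⊤

/-- Finitely generated indecomposable injective right `A`-modules. -/
def IndecInjective : Type (u + 1) :=
  {M : RightModuleCat A // Module.Finite Aᵐᵒᵖ M ∧ Indecomposable M ∧ Injective M}

/-- Finitely generated indecomposable projective right `A`-modules. -/
def IndecProjective : Type (u + 1) :=
  {M : RightModuleCat A // Module.Finite Aᵐᵒᵖ M ∧ Indecomposable M ∧ Projective M}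

instance IndecInjective.setoid : Setoid (IndecInjective A) where
  r M N := Nonempty (M.1 ≅ N.1)
  iseqv := ⟨fun _ => ⟨Iso.refl _⟩, fun ⟨e⟩ => ⟨e.symm⟩, fun ⟨e⟩ ⟨f⟩ => ⟨e ≪≫ f⟩⟩

instance IndecProjective.setoid : Setoid (IndecProjective A) where
  r M N := Nonempty (M.1 ≅ N.1)
  iseqv := ⟨fun _ => ⟨Iso.refl _⟩, fun ⟨e⟩ => ⟨e.symm⟩, fun ⟨e⟩ ⟨f⟩ => ⟨e ≪≫ f⟩⟩

/-- Isomorphism classes of indecomposable injective modules. -/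
abbrev IndecInjectiveClass : Type (u + 1) := Quotient (IndecInjective.setoid A)

/-- Isomorphism classes of indecomposable projective modules. -/
abbrev IndecProjectiveClass : Type (u + 1) := Quotient (IndecProjective.setoid A)

/-- `A` has a well-defined Auslander-Reiten map if every indecomposable injective module has a
finite minimal projective resolution whose last nonzero term is indecomposable. -/
def HasWellDefinedARMap : Prop :=
  ∀ M : IndecInjective A, ∃ (P : ProjectiveResolution M.1) (d : ℕ),
    IsMinimalProjectiveResolution P ∧ IsLastNonzeroTerm P d ∧ Indecomposable (P.complex.X d)

variable {A}

/-- The last nonzero term of a minimal projective resolution of `M`. -/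
noncomputable def lastTerm (h : HasWellDefinedARMap A) (M : IndecInjective A) :
    IndecProjective A :=
  ⟨(h M).choose.complex.X (h M).choose_spec.choose,
    (h M).choose_spec.choose_spec.1.finite _, (h M).choose_spec.choose_spec.2.2,
    (h M).choose.projective _⟩

/-- The Auslander-Reiten map `ψ_A`. It sends the class of `M` to the class of the last nonzero
term `P_d` of a minimal projective resolution of `M`, that is, of the syzygy `Ω ^ d (M)` with
`d = pdim M`. -/
noncomputable def auslanderReitenMap (h : HasWellDefinedARMap A) :
    IndecInjectiveClass A → IndecProjectiveClass A :=
  Quotient.map (lastTerm h) fun M N ⟨e⟩ =>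
    lastNonzeroTerm_iso e (h M).choose_spec.choose_spec.1 (h N).choose_spec.choose_spec.1
      (h M).choose_spec.choose_spec.2.1 (h N).choose_spec.choose_spec.2.1

end AuslanderReiten

end QuiverAlg

namespace QuiverAlg

/-! ### Combinatorics of resolutions of interval modules -/

section Combinatorics

/-! Label the vertices by integers modulo `N` and let `p s` be the first `t` for which the path from
`s` to `t` is zero. Everything happens among uniserial modules `[a, b)` with a basis of paths from
`a` to `t`, `a ≤ t < b`. The indecomposable projectives are `[s, p s)` and the indecomposable
injectives are `[q t, t)`, where `q` is the lower adjoint of `p`. The projective cover of `[a, b)`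
is `[a, p a)` with kernel `[b, p a)`, so the `n`-th syzygy is `[xₙ, xₙ₊₁)` for `x = a, b, p a, p b,
p (p a), …`, cut off at the first repetition. Dually the `n`-th cosyzygy is `[xₙ₊₁, xₙ)` for `x = b,
a, q b, q a, …`. Both sides of the theorem thus become statements about a Galois connection on `ℤ`
(`isAuslanderGorenstein_iff`, `bijective_auslanderReitenMap_iff`), and
`numericallyAuslanderGorenstein_iff` compares them.

The link is a condition (*): if the minimal injective resolution of `[i, p i)` has a nonzero term in
degree `2s + 2`, then `p^[s+1] (q^[s+1] i) = i`. The Auslander-Gorenstein property implies (*) by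
induction on `s`, from the bound on the projective dimension of the term in degree `2s + 1`. Given
(*), iterating `p` retraces the injective resolution of `[i, p i)`: if its last term is `[q j, j)`
in degree `d`, then the projective resolution of `[q j, j)` ends in degree `d` with `[i, p i)`.

Conversely, let every `[i, p i)` end the resolution of some `[q j, j)`, in degree `d`, and put `r =
⌊d / 2⌋`. Then (*) follows by strong induction on `s`: if `r ≤ s`, the injective resolution of `[i,
p i)` has already stopped before degree `2r + 2`; if `r > s`, then `i` lies in the image of
`p^[s+1]`, where `p^[s+1] ∘ q^[s+1]` is the identity. Condition (*) in turn gives all the dimension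
bounds.

Surjectivity of the Auslander-Reiten map is all that has to be compared: there are `N` classes of
injectives and `N` of projectives, so a surjective partial map is everywhere defined and bijective
(`exists_of_equivariant`). -/

/-- The sequence `a₀, a₁, f a₀, f a₁, f (f a₀), …`. -/
def interlacedOrbit (f : ℤ → ℤ) (a b : ℤ) : ℕ → ℤ
  | 0 => a
  | 1 => b
  | n + 2 => f (interlacedOrbit f a b n)

/-- The sequence `interlacedOrbit f a b`, made constant after its first repetition. -/
def stoppedOrbit (f : ℤ → ℤ) (a b : ℤ) : ℕ → ℤ
  | 0 => a
  | 1 => b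
  | n + 2 => if stoppedOrbit f a b n = stoppedOrbit f a b (n + 1) then stoppedOrbit f a b (n + 1)
      else f (stoppedOrbit f a b n)

variable {f : ℤ → ℤ} {a b : ℤ}

theorem stoppedOrbit_of_eq {n : ℕ} (h : stoppedOrbit f a b n = stoppedOrbit f a b (n + 1)) :
    stoppedOrbit f a b (n + 2) = stoppedOrbit f a b (n + 1) := by
  rw [stoppedOrbit, if_pos h]

theorem stoppedOrbit_of_ne {n : ℕ} (h : stoppedOrbit f a b n ≠ stoppedOrbit f a b (n + 1)) :
    stoppedOrbit f a b (n + 2) = f (stoppedOrbit f a b n) := by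
  rw [stoppedOrbit, if_neg h]

theorem stoppedOrbit_stationary {n : ℕ} (h : stoppedOrbit f a b n = stoppedOrbit f a b (n + 1))
    {m : ℕ} (hm : n ≤ m) : stoppedOrbit f a b m = stoppedOrbit f a b n := by
  have key : ∀ k, stoppedOrbit f a b (n + k) = stoppedOrbit f a b n ∧
      stoppedOrbit f a b (n + k) = stoppedOrbit f a b (n + k + 1) := by
    intro k
    induction k with
    | zero => exact ⟨rfl, h⟩
    | succ k ih => exact ⟨ih.2.symm.trans ih.1, (stoppedOrbit_of_eq ih.2).symm⟩
  obtain ⟨k, rfl⟩ := Nat.exists_eq_add_of_le hm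
  exact (key k).1

theorem stoppedOrbit_ne_of_le {n m : ℕ} (h : stoppedOrbit f a b n ≠ stoppedOrbit f a b (n + 1))
    (hm : m ≤ n) : stoppedOrbit f a b m ≠ stoppedOrbit f a b (m + 1) := fun h' =>
  h ((stoppedOrbit_stationary h' hm).trans (stoppedOrbit_stationary h' (by omega)).symm)

theorem stoppedOrbit_eq_interlacedOrbit {n : ℕ}
    (h : ∀ m < n, stoppedOrbit f a b m ≠ stoppedOrbit f a b (m + 1)) :
    ∀ m ≤ n + 1, stoppedOrbit f a b m = interlacedOrbit f a b m := by
  intro m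
  induction m using Nat.twoStepInduction with
  | zero => intro _; rfl
  | one => intro _; rfl
  | more m ih _ =>
    intro hm
    rw [stoppedOrbit_of_ne (h m (by omega)), ih (by omega)]
    rfl

/-- The recursion applies `f` to both sides, so an equality of neighbours recurs with period two,
but not with period one. -/
theorem interlacedOrbit_persist {m : ℕ} (h : interlacedOrbit f a b m = interlacedOrbit f a b (m + 1))
    (k : ℕ) : interlacedOrbit f a b (m + 2 * k) = interlacedOrbit f a b (m + 2 * k + 1) := by
  induction k with
  | zero => exact h
  | succ k ih => exact congrArg f ih

/-- An earlier repetition would persist with period two up to one of the last two places. Hence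
testing these two places, one of each parity, rules out all earlier repetitions. -/
theorem stoppedOrbit_ne_iff (n : ℕ) : stoppedOrbit f a b (n + 1) ≠ stoppedOrbit f a b (n + 2) ↔
    interlacedOrbit f a b n ≠ interlacedOrbit f a b (n + 1) ∧
      interlacedOrbit f a b (n + 1) ≠ interlacedOrbit f a b (n + 2) := by
  constructor
  · intro h
    have h' := stoppedOrbit_eq_interlacedOrbit (n := n + 2)
      (fun m hm => stoppedOrbit_ne_of_le h (by omega))
    rw [← h' n (by omega), ← h' (n + 1) (by omega), ← h' (n + 2) (by omega)]
    exact ⟨stoppedOrbit_ne_of_le h (by omega), h⟩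
  · rintro ⟨h1, h2⟩
    have key : ∀ m ≤ n + 1, interlacedOrbit f a b m ≠ interlacedOrbit f a b (m + 1) := by
      intro m hm h
      obtain ⟨k, hk | hk⟩ : ∃ k, m + 2 * k = n ∨ m + 2 * k = n + 1 :=
        ⟨(n + 1 - m) / 2, by omega⟩
      · have h3 := interlacedOrbit_persist h k
        rw [hk] at h3
        exact h1 h3
      · have h3 := interlacedOrbit_persist h k
        rw [hk] at h3
        exact h2 h3
    have h3 : ∀ m ≤ n + 1, stoppedOrbit f a b m ≠ stoppedOrbit f a b (m + 1) := by
      intro m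
      induction m using Nat.strong_induction_on with
      | _ m ih =>
        intro hm
        have := stoppedOrbit_eq_interlacedOrbit (n := m) (fun l hl => ih l hl (by omega))
        rw [this m (by omega), this (m + 1) le_rfl]
        exact key m hm
    exact h3 _ le_rfl

theorem stoppedOrbit_eq_of_ne {n : ℕ} (h : stoppedOrbit f a b n ≠ stoppedOrbit f a b (n + 1))
    {m : ℕ} (hm : m ≤ n + 2) : stoppedOrbit f a b m = interlacedOrbit f a b m :=
  stoppedOrbit_eq_interlacedOrbit (n := n + 1)
    (fun _ hl => stoppedOrbit_ne_of_le h (by omega)) m hm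

theorem interlacedOrbit_even (r : ℕ) : interlacedOrbit f a b (2 * r) = f^[r] a := by
  induction r with
  | zero => rfl
  | succ r ih => rw [Function.iterate_succ_apply', ← ih]; rfl

theorem interlacedOrbit_odd (r : ℕ) : interlacedOrbit f a b (2 * r + 1) = f^[r] b := by
  induction r with
  | zero => rfl
  | succ r ih => rw [Function.iterate_succ_apply', ← ih]; rfl

/-- Together with its even counterpart this expresses the nonvanishing of a syzygy or cosyzygy by
iterates alone, without the case distinction built into the orbit. -/
theorem stoppedOrbit_odd_ne_iff (r : ℕ) :
    stoppedOrbit f a b (2 * r + 1) ≠ stoppedOrbit f a b (2 * r + 2) ↔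
      f^[r] a ≠ f^[r] b ∧ f^[r] b ≠ f^[r + 1] a := by
  rw [stoppedOrbit_ne_iff, interlacedOrbit_even, interlacedOrbit_odd,
    show 2 * r + 2 = 2 * (r + 1) by ring, interlacedOrbit_even]

theorem stoppedOrbit_even_ne_iff (r : ℕ) :
    stoppedOrbit f a b (2 * r + 2) ≠ stoppedOrbit f a b (2 * r + 3) ↔
      f^[r] b ≠ f^[r + 1] a ∧ f^[r + 1] a ≠ f^[r + 1] b := by
  rw [show 2 * r + 2 = (2 * r + 1) + 1 by ring, show 2 * r + 3 = (2 * r + 1) + 2 by ring,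
    stoppedOrbit_ne_iff, interlacedOrbit_odd,
    show 2 * r + 1 + 1 = 2 * (r + 1) by ring, interlacedOrbit_even,
    show 2 * r + 1 + 2 = 2 * (r + 1) + 1 by ring, interlacedOrbit_odd]

theorem stoppedOrbit_even_of_ne {n r : ℕ}
    (h : stoppedOrbit f a b n ≠ stoppedOrbit f a b (n + 1)) (hr : 2 * r ≤ n + 2) :
    stoppedOrbit f a b (2 * r) = f^[r] a := by
  rw [stoppedOrbit_eq_of_ne h hr, interlacedOrbit_even]

theorem stoppedOrbit_odd_of_ne {n r : ℕ}
    (h : stoppedOrbit f a b n ≠ stoppedOrbit f a b (n + 1)) (hr : 2 * r + 1 ≤ n + 2) :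
    stoppedOrbit f a b (2 * r + 1) = f^[r] b := by
  rw [stoppedOrbit_eq_of_ne h hr, interlacedOrbit_odd]

end Combinatorics

end QuiverAlg

namespace QuiverAlg

/-! ### The numerical theorem for a Galois connection on `ℤ` -/

section Adjoint

/-- Source of the identities `p^[r] ∘ q^[r] ∘ p^[r] = p^[r]` and `q^[r] ∘ p^[r] ∘ q^[r] = q^[r]`
used below. -/
theorem galoisConnection_iterate {p q : ℤ → ℤ} (gc : GaloisConnection q p) (r : ℕ) :
    GaloisConnection q^[r] p^[r] := by
  induction r with
  | zero => exact GaloisConnection.id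
  | succ r ih =>
    rw [Function.iterate_succ' , Function.iterate_succ]
    exact ih.compose gc

/-- The numerical form of the Auslander-Gorenstein property for the interval modules `[s, p s)`
with injective envelopes `[q t, t)`. -/
def NumericallyAuslanderGorenstein (p q : ℤ → ℤ) : Prop :=
  (∀ i n, stoppedOrbit q (p i) i n ≠ stoppedOrbit q (p i) i (n + 1) →
    stoppedOrbit p (q (stoppedOrbit q (p i) i n)) (stoppedOrbit q (p i) i n) (n + 1) =
      stoppedOrbit p (q (stoppedOrbit q (p i) i n)) (stoppedOrbit q (p i) i n) (n + 2)) ∧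
  ∀ i, ∃ n, stoppedOrbit q (p i) i n = stoppedOrbit q (p i) i (n + 1)

/-- The resolution of `[q j, j)` by the modules `[s, p s)` has length `d` and its last term is
`[i, p i)`. -/
def IsARPair (p q : ℤ → ℤ) (j i : ℤ) (d : ℕ) : Prop :=
  stoppedOrbit p (q j) j d ≠ stoppedOrbit p (q j) j (d + 1) ∧
    stoppedOrbit p (q j) j (d + 1) = stoppedOrbit p (q j) j (d + 2) ∧
    stoppedOrbit p (q j) j d = i

variable {p q : ℤ → ℤ} (gc : GaloisConnection q p) (lt : ∀ a, a < p a)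
include gc lt

theorem adjoint_lt (b : ℤ) : q b < b := by
  have : q b ≤ b - 1 := (gc _ _).2 (by have := lt (b - 1); omega)
  omega

/-- Condition (*). The injective with right end `q^[s] i` occurs in degree `2s + 1`, so its syzygy
of degree `2s + 2` vanishes. By induction `p^[s]` brings `q^[s] i` back to `i`, so this vanishing
means either the claim or `p^[s+1] (q^[s+1] i) = p i`; by adjunction the latter contradicts `h2`. -/
theorem iterate_adjoint_eq_of_numericallyAuslanderGorenstein
    (h : NumericallyAuslanderGorenstein p q) (s : ℕ) (i : ℤ)
    (h1 : q^[s] i ≠ q^[s + 1] (p i)) (h2 : q^[s + 1] (p i) ≠ q^[s + 1] i) :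
    p^[s + 1] (q^[s + 1] i) = i := by
  have hgc := galoisConnection_iterate gc
  induction s with
  | zero =>
    have hB : stoppedOrbit q (p i) i 1 ≠ stoppedOrbit q (p i) i 2 :=
      (stoppedOrbit_odd_ne_iff 0).2 ⟨(lt i).ne', h1⟩
    have h3 := h.1 i 1 hB
    by_contra hne
    refine (stoppedOrbit_even_ne_iff 0).2 ⟨fun h4 => hne h4.symm, fun h4 => h2 ?_⟩ h3
    have h5 : p (q i) = p i := h4
    exact le_antisymm ((gc _ _).2 h5.ge) (gc.monotone_l (lt i).le)
  | succ s ih =>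
    have h0 : p^[s + 1] (q^[s + 1] i) = i := by
      refine ih (fun h3 => h1 ?_) fun h3 => h2 ?_
      · rw [Function.iterate_succ_apply', Function.iterate_succ_apply' q (s + 1), h3]
      · rw [Function.iterate_succ_apply', Function.iterate_succ_apply' q (s + 1), h3]
    have hB : stoppedOrbit q (p i) i (2 * (s + 1) + 1) ≠
        stoppedOrbit q (p i) i (2 * (s + 1) + 2) := by
      refine (stoppedOrbit_odd_ne_iff (s + 1)).2 ⟨fun h3 => h2 ?_, h1⟩
      rw [Function.iterate_succ_apply', Function.iterate_succ_apply' q (s + 1), h3]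
    have h3 := h.1 i _ hB
    rw [stoppedOrbit_odd_of_ne hB (by omega)] at h3
    by_contra hne
    refine (stoppedOrbit_even_ne_iff (s + 1)).2 ⟨fun h4 => hne ?_, fun h4 => h2 ?_⟩ h3
    · rw [h0] at h4
      rw [Function.iterate_succ_apply' q (s + 1), ← h4]
    · rw [Function.iterate_succ_apply' p (s + 1) (q^[s + 1] i), h0,
        ← Function.iterate_succ_apply' q] at h4
      exact le_antisymm ((hgc _ _ _).2 h4.ge) ((hgc _).monotone_l (lt i).le)

/-- If `A` is Auslander-Gorenstein, then every `[i, p i)` is a last term. -/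
theorem exists_isARPair_of_numericallyAuslanderGorenstein
    (h : NumericallyAuslanderGorenstein p q) (i : ℤ) : ∃ j d, IsARPair p q j i d := by
  have hgc := galoisConnection_iterate gc
  have key := iterate_adjoint_eq_of_numericallyAuslanderGorenstein gc lt h
  have hpqp : ∀ a, p (q (p a)) = p a := gc.u_l_u_eq_u
  have hlt := adjoint_lt gc lt
  -- `e` is the degree of the last nonzero term of the injective resolution of `[i, p i)`; the
  -- sought `j` is the right end of that term, and `d = e`.
  obtain ⟨e, he, he'⟩ : ∃ e, stoppedOrbit q (p i) i e ≠ stoppedOrbit q (p i) i (e + 1) ∧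
      stoppedOrbit q (p i) i (e + 1) = stoppedOrbit q (p i) i (e + 2) := by
    obtain ⟨n, hn⟩ := h.2 i
    induction n with
    | zero => exact absurd hn (lt i).ne'
    | succ n ih =>
      by_cases hn' : stoppedOrbit q (p i) i n = stoppedOrbit q (p i) i (n + 1)
      · exact ih hn'
      · exact ⟨n, hn', hn⟩
  obtain ⟨r, rfl | rfl | rfl⟩ : ∃ r, e = 0 ∨ e = 2 * r + 1 ∨ e = 2 * r + 2 := by
    obtain ⟨r, hr⟩ := Nat.even_or_odd' e
    rcases hr with rfl | rfl
    · cases r with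
      | zero => exact ⟨0, Or.inl rfl⟩
      | succ r => exact ⟨r, by omega⟩
    · exact ⟨r, by omega⟩
  · have h1 : i = q (p i) := he'.trans (stoppedOrbit_of_ne he)
    -- Here `[i, p i)` is itself injective, equal to `[q (p i), p i)`.
    refine ⟨p i, 0, ?_, ?_, h1.symm⟩
    · exact (hlt _).ne
    · rw [stoppedOrbit_of_ne (n := 0) (hlt _).ne]
      exact (hpqp i).symm
  · have h1 := (stoppedOrbit_odd_ne_iff r).1 he
    have h2 : q^[r + 1] (p i) = q^[r + 1] i := by
      by_contra h2
      exact (stoppedOrbit_even_ne_iff r).2 ⟨h1.2, h2⟩ he'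
    have h0 : p^[r] (q^[r] i) = i := by
      cases r with
      | zero => rfl
      | succ r =>
        refine key r i (fun h3 => h1.2 ?_) h1.1
        rw [Function.iterate_succ_apply', Function.iterate_succ_apply' q (r + 1), h3]
    -- With `j = q^[r] i`, the facts `h0` and `h3` identify the syzygy of `[q j, j)` in degree `2r +
    -- 1` with `[i, p i)`.
    have h3 : p^[r + 1] (q (q^[r] i)) = p i := by
      rw [← Function.iterate_succ_apply' q, ← h2]
      conv_lhs => rw [← h0]
      rw [← Function.iterate_succ_apply' p, (hgc (r + 1)).u_l_u_eq_u, Function.iterate_succ_apply',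
        h0]
    have h4 : stoppedOrbit p (q (q^[r] i)) (q^[r] i) (2 * r + 1) ≠
        stoppedOrbit p (q (q^[r] i)) (q^[r] i) (2 * r + 2) := by
      refine (stoppedOrbit_odd_ne_iff r).2 ⟨fun h5 => ?_, ?_⟩
      · rw [h0] at h5
        have h6 : q^[r] i ≤ q (q^[r] i) := ((hgc r) _ _).2 h5.ge
        exact absurd (hlt (q^[r] i)) h6.not_gt
      · rw [h3, h0]
        exact (lt i).ne
    refine ⟨q^[r] i, 2 * r + 1, h4, ?_, ?_⟩
    · by_contra h5
      refine ((stoppedOrbit_even_ne_iff r).1 h5).2 ?_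
      rw [h3, Function.iterate_succ_apply', h0]
    · rw [stoppedOrbit_odd_of_ne h4 (by omega), h0]
  · have h1 := (stoppedOrbit_even_ne_iff r).1 he
    have h2 : q^[r + 1] i = q^[r + 2] (p i) := by
      by_contra h2
      exact (stoppedOrbit_odd_ne_iff (r + 1)).2 ⟨h1.2, h2⟩ he'
    have h0 := key r i h1.1 h1.2
    have h3 : p^[r + 1] (q^[r + 1] (p i)) = p i := by
      have h4 : p i = p^[r + 1] (p (q^[r + 1] i)) := by
        rw [← Function.iterate_succ_apply p, Function.iterate_succ_apply' p, h0]
      rw [h4, (hgc (r + 1)).u_l_u_eq_u]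
    -- With `j = q^[r + 1] (p i)`, the facts `h4` and `h3` identify the syzygy of `[q j, j)` in
    -- degree `2r + 2` with `[i, p i)`.
    have h4 : p^[r + 1] (q (q^[r + 1] (p i))) = i := by
      rw [← Function.iterate_succ_apply' q, ← h2, h0]
    have h5 : stoppedOrbit p (q (q^[r + 1] (p i))) (q^[r + 1] (p i)) (2 * r + 2) ≠
        stoppedOrbit p (q (q^[r + 1] (p i))) (q^[r + 1] (p i)) (2 * r + 3) := by
      refine (stoppedOrbit_even_ne_iff r).2 ⟨fun h6 => h1.1 ?_, ?_⟩
      · rw [h4] at h6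
        refine le_antisymm ((hgc _ _ _).2 h6.ge) ?_
        rw [Function.iterate_succ_apply]
        exact (hgc r).monotone_l (gc.l_u_le i)
      · rw [h3, h4]
        exact (lt i).ne
    refine ⟨q^[r + 1] (p i), 2 * r + 2, h5, ?_, ?_⟩
    · by_contra h6
      refine ((stoppedOrbit_odd_ne_iff (r + 1)).1 h6).2 ?_
      rw [h3, Function.iterate_succ_apply' p, h4]
    · rw [show 2 * r + 2 = 2 * (r + 1) by ring, stoppedOrbit_even_of_ne h5 (by omega), h4]

/-- Dual to (*): while the projective resolution of `[q j, j)` continues, `q` retraces the steps of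
`p`. If this failed first at `u + 1`, then (*) at `p^[u] j` would give `p^[u + 1] (q j) = p^[u] j`,
a repetition that has not yet occurred. -/
theorem iterate_adjoint_iterate_of_isARPair {r : ℕ}
    (hr : ∀ s < r, ∀ i, q^[s] i ≠ q^[s + 1] (p i) → q^[s + 1] (p i) ≠ q^[s + 1] i →
      p^[s + 1] (q^[s + 1] i) = i)
    {j i : ℤ} {d : ℕ} (h : IsARPair p q j i d) (hd : 2 * r ≤ d) {u : ℕ} (hu : u ≤ r) :
    q^[u] (p^[u] j) = j := by
  have hgc := galoisConnection_iterate gc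
  induction u with
  | zero => rfl
  | succ u ih =>
    have ih := ih (by omega)
    have h1 := (stoppedOrbit_even_ne_iff u).1 (stoppedOrbit_ne_of_le h.1 (m := 2 * u + 2) (by omega))
    have h3 : q^[u + 1] (p^[u] j) = q j := by rw [Function.iterate_succ_apply', ih]
    by_contra h2
    rw [Function.iterate_succ_apply' p] at h2
    refine h1.1 ?_
    rw [← h3, hr u (by omega) (p^[u] j) (fun h4 => h2 ?_) fun h4 => h1.2 ?_]
    · rw [← h4, ih]
    · refine le_antisymm ((hgc _).monotone_u (adjoint_lt gc lt j).le) ?_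
      rw [← h3, ← h4, Function.iterate_succ_apply' p u j]
      exact (hgc _).le_u_l _

/-- The injective resolution of `[i, p i)` stops by degree `2r + 2`. Since `q^[r]` undoes `p^[r]` on
`j`, the end of the projective resolution at `d` carries over, by adjunction, to a repetition in the
orbit of `q`. -/
theorem not_ne_of_isARPair {r : ℕ}
    (hr : ∀ s < r, ∀ i, q^[s] i ≠ q^[s + 1] (p i) → q^[s + 1] (p i) ≠ q^[s + 1] i →
      p^[s + 1] (q^[s + 1] i) = i)
    {j i : ℤ} {d : ℕ} (h : IsARPair p q j i d) (hd : d = 2 * r ∨ d = 2 * r + 1) :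
    ¬ (q^[r] i ≠ q^[r + 1] (p i) ∧ q^[r + 1] (p i) ≠ q^[r + 1] i) := by
  have hgc := galoisConnection_iterate gc
  have h0 : q^[r] (p^[r] j) = j :=
    iterate_adjoint_iterate_of_isARPair gc lt hr h (by omega) le_rfl
  obtain ⟨h1, h2, rfl⟩ := h
  rcases hd with rfl | rfl
  · have h3 : p^[r] (q j) ≠ p^[r] j := by
      rw [← stoppedOrbit_even_of_ne h1 (by omega), ← stoppedOrbit_odd_of_ne h1 (by omega)]
      exact h1
    have h4 : p^[r + 1] (q j) = p^[r] j := by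
      by_contra h4
      exact (stoppedOrbit_odd_ne_iff r).2 ⟨h3, Ne.symm h4⟩ h2
    rw [stoppedOrbit_even_of_ne h1 (by omega), ← Function.iterate_succ_apply' p, h4]
    rintro ⟨h5, -⟩
    refine h5 (le_antisymm ?_ ?_)
    · rw [Function.iterate_succ_apply' q, h0]
      exact (hgc r).l_u_le _
    · rw [Function.iterate_succ_apply]
      refine (hgc r).monotone_l ((gc _ _).2 ?_)
      rw [← Function.iterate_succ_apply' p, h4]
  · have h3 := ((stoppedOrbit_odd_ne_iff r).1 h1).2
    have h4 : p^[r + 1] (q j) = p^[r + 1] j := by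
      by_contra h4
      exact (stoppedOrbit_even_ne_iff r).2 ⟨h3, h4⟩ h2
    rw [stoppedOrbit_odd_of_ne h1 (by omega), ← Function.iterate_succ_apply' p, ← h4]
    rintro ⟨-, h5⟩
    refine h5 (le_antisymm ?_ ?_)
    · rw [Function.iterate_succ_apply' q r (p^[r] j), h0]
      exact (hgc (r + 1)).l_u_le _
    · rw [h4, Function.iterate_succ_apply' p]
      exact (hgc (r + 1)).monotone_l (lt _).le

-- A repetition at level `r` is carried to level `s` by `q^[s - r]`.
omit gc lt in
theorem ne_of_ne_of_le {i : ℤ} {r s : ℕ} (hrs : r ≤ s)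
    (h : q^[s] i ≠ q^[s + 1] (p i) ∧ q^[s + 1] (p i) ≠ q^[s + 1] i) :
    q^[r] i ≠ q^[r + 1] (p i) ∧ q^[r + 1] (p i) ≠ q^[r + 1] i := by
  obtain ⟨k, rfl⟩ := Nat.exists_eq_add_of_le' hrs
  refine ⟨fun h1 => h.1 ?_, fun h1 => h.2 ?_⟩
  · rw [Function.iterate_add_apply, h1, ← Function.iterate_add_apply]
    rfl
  · rw [add_assoc, Function.iterate_add_apply, h1, ← Function.iterate_add_apply]

/-- Condition (*) from surjectivity. A short projective resolution ending at `i` makes the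
hypotheses of (*) fail, and a long one puts `i` in the image of `p^[s + 1]`. The first case uses (*)
only for smaller indices, which makes the induction work. -/
theorem iterate_adjoint_eq_of_isARPair (h : ∀ i, ∃ j d, IsARPair p q j i d) (s : ℕ) :
    ∀ i, q^[s] i ≠ q^[s + 1] (p i) → q^[s + 1] (p i) ≠ q^[s + 1] i →
      p^[s + 1] (q^[s + 1] i) = i := by
  induction s using Nat.strong_induction_on with
  | _ s ih =>
    intro i h1 h2
    have hgc := galoisConnection_iterate gc
    obtain ⟨j, d, hd⟩ := h i
    obtain ⟨r, hr⟩ := Nat.even_or_odd' d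
    rcases le_or_gt r s with hrs | hrs
    · exact absurd (ne_of_ne_of_le hrs ⟨h1, h2⟩)
        (not_ne_of_isARPair gc lt (fun u hu => ih u (by omega)) hd hr)
    · obtain ⟨x, rfl⟩ : ∃ x, p^[s + 1] x = i := by
        obtain ⟨k, rfl⟩ := Nat.exists_eq_add_of_le (show s + 1 ≤ r from hrs)
        obtain ⟨h3, -, rfl⟩ := hd
        rcases hr with rfl | rfl
        · rw [stoppedOrbit_even_of_ne h3 (by omega), Function.iterate_add_apply]
          exact ⟨_, rfl⟩
        · rw [stoppedOrbit_odd_of_ne h3 (by omega), Function.iterate_add_apply]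
          exact ⟨_, rfl⟩
      exact (hgc _).u_l_u_eq_u x

/-- If every `[i, p i)` is a last term, then `A` is Auslander-Gorenstein. -/
theorem numericallyAuslanderGorenstein_of_isARPair (h : ∀ i, ∃ j d, IsARPair p q j i d) :
    NumericallyAuslanderGorenstein p q := by
  have key := iterate_adjoint_eq_of_isARPair gc lt h
  have hgc := galoisConnection_iterate gc
  refine ⟨fun i n hn => ?_, fun i => ?_⟩
  · obtain ⟨s, rfl | rfl | rfl⟩ : ∃ r, n = 0 ∨ n = 2 * r + 1 ∨ n = 2 * r + 2 := by
      obtain ⟨r, hr⟩ := Nat.even_or_odd' n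
      rcases hr with rfl | rfl
      · cases r with
        | zero => exact ⟨0, Or.inl rfl⟩
        | succ r => exact ⟨r, by omega⟩
      · exact ⟨r, by omega⟩
    -- Degree zero: the injective envelope `[q (p i), p i)` is projective, because `p (q (p i)) = p
    -- i`.
    · rw [stoppedOrbit_of_ne (f := p) (n := 0) (adjoint_lt gc lt _).ne]
      exact (gc.u_l_u_eq_u i).symm
    · have h1 := (stoppedOrbit_odd_ne_iff s).1 hn
      rw [stoppedOrbit_odd_of_ne hn (by omega)]
      have h0 : p^[s] (q^[s] i) = i := by
        cases s with
        | zero => rfl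
        | succ s =>
          refine key s i (fun h3 => h1.2 ?_) h1.1
          rw [Function.iterate_succ_apply', Function.iterate_succ_apply' q (s + 1), h3]
      by_contra h2
      have h2 := (stoppedOrbit_even_ne_iff s).1 h2
      rw [h0, ← Function.iterate_succ_apply' q, Function.iterate_succ_apply' p s (q^[s] i), h0] at h2
      -- If the injective resolution stops in degree `2s + 2`, the triangle identity for `p^[s + 1]`
      -- makes the syzygy vanish; otherwise (*) applies at `s` itself.
      by_cases h3 : q^[s + 1] (p i) = q^[s + 1] i
      · refine h2.2 ?_
        have h4 : p^[s + 1] (q^[s] i) = p i := by rw [Function.iterate_succ_apply', h0]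
        rw [← h3, ← h4, (hgc _).u_l_u_eq_u]
      · exact h2.1 (key s i h1.2 h3).symm
    · have h1 := (stoppedOrbit_even_ne_iff s).1 hn
      rw [show 2 * s + 2 = 2 * (s + 1) by ring] at hn ⊢
      rw [stoppedOrbit_even_of_ne hn (by omega)]
      have h0 := key s i h1.1 h1.2
      have h3 : p i = p^[s + 1] (p (q^[s + 1] i)) := by
        rw [← Function.iterate_succ_apply p, Function.iterate_succ_apply' p, h0]
      by_contra h2
      refine ((stoppedOrbit_odd_ne_iff (s + 1)).1 h2).2 ?_
      rw [← Function.iterate_succ_apply' q, h3, (hgc (s + 1)).u_l_u_eq_u,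
        ← Function.iterate_succ_apply p, (hgc (s + 1 + 1)).u_l_u_eq_u]
  · obtain ⟨j, d, hd⟩ := h i
    obtain ⟨r, hr⟩ := Nat.even_or_odd' d
    refine ⟨2 * r + 2, ?_⟩
    by_contra h1
    exact not_ne_of_isARPair gc lt (fun u _ => key u) hd hr ((stoppedOrbit_even_ne_iff r).1 h1)

theorem numericallyAuslanderGorenstein_iff :
    NumericallyAuslanderGorenstein p q ↔ ∀ i, ∃ j d, IsARPair p q j i d :=
  ⟨exists_isARPair_of_numericallyAuslanderGorenstein gc lt,
    numericallyAuslanderGorenstein_of_isARPair gc lt⟩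

end Adjoint

end QuiverAlg

namespace QuiverAlg

/-! ### Algebras with a basis of paths in a cycle or a line -/

/-- A basis of an algebra `A` by the nonzero paths of a bound quiver with one arrow `s → s + 1` for
`s` in `ℤ / N`. For `s ≤ t`, the path from `s` to `t` is `y s t`, and it is zero if and only if
`p s ≤ t`. The vertices are labelled by integers instead of residue classes. -/
structure NakayamaBasis (k : Type u) (A : Type v) [Field k] [Ring A] [Algebra k A] where
  N : ℕ
  N_pos : 0 < N
  p : ℤ → ℤ
  lt_p : ∀ s, s < p s
  p_add : ∀ s, p (s + N) = p s + N
  y : ℤ → ℤ → A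
  y_add : ∀ s t, y (s + N) (t + N) = y s t
  y_eq_zero : ∀ s t, ¬ (s ≤ t ∧ t < p s) → y s t = 0
  y_mul : ∀ s t u, s ≤ t → t ≤ u → y s t * y t u = y s u
  y_mul_zero : ∀ s t t' u, ¬ (N : ℤ) ∣ t' - t → y s t * y t' u = 0
  one : ∑ i ∈ Finset.range N, y i i = 1
  span : Submodule.span k (Set.range fun s : ℤ × ℤ => y s.1 s.2) = ⊤
  -- Coordinate functionals encode linear independence of the nonzero paths. The last two conditions
  -- in `χ_y` say that `(s', t')` is a translate of `(s, t)` by a multiple of `N`.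
  χ : ℤ → ℤ → A →ₗ[k] k
  χ_y : ∀ s t s' t', χ s t (y s' t') =
    if s ≤ t ∧ t < p s ∧ (N : ℤ) ∣ s' - s ∧ t' - s' = t - s then 1 else 0

namespace NakayamaBasis

variable {k : Type u} {A : Type v} [Field k] [Ring A] [Algebra k A] (B : NakayamaBasis k A)

theorem p_add_mul (s c : ℤ) : B.p (s + c * B.N) = B.p s + c * B.N := by
  induction c using Int.induction_on with
  | zero => simp
  | succ c ih => rw [add_mul, one_mul, ← add_assoc, B.p_add, ih, add_assoc]
  | pred c ih =>
    rw [← add_left_inj (B.N : ℤ), ← B.p_add, add_assoc, add_assoc, sub_mul, one_mul,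
      sub_add_cancel, ih]

theorem y_add_mul (s t c : ℤ) : B.y (s + c * B.N) (t + c * B.N) = B.y s t := by
  induction c using Int.induction_on with
  | zero => simp
  | succ c ih => rw [add_mul, one_mul, ← add_assoc, ← add_assoc, B.y_add, ih]
  | pred c ih =>
    rw [← B.y_add, add_assoc, add_assoc, sub_mul, one_mul, sub_add_cancel, ih]

theorem χ_y_self {s t : ℤ} (h : s ≤ t) (h' : t < B.p s) : B.χ s t (B.y s t) = 1 := by
  simp [χ_y, h, h']

/-- If `p (s + 1) < p s`, the nonzero path from `s` to `p s - 1` would factor through the zero path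
from `s + 1` to `p s - 1`. -/
theorem p_mono : Monotone B.p := by
  refine monotone_int_of_le_succ fun s => ?_
  by_contra! h
  have h1 := B.lt_p (s + 1)
  have h2 := B.χ_y_self (s := s) (t := B.p s - 1) (by omega) (by omega)
  rw [← B.y_mul s (s + 1) _ (by omega) (by omega),
    B.y_eq_zero (s + 1) (B.p s - 1) (by omega), mul_zero, map_zero] at h2
  exact zero_ne_one h2

variable {B} in
theorem induction {P : A → Prop} (x : A) (zero : P 0) (add : ∀ x y, P x → P y → P (x + y))
    (y : ∀ (c : k) s t, s ≤ t → t < B.p s → P (c • B.y s t)) : P x := by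
  have hx : x ∈ Submodule.span k (Set.range fun s : ℤ × ℤ => B.y s.1 s.2) :=
    B.span ▸ Submodule.mem_top
  induction hx using Submodule.closure_induction with
  | zero => exact zero
  | add x y _ _ hx hy => exact add x y hx hy
  | smul_mem c x hx =>
    obtain ⟨⟨s, t⟩, rfl⟩ := hx
    by_cases h : s ≤ t ∧ t < B.p s
    · exact y c s t h.1 h.2
    · simp only [B.y_eq_zero s t h, smul_zero, zero]

/-- Prepending the path from `s` to `a` moves the coefficient at `(a, t)` to `(s, t)`, unless the
longer path is zero. A path starting in the class of `a` is translated so that it starts at `a`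
exactly; all others are not composable. -/
theorem χ_y_mul {s a t : ℤ} (h : s ≤ a) (z : A) :
    B.χ s t (B.y s a * z) = if a ≤ t ∧ t < B.p s then B.χ a t z else 0 := by
  have hp := B.p_mono h
  induction z using B.induction with
  | zero => simp
  | add z w hz hw => simp only [mul_add, map_add, hz, hw]; split_ifs <;> simp
  | y c a' t' h1 h2 =>
    rw [mul_smul_comm, map_smul, map_smul]
    by_cases h3 : (B.N : ℤ) ∣ a' - a
    · obtain ⟨m, hm⟩ := h3
      obtain rfl : a' = a + m * B.N := by linarith
      obtain ⟨t', rfl⟩ : ∃ t'', t' = t'' + m * B.N := ⟨t' - m * B.N, by ring⟩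
      rw [B.y_add_mul, B.y_mul s a t' h (by omega), χ_y, χ_y]
      simp only [sub_self, dvd_zero, true_and]
      split_ifs <;> first | rfl | omega | simp
    · rw [B.y_mul_zero _ _ _ _ h3, χ_y]
      simp [h3]

theorem χ_mul_y {a s t : ℤ} (h : s ≤ t) (z : A) :
    B.χ a t (z * B.y s t) = if t < B.p a then B.χ a s z else 0 := by
  induction z using B.induction with
  | zero => simp
  | add z w hz hw => simp only [add_mul, map_add, hz, hw]; split_ifs <;> simp
  | y c a' t' h1 h2 =>
    rw [smul_mul_assoc, map_smul, map_smul]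
    by_cases h3 : (B.N : ℤ) ∣ s - t'
    · obtain ⟨m, hm⟩ := h3
      obtain rfl : t' = s + (-m) * B.N := by linarith
      obtain ⟨a', rfl⟩ : ∃ a'', a' = a'' + (-m) * B.N := ⟨a' - (-m) * B.N, by ring⟩
      have h4 : (a ≤ t ∧ t < B.p a ∧ (B.N : ℤ) ∣ a' - a ∧ t - a' = t - a) ↔
          (t < B.p a ∧ a ≤ s ∧ s < B.p a ∧ (B.N : ℤ) ∣ a' - a ∧ s - a' = s - a) :=
        ⟨fun ⟨_, h5, h6, _⟩ => ⟨h5, by omega, by omega, h6, by omega⟩,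
          fun ⟨h5, _, _, h6, _⟩ => ⟨by omega, h5, h6, by omega⟩⟩
      rw [B.y_add_mul, B.y_mul _ s t (by omega) h, χ_y, χ_y, if_congr h4 rfl rfl,
        ite_and]
      split_ifs <;> simp
    · have h4 : B.χ a s (B.y a' t') = 0 := by
        rw [χ_y, if_neg]
        rintro ⟨-, -, h4, h5⟩
        refine h3 ?_
        rw [show s - t' = -(a' - a) by linarith]
        exact (dvd_neg).2 h4
      rw [B.y_mul_zero _ _ _ _ h3, h4, map_zero, smul_zero, ite_self]

theorem χ_mul_y_eq_zero {a s t u : ℤ} (h : ¬ (B.N : ℤ) ∣ u - t) (z : A) :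
    B.χ a t (z * B.y s u) = 0 := by
  induction z using B.induction with
  | zero => simp
  | add z w hz hw => simp only [add_mul, map_add, hz, hw, add_zero]
  | y c a' t' h1 h2 =>
    rw [smul_mul_assoc, map_smul]
    by_cases h3 : (B.N : ℤ) ∣ s - t'
    · obtain ⟨m, hm⟩ := h3
      obtain rfl : t' = s + (-m) * B.N := by linarith
      obtain ⟨a', rfl⟩ : ∃ a'', a' = a'' + (-m) * B.N := ⟨a' - (-m) * B.N, by ring⟩
      rw [B.y_add_mul]
      by_cases h4 : s ≤ u
      · rw [B.y_mul _ s u (by omega) h4, χ_y, if_neg, smul_zero]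
        rintro ⟨-, -, h5, h6⟩
        exact h (by rwa [show u - t = a' - a by linarith])
      · rw [B.y_eq_zero s u (by omega), mul_zero, map_zero, smul_zero]
    · rw [B.y_mul_zero _ _ _ _ h3, map_zero, smul_zero]

theorem χ_eq_zero {s t : ℤ} (h : ¬ (s ≤ t ∧ t < B.p s)) (z : A) : B.χ s t z = 0 := by
  induction z using B.induction with
  | zero => simp
  | add z w hz hw => rw [map_add, hz, hw, add_zero]
  | y c a' t' h1 h2 =>
    rw [map_smul, χ_y, if_neg, smul_zero]
    exact fun h' => h ⟨h'.1, h'.2.1⟩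

/-- The expansion of an element in the basis of paths. -/
theorem eq_sum (z : A) :
    z = ∑ i ∈ Finset.range B.N, ∑ t ∈ Finset.Ico (i : ℤ) (B.p i), B.χ i t z • B.y i t := by
  induction z using B.induction with
  | zero => simp
  | add z w hz hw => simp only [map_add, add_smul, Finset.sum_add_distrib, ← hz, ← hw]
  | y c a t h1 h2 =>
    have hN : (0 : ℤ) < B.N := by exact_mod_cast B.N_pos
    simp only [map_smul, smul_assoc, ← Finset.smul_sum]
    congr 1
    obtain ⟨m, i, hi, rfl⟩ : ∃ (m : ℤ) (i : ℕ), i < B.N ∧ a = i + m * B.N := by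
      refine ⟨a / B.N, (a % B.N).toNat, ?_, ?_⟩
      · have := Int.emod_lt_of_pos a hN
        have := Int.emod_nonneg a hN.ne'
        omega
      · rw [Int.toNat_of_nonneg (Int.emod_nonneg a hN.ne'), mul_comm, Int.emod_add_mul_ediv]
    obtain ⟨t, rfl⟩ : ∃ t', t = t' + m * B.N := ⟨t - m * B.N, by ring⟩
    rw [p_add_mul] at h2
    rw [B.y_add_mul, Finset.sum_eq_single i, Finset.sum_eq_single t]
    · rw [χ_y_self _ (by omega) (by omega), one_smul]
    · intro t' ht' hne
      rw [χ_y, if_neg, zero_smul]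
      omega
    · intro h
      exact absurd (Finset.mem_Ico.2 ⟨by omega, by omega⟩) h
    · intro i' hi' hne
      refine Finset.sum_eq_zero fun t' _ => ?_
      rw [χ_y, if_neg, zero_smul]
      rintro ⟨-, -, h5, -⟩
      have h6 := Finset.mem_range.1 hi'
      have h7 := Int.eq_zero_of_abs_lt_dvd h5 (by rw [abs_lt]; omega)
      omega
    · intro h
      exact absurd (Finset.mem_range.2 hi) h

end NakayamaBasis

end QuiverAlg

namespace QuiverAlg

namespace NakayamaBasis

variable {k : Type u} {A : Type v} [Field k] [Ring A] [Algebra k A] (B : NakayamaBasis k A)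

/-! ### Interval modules -/

/-- The elements of `A` whose coefficients at the paths from `a` to `t` vanish for `a ≤ t < b`. -/
def annihilator (a b : ℤ) : Submodule Aᵐᵒᵖ A where
  carrier := {z | ∀ t, a ≤ t → t < b → B.χ a t z = 0}
  zero_mem' := fun _ _ _ => map_zero _
  add_mem' := fun hz hw t h h' => by rw [map_add, hz t h h', hw t h h', add_zero]
  smul_mem' := fun w z hz t h h' => by
    obtain ⟨w, rfl⟩ := MulOpposite.op_surjective w
    rw [op_smul_eq_mul]
    induction w using B.induction with
    | zero => simp
    | add x y hx hy => rw [mul_add, map_add, hx, hy, add_zero]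
    | y c s u h1 h2 =>
      rw [mul_smul_comm, map_smul]
      by_cases h3 : (B.N : ℤ) ∣ u - t
      · obtain ⟨m, hm⟩ := h3
        obtain rfl : u = t + m * B.N := by linarith
        obtain ⟨s, rfl⟩ : ∃ s', s = s' + m * B.N := ⟨s - m * B.N, by ring⟩
        rw [y_add_mul, χ_mul_y _ (by omega)]
        by_cases h4 : a ≤ s
        · rw [hz s h4 (by omega), ite_self, smul_zero]
        -- No path from `a` ends at a point to the left of `a`, so nothing has to be assumed about
        -- `z` here.
        · rw [B.χ_eq_zero (s := a) (t := s) (by omega), ite_self, smul_zero]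
      · rw [B.χ_mul_y_eq_zero h3, smul_zero]

/-- The uniserial right module with a basis of the paths from `a` to `t` for `a ≤ t < b`. -/
abbrev Interval (a b : ℤ) : Type v := A ⧸ B.annihilator a b

/-- The class of `z` in an interval module. -/
abbrev cls (a b : ℤ) (z : A) : B.Interval a b := Submodule.Quotient.mk z

theorem cls_eq_zero {a b : ℤ} {z : A} :
    B.cls a b z = 0 ↔ ∀ t, a ≤ t → t < b → B.χ a t z = 0 :=
  Submodule.Quotient.mk_eq_zero _

theorem op_smul_cls {a b : ℤ} (z w : A) :
    MulOpposite.op w • B.cls a b z = B.cls a b (z * w) := rfl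

omit [Algebra k A] in
/-- Left multiplication as a map of right modules. -/
def leftMul (x : A) : A →ₗ[Aᵐᵒᵖ] A where
  toFun z := x * z
  map_add' := mul_add x
  map_smul' := fun w z => by
    obtain ⟨w, rfl⟩ := MulOpposite.op_surjective w
    simp [mul_assoc]

/-- The map `[a, b) → [a', b')` for `a' ≤ a` and `b' ≤ b` which factors over `[a, b')`. -/
def shift {a' a b' b : ℤ} (ha : a' ≤ a) (hb : b' ≤ b) :
    B.Interval a b →ₗ[Aᵐᵒᵖ] B.Interval a' b' :=
  Submodule.mapQ _ _ (leftMul (B.y a' a)) fun z hz t ht ht' => by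
    change B.χ a' t (B.y a' a * z) = 0
    rw [B.χ_y_mul ha]
    split_ifs with h
    · exact hz t h.1 (by omega)
    · rfl

theorem shift_cls {a' a b' b : ℤ} (ha : a' ≤ a) (hb : b' ≤ b) (z : A) :
    B.shift ha hb (B.cls a b z) = B.cls a' b' (B.y a' a * z) := rfl

/-- The assumption `b' ≤ p a'` ensures that prepending the path from `a'` to `a` kills no basis path
ending before `b'`, so the kernel consists of the part from `b'` on. -/
theorem shift_cls_eq_zero {a' a b' b : ℤ} (ha : a' ≤ a) (hb : b' ≤ b) (h : b' ≤ B.p a') {z : A} :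
    B.shift ha hb (B.cls a b z) = 0 ↔ ∀ t, a ≤ t → t < b' → B.χ a t z = 0 := by
  rw [shift_cls, cls_eq_zero]
  constructor
  · intro h1 t h2 h3
    have := h1 t (by omega) h3
    rwa [B.χ_y_mul ha, if_pos ⟨h2, by omega⟩] at this
  · intro h1 t h2 h3
    rw [B.χ_y_mul ha]
    split_ifs with h4
    · exact h1 t h4.1 h3
    · rfl

theorem χ_sum {a t b c : ℤ} (f : ℤ → k) :
    B.χ a t (∑ s ∈ Finset.Ico b c, f s • B.y a s) =
      if b ≤ t ∧ t < c ∧ a ≤ t ∧ t < B.p a then f t else 0 := by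
  simp only [map_sum, map_smul, χ_y, sub_self, dvd_zero, true_and, sub_left_inj]
  split_ifs with h
  · rw [Finset.sum_eq_single t]
    · simp [h]
    · intro s _ hs
      rw [if_neg (by tauto), smul_zero]
    · intro ht
      exact absurd (Finset.mem_Ico.2 ⟨h.1, h.2.1⟩) ht
  · refine Finset.sum_eq_zero fun s hs => ?_
    rw [Finset.mem_Ico] at hs
    rw [if_neg (by omega), smul_zero]

/-- The kernel of the second map is the part of `[a₁, b₁)` from `b₀` on, and the image of the first
is the part from `a₂` on. This one lemma yields every exact sequence below. -/
theorem shift_exact {a₀ a₁ a₂ b₀ b₁ b₂ : ℤ} (ha : a₀ ≤ a₁) (ha' : a₁ ≤ a₂) (hb : b₀ ≤ b₁)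
    (hb' : b₁ ≤ b₂) (h : a₂ = b₀) (hp : b₀ ≤ B.p a₀) :
    Function.Exact (B.shift ha' hb') (B.shift ha hb) := by
  intro x
  obtain ⟨z, rfl⟩ := Submodule.Quotient.mk_surjective _ x
  rw [B.shift_cls_eq_zero ha hb hp]
  constructor
  · intro h1
    refine ⟨B.cls _ _ (∑ s ∈ Finset.Ico a₂ b₁, B.χ a₁ s z • B.y a₂ s), ?_⟩
    rw [shift_cls, ← sub_eq_zero]
    refine B.cls_eq_zero.2 fun t ht ht' => ?_
    have := B.p_mono ha'
    rw [map_sub, B.χ_y_mul ha', χ_sum]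
    by_cases h2 : a₂ ≤ t
    · by_cases h3 : t < B.p a₁
      · rw [if_pos ⟨h2, h3⟩, if_pos ⟨h2, ht', h2, by omega⟩, sub_self]
      · rw [if_neg (by omega), B.χ_eq_zero (by omega), sub_self]
    · rw [if_neg (by omega), h1 t ht (by omega), sub_self]
  · rintro ⟨w, hw⟩ t ht ht'
    obtain ⟨w, rfl⟩ := Submodule.Quotient.mk_surjective _ w
    rw [shift_cls, ← sub_eq_zero] at hw
    have := B.cls_eq_zero.1 hw t ht (by omega)
    rw [map_sub, B.χ_y_mul ha', if_neg (by omega), zero_sub, neg_eq_zero] at this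
    exact this

theorem shift_surjective {a b' b : ℤ} (hb : b' ≤ b) :
    Function.Surjective (B.shift (le_refl a) hb) := by
  intro x
  obtain ⟨z, rfl⟩ := Submodule.Quotient.mk_surjective _ x
  refine ⟨B.cls _ _ z, ?_⟩
  rw [shift_cls, ← sub_eq_zero]
  refine B.cls_eq_zero.2 fun t ht ht' => ?_
  rw [map_sub, B.χ_y_mul le_rfl]
  split_ifs with h
  · exact sub_self _
  · rw [B.χ_eq_zero (by omega), sub_self]

theorem shift_injective {a' a b : ℤ} (ha : a' ≤ a) (h : b ≤ B.p a') :
    Function.Injective (B.shift ha (le_refl b)) := by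
  rw [injective_iff_map_eq_zero]
  intro x hx
  obtain ⟨z, rfl⟩ := Submodule.Quotient.mk_surjective _ x
  exact B.cls_eq_zero.2 ((B.shift_cls_eq_zero ha le_rfl h).1 hx)

theorem interval_subsingleton {a b : ℤ} (h : b ≤ a) : Subsingleton (B.Interval a b) := by
  refine ⟨fun x y => ?_⟩
  obtain ⟨z, rfl⟩ := Submodule.Quotient.mk_surjective _ x
  obtain ⟨w, rfl⟩ := Submodule.Quotient.mk_surjective _ y
  rw [← sub_eq_zero]
  exact B.cls_eq_zero.2 fun t h1 h2 => by omega

theorem interval_nontrivial {a b : ℤ} (h : a < b) : Nontrivial (B.Interval a b) := by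
  refine ⟨B.cls a b (B.y a a), 0, fun h' => ?_⟩
  have := B.cls_eq_zero.1 h' a le_rfl h
  rw [B.χ_y_self le_rfl (B.lt_p a)] at this
  exact one_ne_zero this

omit [Algebra k A] in
instance finite_regular : Module.Finite Aᵐᵒᵖ A := by
  refine ⟨⟨{1}, ?_⟩⟩
  rw [eq_top_iff]
  intro z _
  rw [Finset.coe_singleton, Submodule.mem_span_singleton]
  exact ⟨MulOpposite.op z, by simp⟩

omit [Algebra k A] in
instance projective_regular : Module.Projective Aᵐᵒᵖ A := by
  let e : Aᵐᵒᵖ ≃ₗ[Aᵐᵒᵖ] A :=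
    { MulOpposite.opAddEquiv.symm with
      map_smul' := fun w z => rfl }
  exact Module.Projective.of_equiv e

/-- An interval module is generated by any element with nonzero coefficient at the first path. -/
theorem eq_top_of_χ_ne_zero {a b : ℤ} {L : Submodule Aᵐᵒᵖ (B.Interval a b)} {w : A}
    (hw : B.cls a b w ∈ L) (h : B.χ a a w ≠ 0) : L = ⊤ := by
  -- `n` bounds the length of the final stretch on which `z` may have nonzero coefficients. The
  -- first of these, at `u`, is cancelled by a multiple of `w * y a u`.
  have key : ∀ (n : ℕ) (z : A), (∀ t, a ≤ t → t < b - n → B.χ a t z = 0) → B.cls a b z ∈ L := by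
    intro n
    induction n with
    | zero =>
      intro z hz
      rw [B.cls_eq_zero.2 fun t ht ht' => hz t ht (by simpa using ht')]
      exact L.zero_mem
    | succ n ih =>
      intro z hz
      by_cases hn : a ≤ b - n - 1
      · set u := b - n - 1 with hu
        set c : k := B.χ a u z * (B.χ a a w)⁻¹ with hc
        have h1 : B.cls a b (w * (c • B.y a u)) ∈ L :=
          L.smul_mem (MulOpposite.op (c • B.y a u)) hw
        have h2 : B.cls a b (z - w * (c • B.y a u)) ∈ L := by
          refine ih _ fun t ht ht' => ?_
          rw [map_sub, mul_smul_comm, map_smul]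
          rcases eq_or_lt_of_le (show t ≤ u by omega) with htu | htu
          · rw [htu]
            by_cases htp : u < B.p a
            · rw [B.χ_mul_y hn, if_pos htp, hc, smul_eq_mul, mul_assoc, inv_mul_cancel₀ h, mul_one,
                sub_self]
            · rw [B.χ_eq_zero (by omega), B.χ_eq_zero (by omega), smul_zero, sub_zero]
          · rw [hz t ht (by push_cast; omega), zero_sub, neg_eq_zero]
            -- On a cycle `u` and `t < u` may be the same vertex. A translate of the path `(a, u)`
            -- ending at `t` starts to the left of `a`, so it contributes nothing.
            by_cases h3 : (B.N : ℤ) ∣ u - t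
            · obtain ⟨m, hm⟩ := h3
              have h4 : B.y a u = B.y (a - m * B.N) t := by
                rw [← B.y_add_mul _ t m]
                congr 1 <;> linarith
              rw [h4, B.χ_mul_y (by linarith), B.χ_eq_zero (s := a) (by
                intro h5
                linarith), ite_self, smul_zero]
            · rw [B.χ_mul_y_eq_zero h3, smul_zero]
        have h3 := L.add_mem h2 h1
        rwa [← Submodule.Quotient.mk_add, sub_add_cancel] at h3
      · exact ih z fun t ht ht' => by omega
  rw [eq_top_iff]
  intro x _
  obtain ⟨z, rfl⟩ := Submodule.Quotient.mk_surjective _ x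
  exact key (b - a).toNat z fun t h1 h2 => by omega

/-- If `a' < a`, the image misses the path of length zero, so any complementary `L` contains an
element with nonzero coefficient there and is everything. If `b' ≤ a'`, the target is zero. -/
theorem isSuperfluous_range_shift {a' a b' b : ℤ} (ha : a' ≤ a) (hb : b' ≤ b)
    (h : a' < a ∨ b' ≤ a') : IsSuperfluous (LinearMap.range (B.shift ha hb)) := by
  intro L hL
  by_cases h' : b' ≤ a'
  · have := B.interval_subsingleton h'
    exact Subsingleton.elim _ _
  · have h1 : B.cls a' b' (B.y a' a') ∈ LinearMap.range (B.shift ha hb) ⊔ L :=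
      hL ▸ Submodule.mem_top
    obtain ⟨_, ⟨x, rfl⟩, l, hl, hxl⟩ := Submodule.mem_sup.1 h1
    obtain ⟨x, rfl⟩ := Submodule.Quotient.mk_surjective _ x
    obtain ⟨l, rfl⟩ := Submodule.Quotient.mk_surjective _ l
    refine B.eq_top_of_χ_ne_zero hl ?_
    rw [shift_cls, ← sub_eq_zero] at hxl
    have := B.cls_eq_zero.1 hxl a' le_rfl (by omega)
    rw [map_sub, map_add, B.χ_y_mul ha, if_neg (by omega), zero_add,
      B.χ_y_self le_rfl (B.lt_p a'), sub_eq_zero] at this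
    rw [this]
    exact one_ne_zero

end NakayamaBasis

end QuiverAlg

namespace QuiverAlg

namespace NakayamaBasis

variable {k : Type u} {A : Type v} [Field k] [Ring A] [Algebra k A] (B : NakayamaBasis k A)

/-! ### Maps out of interval modules; projective and injective intervals -/

theorem y_self_mul_eq_sum (a : ℤ) (z : A) :
    B.y a a * z = ∑ t ∈ Finset.Ico a (B.p a), B.χ a t z • B.y a t := by
  induction z using B.induction with
  | zero => simp
  | add z w hz hw => simp only [mul_add, map_add, add_smul, Finset.sum_add_distrib, hz, hw]
  | y c a' t' h1 h2 =>
    simp only [map_smul, smul_assoc, ← Finset.smul_sum, mul_smul_comm]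
    congr 1
    by_cases h3 : (B.N : ℤ) ∣ a' - a
    · obtain ⟨m, hm⟩ := h3
      obtain rfl : a' = a + m * B.N := by linarith
      obtain ⟨t', rfl⟩ : ∃ t'', t' = t'' + m * B.N := ⟨t' - m * B.N, by ring⟩
      rw [p_add_mul] at h2
      rw [y_add_mul, B.y_mul a a t' le_rfl (by omega), Finset.sum_eq_single t',
        χ_y_self _ (by omega) (by omega), one_smul]
      · intro t _ ht
        rw [χ_y, if_neg (by omega), zero_smul]
      · intro h
        exact absurd (Finset.mem_Ico.2 ⟨by omega, by omega⟩) h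
    · rw [B.y_mul_zero _ _ _ _ h3, Finset.sum_eq_zero]
      intro t _
      rw [χ_y, if_neg (fun h => h3 h.2.2.1), zero_smul]

section Lift

variable {X : Type w} [AddCommGroup X] [Module Aᵐᵒᵖ X]

omit [Algebra k A] in
/-- The map of right modules `A → X` with `1 ↦ x`. -/
def orbitMap (x : X) : A →ₗ[Aᵐᵒᵖ] X where
  toFun z := MulOpposite.op z • x
  map_add' z w := by rw [MulOpposite.op_add, add_smul]
  map_smul' w z := by
    obtain ⟨w, rfl⟩ := MulOpposite.op_surjective w
    rw [op_smul_eq_mul, MulOpposite.op_mul, mul_smul, RingHom.id_apply]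

/-- Well-definedness of `lift`: as `x = x e_a`, only `e_a z` matters; its coefficients before `b`
vanish by `hz` and its paths from `b` on kill `x`. -/
theorem op_smul_eq_zero {a b : ℤ} {x : X} (hx : MulOpposite.op (B.y a a) • x = x)
    (h : ∀ t, b ≤ t → MulOpposite.op (B.y a t) • x = 0) {z : A} (hz : z ∈ B.annihilator a b) :
    MulOpposite.op z • x = 0 := by
  rw [← hx, ← mul_smul, ← MulOpposite.op_mul, y_self_mul_eq_sum]
  change orbitMap x _ = 0
  rw [map_sum]
  refine Finset.sum_eq_zero fun t ht => ?_
  rw [Finset.mem_Ico] at ht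
  rcases lt_or_ge t b with htb | htb
  · rw [hz t ht.1 htb, zero_smul, map_zero]
  -- `X` carries no `k`-structure here, so the scalar is moved into a right factor in `A`.
  · rw [← mul_one (B.y a t), ← mul_smul_comm]
    change MulOpposite.op (B.y a t * (_ : A)) • x = 0
    rw [MulOpposite.op_mul, mul_smul, h t htb, smul_zero]

/-- The map `[a, b) → X` given by an element of `X`. -/
def lift {a b : ℤ} (x : X) (hx : MulOpposite.op (B.y a a) • x = x)
    (h : ∀ t, b ≤ t → MulOpposite.op (B.y a t) • x = 0) : B.Interval a b →ₗ[Aᵐᵒᵖ] X :=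
  Submodule.liftQ _ (orbitMap x) fun _ hz => B.op_smul_eq_zero hx h hz

end Lift

theorem y_eq_zero_of_p_le {a t : ℤ} (h : B.p a ≤ t) : B.y a t = 0 :=
  B.y_eq_zero _ _ (by omega)

/-- The inclusion of `[a, p a)` as a direct summand of the regular representation. -/
def inclusion (a : ℤ) : B.Interval a (B.p a) →ₗ[Aᵐᵒᵖ] A :=
  B.lift (B.y a a) (B.y_mul a a a le_rfl le_rfl) fun t ht => by
    rw [op_smul_eq_mul, B.y_eq_zero_of_p_le ht, mul_zero]

theorem mkQ_inclusion (a : ℤ) (x : B.Interval a (B.p a)) :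
    B.cls a (B.p a) (B.inclusion a x) = x := by
  obtain ⟨z, rfl⟩ := Submodule.Quotient.mk_surjective _ x
  rw [← sub_eq_zero]
  refine B.cls_eq_zero.2 fun t ht ht' => ?_
  change B.χ a t (B.y a a * z - z) = 0
  rw [map_sub, B.χ_y_mul le_rfl, if_pos ⟨ht, ht'⟩, sub_self]

instance projective_interval (a : ℤ) : Module.Projective Aᵐᵒᵖ (B.Interval a (B.p a)) :=
  Module.Projective.of_split (B.inclusion a) (Submodule.mkQ _)
    (LinearMap.ext fun x => B.mkQ_inclusion a x)

/-- The coefficient of the last path, as a linear functional on `[a, b)`. -/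
noncomputable def socleCoeff {a b : ℤ} (h : a < b) : B.Interval a b →ₗ[k] k :=
  (((B.annihilator a b).restrictScalars k).liftQ (B.χ a (b - 1))
    fun _ hz => hz (b - 1) (by omega) (by omega)) ∘ₗ
    (Submodule.Quotient.restrictScalarsEquiv k (B.annihilator a b)).symm.toLinearMap

theorem socleCoeff_cls {a b : ℤ} (h : a < b) (z : A) :
    B.socleCoeff h (B.cls a b z) = B.χ a (b - 1) z := rfl

/-- Multiplying by the path from `m` to `b - 1` moves the coefficient at `m` to the last place, so
the functional detects every coefficient. -/
theorem eq_zero_of_socleCoeff {a b : ℤ} (h : a < b) (hb : b ≤ B.p a) {x : B.Interval a b}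
    (hx : ∀ m, a ≤ m → m < b → B.socleCoeff h (MulOpposite.op (B.y m (b - 1)) • x) = 0) :
    x = 0 := by
  obtain ⟨z, rfl⟩ := Submodule.Quotient.mk_surjective _ x
  refine B.cls_eq_zero.2 fun m h1 h2 => ?_
  have := hx m h1 h2
  change B.χ a (b - 1) (z * B.y m (b - 1)) = 0 at this
  rwa [B.χ_mul_y (by omega), if_pos (by omega)] at this

/-- By `ha`, the nonzero paths ending at `b - 1` are exactly those from `m` with `a ≤ m < b`. So
`[a, b)` is the `k`-dual of a projective left module, and Baer's criterion reduces to extending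
linear functionals over `k`. -/
theorem injective_interval {a b : ℤ} (hab : a < b) (hb : b ≤ B.p a) (ha : ∀ s, s < a → B.p s < b) :
    Module.Injective Aᵐᵒᵖ (B.Interval a b) := by
  refine Module.Baer.injective fun I g => ?_
  let ν : I.restrictScalars k →ₗ[k] k := B.socleCoeff hab ∘ₗ g.restrictScalars k
  obtain ⟨μ, hμ⟩ := LinearMap.exists_extend ν
  have hμ' : ∀ x (hx : x ∈ I), μ x = B.socleCoeff hab (g ⟨x, hx⟩) := fun x hx =>
    LinearMap.congr_fun hμ ⟨x, hx⟩
  -- The element representing `μ`: its coefficient at `m` is the value of `μ` on the path from `m`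
  -- to `b - 1`.
  set z : B.Interval a b := B.cls a b
    (∑ m ∈ Finset.Ico a b, μ (MulOpposite.op (B.y m (b - 1))) • B.y a m) with hz
  have key : ∀ c : A, B.socleCoeff hab (MulOpposite.op (c * B.y (b - 1) (b - 1)) • z) =
      μ (MulOpposite.op (c * B.y (b - 1) (b - 1))) := by
    intro c
    induction c using B.induction with
    | zero => simp
    | add c d hc hd => rw [add_mul, MulOpposite.op_add, add_smul, map_add, map_add, hc, hd]
    | y r s t h1 h2 =>
      rw [smul_mul_assoc, MulOpposite.op_smul, smul_assoc, (B.socleCoeff hab).map_smul, μ.map_smul]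
      congr 1
      by_cases h3 : (B.N : ℤ) ∣ b - 1 - t
      · obtain ⟨m, hm⟩ := h3
        obtain rfl : t = b - 1 + (-m) * B.N := by linarith
        obtain ⟨s, rfl⟩ : ∃ s', s = s' + (-m) * B.N := ⟨s - (-m) * B.N, by ring⟩
        rw [p_add_mul] at h2
        rw [y_add_mul, B.y_mul s (b - 1) (b - 1) (by omega) le_rfl]
        have has : a ≤ s := by
          by_contra has
          have := ha s (by omega)
          omega
        rw [hz, op_smul_cls, socleCoeff_cls, B.χ_mul_y (by omega), if_pos (by omega), χ_sum,
          if_pos (by omega)]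
      · rw [B.y_mul_zero _ _ _ _ h3]
        simp
  refine ⟨LinearMap.toSpanSingleton _ _ z, fun x hx => ?_⟩
  rw [LinearMap.toSpanSingleton_apply, ← sub_eq_zero]
  refine B.eq_zero_of_socleCoeff hab hb fun m h1 h2 => ?_
  rw [smul_sub, map_sub, ← map_smul g, ← mul_smul, sub_eq_zero]
  obtain ⟨x, rfl⟩ := MulOpposite.op_surjective x
  have h3 := key (x * B.y m (b - 1))
  rw [mul_assoc, B.y_mul m (b - 1) (b - 1) (by omega) le_rfl, MulOpposite.op_mul] at h3
  exact h3.trans (hμ' _ (I.smul_mem _ hx))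

/-! ### Socles -/

section Socle

variable {X : Type w} [AddCommGroup X] [Module Aᵐᵒᵖ X]

/-- The elements killed by all arrows. -/
def socle (X : Type w) [AddCommGroup X] [Module Aᵐᵒᵖ X] : Set X :=
  {x | ∀ s t, s < t → MulOpposite.op (B.y s t) • x = 0}

/-- Some `x e_i` is nonzero; a longest path from `i` not killing `x` moves it into the socle, at the
end vertex `t` of that path. -/
theorem exists_mem_socle {L : Submodule Aᵐᵒᵖ X} (hL : L ≠ ⊥) :
    ∃ x ∈ L, x ≠ 0 ∧ x ∈ B.socle X ∧ ∃ t, MulOpposite.op (B.y t t) • x = x := by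
  obtain ⟨x, hx, hx0⟩ := L.ne_bot_iff.1 hL
  obtain ⟨i, hi⟩ : ∃ i : ℤ, MulOpposite.op (B.y i i) • x ≠ 0 := by
    by_contra! h
    refine hx0 ?_
    have h1 : orbitMap x (1 : A) = x := one_smul _ x
    rw [← h1, ← B.one, map_sum]
    exact Finset.sum_eq_zero fun i _ => h i
  obtain ⟨t, ht, ht'⟩ := Int.exists_greatest_of_bdd
    (P := fun t => i ≤ t ∧ MulOpposite.op (B.y i t) • x ≠ 0)
    ⟨B.p i, fun t ht => by
      by_contra h
      exact ht.2 (by rw [B.y_eq_zero_of_p_le (by omega), MulOpposite.op_zero, zero_smul])⟩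
    ⟨i, le_rfl, hi⟩
  refine ⟨_, L.smul_mem _ hx, ht.2, fun s u hsu => ?_, t, ?_⟩
  · rw [← mul_smul, ← MulOpposite.op_mul]
    by_cases h3 : (B.N : ℤ) ∣ s - t
    · obtain ⟨m, hm⟩ := h3
      obtain rfl : s = t + m * B.N := by linarith
      obtain ⟨u, rfl⟩ : ∃ u', u = u' + m * B.N := ⟨u - m * B.N, by ring⟩
      rw [y_add_mul, B.y_mul i t u ht.1 (by omega)]
      by_contra h
      have := ht' u ⟨by omega, h⟩
      omega
    · rw [B.y_mul_zero _ _ _ _ h3, MulOpposite.op_zero, zero_smul]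
  · rw [← mul_smul, ← MulOpposite.op_mul, B.y_mul i t t ht.1 le_rfl]

theorem isEssential_of_socle_subset {S : Submodule Aᵐᵒᵖ X} (h : B.socle X ⊆ S) :
    IsEssential S := by
  intro L hL
  by_contra hne
  obtain ⟨x, hx, hx0, hxs, -⟩ := B.exists_mem_socle hne
  have h1 : x ∈ S ⊓ L := ⟨h hxs, hx⟩
  rw [hL] at h1
  exact hx0 ((Submodule.mem_bot _).1 h1)

/-- The arrow from `t` to `t + 1` would carry a nonzero coefficient at `t` to a nonzero one at `t +
1`. So the socle is spanned by the last path. -/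
theorem χ_eq_zero_of_mem_socle {a b : ℤ} (hb : b ≤ B.p a) {z : A}
    (hz : B.cls a b z ∈ B.socle (B.Interval a b)) {t : ℤ} (ht : t < b - 1) : B.χ a t z = 0 := by
  by_cases h : a ≤ t
  · have h1 := B.cls_eq_zero.1 (hz t (t + 1) (by omega)) (t + 1) (by omega) (by omega)
    change B.χ a (t + 1) (z * B.y t (t + 1)) = 0 at h1
    rwa [B.χ_mul_y (by omega), if_pos (by omega)] at h1
  · exact B.χ_eq_zero (by omega) z

theorem socle_subset_ker_shift {a' a b' b : ℤ} (ha : a' ≤ a) (hb : b' ≤ b) (h : b' < b ∨ b ≤ a)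
    (hp : b' ≤ B.p a') (hp' : b ≤ B.p a) :
    B.socle (B.Interval a b) ⊆ LinearMap.ker (B.shift ha hb) := by
  intro x hx
  obtain ⟨z, rfl⟩ := Submodule.Quotient.mk_surjective _ x
  refine (B.shift_cls_eq_zero ha hb hp).2 fun t h1 h2 => ?_
  exact B.χ_eq_zero_of_mem_socle hp' hx (by omega)

/-- Two nonzero submodules of an interval module intersect. -/
theorem inf_ne_bot {a b : ℤ} (hab : a < b) (hb : b ≤ B.p a)
    {L L' : Submodule Aᵐᵒᵖ (B.Interval a b)} (hL : L ≠ ⊥) (hL' : L' ≠ ⊥) : L ⊓ L' ≠ ⊥ := by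
  have key : ∀ {L : Submodule Aᵐᵒᵖ (B.Interval a b)}, L ≠ ⊥ → B.cls a b (B.y a (b - 1)) ∈ L := by
    intro L hL
    obtain ⟨x, hx, hx0, hxs, -⟩ := B.exists_mem_socle hL
    obtain ⟨z, rfl⟩ := Submodule.Quotient.mk_surjective _ x
    have h1 : B.cls a b z = B.cls a b (B.χ a (b - 1) z • B.y a (b - 1)) := by
      rw [← sub_eq_zero]
      refine B.cls_eq_zero.2 fun t ht ht' => ?_
      rw [map_sub, map_smul, χ_y]
      rcases eq_or_lt_of_le (show t ≤ b - 1 by omega) with rfl | h2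
      · rw [if_pos ⟨ht, by omega, by simp, rfl⟩, smul_eq_mul, mul_one, sub_self]
      · rw [B.χ_eq_zero_of_mem_socle hb hxs h2, if_neg (by omega), smul_zero, sub_zero]
    have h2 : B.χ a (b - 1) z ≠ 0 := by
      intro h2
      rw [h2, zero_smul] at h1
      exact hx0 (h1.trans (B.cls_eq_zero.2 fun t _ _ => map_zero _))
    have hx' : B.cls a b (B.χ a (b - 1) z • B.y a (b - 1)) ∈ L := by
      rw [← h1]
      exact hx
    have h3 := L.smul_mem (MulOpposite.op (algebraMap k A (B.χ a (b - 1) z)⁻¹)) hx'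
    rw [op_smul_cls, ← Algebra.commutes, ← Algebra.smul_def, smul_smul, inv_mul_cancel₀ h2,
      one_smul] at h3
    exact h3
  refine (Submodule.ne_bot_iff _).2 ⟨_, ⟨key hL, key hL'⟩, fun h => ?_⟩
  have := B.cls_eq_zero.1 h (b - 1) (by omega) (by omega)
  rw [B.χ_y_self (by omega) (by omega)] at this
  exact one_ne_zero this

end Socle

end NakayamaBasis

end QuiverAlg

namespace QuiverAlg

/-! ### Resolutions from exact sequences of modules -/

section Resolutions

variable {R : Type u} [Ring R] {M : ModuleCat.{u} R} (X : ℕ → ModuleCat.{u} R)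

theorem comp_eq_zero_of_exact {X Y Z : ModuleCat.{u} R} {f : X ⟶ Y} {g : Y ⟶ Z}
    (h : Function.Exact f.hom g.hom) : f ≫ g = 0 := by
  ext x
  exact h.apply_apply_eq_zero x

theorem shortComplex_exact {X Y Z : ModuleCat.{u} R} {f : X ⟶ Y} {g : Y ⟶ Z}
    (h : Function.Exact f.hom g.hom) :
    (ShortComplex.mk f g (comp_eq_zero_of_exact h)).Exact :=
  (ShortComplex.ShortExact.moduleCat_exact_iff_function_exact _).2 h

theorem chainComplex_of_d (d : ∀ n, X (n + 1) ⟶ X n) (sq : ∀ n, d (n + 1) ≫ d n = 0) (n : ℕ) :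
    (ChainComplex.of X d sq).d (n + 1) n = d n :=
  ChainComplex.of_d X d n

theorem cochainComplex_of_d (d : ∀ n, X n ⟶ X (n + 1)) (sq : ∀ n, d n ≫ d (n + 1) = 0) (n : ℕ) :
    (CochainComplex.of X d sq).d n (n + 1) = d n :=
  CochainComplex.of_d X d n

/-- Allows replacing the differentials of a complex by the given maps, to which they are only
propositionally equal. -/
theorem shortComplex_exact_of_eq {X Y Z : ModuleCat.{u} R} {f f' : X ⟶ Y} {g g' : Y ⟶ Z}
    (h : Function.Exact f'.hom g'.hom) (hf : f = f') (hg : g = g') (w : f ≫ g = 0) :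
    (ShortComplex.mk f g w).Exact := by
  subst hf hg
  exact shortComplex_exact h

/-- The projective resolution given by a long exact sequence. -/
noncomputable def projectiveResolutionOfExact (d : ∀ n, X (n + 1) ⟶ X n) (π : X 0 ⟶ M)
    (hX : ∀ n, Projective (X n)) (hd : ∀ n, Function.Exact (d (n + 1)).hom (d n).hom)
    (h0 : Function.Exact (d 0).hom π.hom) (hπ : Function.Surjective π.hom) :
    ProjectiveResolution M where
  complex := ChainComplex.of X d fun n => comp_eq_zero_of_exact (hd n)
  projective := hX
  π := (ChainComplex.toSingle₀Equiv _ _).symm ⟨π, by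
    rw [chainComplex_of_d]
    exact comp_eq_zero_of_exact h0⟩
  quasiIso := ⟨fun n => by
    cases n
    · rw [ChainComplex.quasiIsoAt₀_iff, ShortComplex.quasiIso_iff_of_zeros']
      · refine ⟨shortComplex_exact_of_eq h0 (chainComplex_of_d X d
          (fun n => comp_eq_zero_of_exact (hd n)) 0) (ChainComplex.toSingle₀Equiv_symm_apply_f_zero _ _) _, ?_⟩
        have h1 : Epi (((ChainComplex.of X d fun n => comp_eq_zero_of_exact (hd n)).toSingle₀Equiv
            M).symm ⟨π, by
              rw [chainComplex_of_d]
              exact comp_eq_zero_of_exact h0⟩ |>.f 0) := by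
          rw [ChainComplex.toSingle₀Equiv_symm_apply_f_zero]
          exact (ModuleCat.epi_iff_surjective π).2 hπ
        exact h1
      all_goals rfl
    · rename_i n
      rw [quasiIsoAt_iff_exactAt']
      · rw [HomologicalComplex.exactAt_iff' _ (n + 2) (n + 1) n (by simp) (by simp)]
        exact shortComplex_exact_of_eq (hd n) (chainComplex_of_d X d _ (n + 1))
          (chainComplex_of_d X d _ n) _
      · apply ChainComplex.exactAt_succ_single_obj⟩

/-- The injective resolution given by a long exact sequence. -/
noncomputable def injectiveResolutionOfExact (d : ∀ n, X n ⟶ X (n + 1)) (ι : M ⟶ X 0)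
    (hX : ∀ n, Injective (X n)) (hd : ∀ n, Function.Exact (d n).hom (d (n + 1)).hom)
    (h0 : Function.Exact ι.hom (d 0).hom) (hι : Function.Injective ι.hom) :
    InjectiveResolution M where
  cocomplex := CochainComplex.of X d fun n => comp_eq_zero_of_exact (hd n)
  injective := hX
  ι := (CochainComplex.fromSingle₀Equiv _ _).symm ⟨ι, by
    rw [cochainComplex_of_d]
    exact comp_eq_zero_of_exact h0⟩
  quasiIso := ⟨fun n => by
    cases n
    · rw [CochainComplex.quasiIsoAt₀_iff, ShortComplex.quasiIso_iff_of_zeros]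
      · refine ⟨shortComplex_exact_of_eq h0 (CochainComplex.fromSingle₀Equiv_symm_apply_f_zero _ _)
          (cochainComplex_of_d X d (fun n => comp_eq_zero_of_exact (hd n)) 0) _, ?_⟩
        have h1 : Mono (((CochainComplex.of X d fun n =>
            comp_eq_zero_of_exact (hd n)).fromSingle₀Equiv M).symm ⟨ι, by
              rw [cochainComplex_of_d]
              exact comp_eq_zero_of_exact h0⟩ |>.f 0) := by
          rw [CochainComplex.fromSingle₀Equiv_symm_apply_f_zero]
          exact (ModuleCat.mono_iff_injective ι).2 hι
        exact h1
      all_goals rfl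
    · rename_i n
      rw [quasiIsoAt_iff_exactAt]
      · rw [HomologicalComplex.exactAt_iff' _ n (n + 1) (n + 2) (by simp) (by simp)]
        exact shortComplex_exact_of_eq (hd n) (cochainComplex_of_d X d _ n)
          (cochainComplex_of_d X d _ (n + 1)) _
      · apply CochainComplex.exactAt_succ_single_obj⟩

theorem projectiveResolutionOfExact_d (d : ∀ n, X (n + 1) ⟶ X n) (π : X 0 ⟶ M)
    (hX : ∀ n, Projective (X n)) (hd : ∀ n, Function.Exact (d (n + 1)).hom (d n).hom)
    (h0 : Function.Exact (d 0).hom π.hom) (hπ : Function.Surjective π.hom) (n : ℕ) :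
    (projectiveResolutionOfExact X d π hX hd h0 hπ).complex.d (n + 1) n = d n :=
  chainComplex_of_d X d (fun n => comp_eq_zero_of_exact (hd n)) n

theorem injectiveResolutionOfExact_d (d : ∀ n, X n ⟶ X (n + 1)) (ι : M ⟶ X 0)
    (hX : ∀ n, Injective (X n)) (hd : ∀ n, Function.Exact (d n).hom (d (n + 1)).hom)
    (h0 : Function.Exact ι.hom (d 0).hom) (hι : Function.Injective ι.hom) (n : ℕ) :
    (injectiveResolutionOfExact X d ι hX hd h0 hι).cocomplex.d n (n + 1) = d n :=
  cochainComplex_of_d X d (fun n => comp_eq_zero_of_exact (hd n)) n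

/-- A projective resolution given by a long exact sequence is minimal if the images of all
differentials are superfluous. -/
theorem isMinimal_projectiveResolutionOfExact (d : ∀ n, X (n + 1) ⟶ X n) (π : X 0 ⟶ M)
    (hX : ∀ n, Projective (X n)) (hd : ∀ n, Function.Exact (d (n + 1)).hom (d n).hom)
    (h0 : Function.Exact (d 0).hom π.hom) (hπ : Function.Surjective π.hom)
    (hf : ∀ n, Module.Finite R (X n)) (hs : ∀ n, IsSuperfluous (LinearMap.range (d n).hom)) :
    IsMinimalProjectiveResolution (projectiveResolutionOfExact X d π hX hd h0 hπ) where
  finite := hf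
  superfluous n := by
    rw [projectiveResolutionOfExact_d]
    exact hs n

/-- An injective resolution given by a long exact sequence is minimal if the kernels of all
differentials are essential. -/
theorem isMinimal_injectiveResolutionOfExact (d : ∀ n, X n ⟶ X (n + 1)) (ι : M ⟶ X 0)
    (hX : ∀ n, Injective (X n)) (hd : ∀ n, Function.Exact (d n).hom (d (n + 1)).hom)
    (h0 : Function.Exact ι.hom (d 0).hom) (hι : Function.Injective ι.hom)
    (hf : ∀ n, Module.Finite R (X n)) (hs : ∀ n, IsEssential (LinearMap.ker (d n).hom)) :
    IsMinimalInjectiveResolution (injectiveResolutionOfExact X d ι hX hd h0 hι) where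
  finite := hf
  essential n := by
    rw [injectiveResolutionOfExact_d]
    exact hs n

end Resolutions

/-! ### Homological dimensions of finite sums, and retracts of indecomposables -/

section Dimension

variable {C : Type u} [Category.{v} C] [Abelian C]

/-- Writing the identity as the sum of the `f i ≫ g i` splits an Ext class of `X` into pieces which
factor through Ext groups of the `Y i`. -/
theorem hasProjectiveDimensionLT_of_sum_eq_id {ι : Type*} [Fintype ι] {X : C} (Y : ι → C)
    (f : ∀ i, X ⟶ Y i) (g : ∀ i, Y i ⟶ X) (h : ∑ i, f i ≫ g i = 𝟙 X) (n : ℕ)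
    (hY : ∀ i, HasProjectiveDimensionLT (Y i) n) : HasProjectiveDimensionLT X n := by
  let := HasExt.standard C
  rw [hasProjectiveDimensionLT_iff]
  intro m hm Z e
  rw [← Abelian.Ext.mk₀_id_comp e, ← h, Abelian.Ext.mk₀_sum, Abelian.Ext.sum_comp]
  refine Finset.sum_eq_zero fun i _ => ?_
  rw [← Abelian.Ext.mk₀_comp_mk₀_assoc, Abelian.Ext.eq_zero_of_hasProjectiveDimensionLT
    ((Abelian.Ext.mk₀ (g i)).comp e (zero_add m)) n hm, Abelian.Ext.comp_zero]

theorem hasInjectiveDimensionLT_of_sum_eq_id {ι : Type*} [Fintype ι] {X : C} (Y : ι → C)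
    (f : ∀ i, X ⟶ Y i) (g : ∀ i, Y i ⟶ X) (h : ∑ i, f i ≫ g i = 𝟙 X) (n : ℕ)
    (hY : ∀ i, HasInjectiveDimensionLT (Y i) n) : HasInjectiveDimensionLT X n := by
  let := HasExt.standard C
  rw [hasInjectiveDimensionLT_iff]
  intro m hm Z e
  rw [← Abelian.Ext.comp_mk₀_id e, ← h, Abelian.Ext.mk₀_sum, Abelian.Ext.comp_sum]
  refine Finset.sum_eq_zero fun i _ => ?_
  rw [← Abelian.Ext.mk₀_comp_mk₀, ← Abelian.Ext.comp_assoc_of_second_deg_zero,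
    Abelian.Ext.eq_zero_of_hasInjectiveDimensionLT (e.comp (Abelian.Ext.mk₀ (f i)) (add_zero m))
      n hm, Abelian.Ext.zero_comp]

/-- A nonzero retract of an indecomposable object is isomorphic to it. -/
theorem nonempty_iso_of_retract {E X : C} (hE : Indecomposable E) (hX : ¬ Limits.IsZero X)
    (h : Retract X E) : Nonempty (E ≅ X) := by
  have : Epi h.r := (SplitEpi.mk h.i h.retract).epi
  let S : ShortComplex C := ShortComplex.mk (Limits.kernel.ι h.r) h.r (Limits.kernel.condition _)
  have hS : S.Exact := ShortComplex.exact_kernel h.r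
  have : Mono S.f := inferInstanceAs (Mono (Limits.kernel.ι h.r))
  have hs : S.Splitting := ShortComplex.Splitting.ofExactOfSection S hS h.i h.retract this
  rcases hE.2 _ _ hs.isoBinaryBiproduct with h1 | h1
  · have : Mono h.r := Preadditive.mono_of_kernel_zero (h1.eq_of_src _ _)
    have := isIso_of_mono_of_epi h.r
    exact ⟨asIso h.r⟩
  · exact absurd h1 hX

end Dimension

/-! ### Minimal injective resolutions -/

section Essential

variable {R : Type u} [Ring R]

theorem IsEssential.comap {M N : Type v} [AddCommGroup M] [Module R M] [AddCommGroup N]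
    [Module R N] {S : Submodule R N} (hS : IsEssential S) (f : M →ₗ[R] N) :
    IsEssential (S.comap f) := by
  intro L hL
  have h1 : L.map f = ⊥ := by
    refine hS _ ((Submodule.eq_bot_iff _).2 ?_)
    rintro _ ⟨hx, x, hxL, rfl⟩
    have h2 : x ∈ S.comap f ⊓ L := ⟨hx, hxL⟩
    rw [hL, Submodule.mem_bot] at h2
    rw [h2, map_zero]
  rw [← hL, eq_comm, inf_eq_right]
  intro x hx
  have h2 : f x ∈ L.map f := ⟨x, hx, rfl⟩
  rw [h1, Submodule.mem_bot] at h2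
  rw [Submodule.mem_comap, h2]
  exact S.zero_mem

theorem IsEssential.inf {M : Type v} [AddCommGroup M] [Module R M] {S T : Submodule R M}
    (hS : IsEssential S) (hT : IsEssential T) : IsEssential (S ⊓ T) := by
  intro L hL
  exact hT _ (hS _ (by rw [← inf_assoc, hL]))

theorem IsEssential.mono {M : Type v} [AddCommGroup M] [Module R M] {S T : Submodule R M}
    (hS : IsEssential S) (h : S ≤ T) : IsEssential T := by
  intro L hL
  exact hS _ (eq_bot_iff.2 (hL ▸ inf_le_inf_right L h))

/-- An endomorphism of a minimal injective resolution which is homotopic to the identity is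
injective. -/
theorem injective_of_homotopy {M : ModuleCat.{u} R} {I : InjectiveResolution M}
    (hI : IsMinimalInjectiveResolution I) {f : I.cocomplex ⟶ I.cocomplex}
    (h : Homotopy f (𝟙 I.cocomplex)) (n : ℕ) : Function.Injective (f.f n).hom := by
  have hc := h.comm n
  have h1 : IsEssential (LinearMap.ker (dNext n h.hom).hom) := by
    rw [Homotopy.dNext_cochainComplex]
    refine (hI.essential n).mono fun x hx => ?_
    rw [LinearMap.mem_ker] at hx ⊢
    rw [ModuleCat.hom_comp, LinearMap.comp_apply, hx, map_zero]
  have h2 : IsEssential (LinearMap.ker (prevD n h.hom).hom) := by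
    cases n with
    | zero =>
      rw [Homotopy.prevD_zero_cochainComplex]
      intro L hL
      rwa [ModuleCat.hom_zero, LinearMap.ker_zero, top_inf_eq] at hL
    | succ m =>
      rw [Homotopy.prevD_succ_cochainComplex]
      exact ((hI.essential m).comap (h.hom (m + 1) m).hom).mono fun x hx => hx
  rw [← LinearMap.ker_eq_bot]
  -- On the intersection of both kernels `f` is the identity; this intersection is essential, so the
  -- kernel of `f` vanishes.
  refine h1.inf h2 _ ((Submodule.eq_bot_iff _).2 ?_)
  rintro x ⟨⟨hx1, hx2⟩, hx3⟩
  have hx : (f.f n).hom x = (dNext n h.hom).hom x + (prevD n h.hom).hom x + x := by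
    rw [hc]; rfl
  rw [LinearMap.mem_ker.1 hx1, LinearMap.mem_ker.1 hx2, LinearMap.mem_ker.1 hx3] at hx
  simpa using hx.symm

/-- The terms of a minimal injective resolution of a retract of `M` are retracts of the terms of any
injective resolution of `M`. -/
theorem nonempty_retract_of_minimal {M M' : ModuleCat.{u} R} (e : Retract M M')
    {I : InjectiveResolution M} (hI : IsMinimalInjectiveResolution I) (I' : InjectiveResolution M')
    (n : ℕ) : Nonempty (Retract (I.cocomplex.X n) (I'.cocomplex.X n)) := by
  let f := InjectiveResolution.desc e.i I' I
  let g := InjectiveResolution.desc e.r I I'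
  have hfg : Homotopy (f ≫ g) (𝟙 I.cocomplex) :=
    ((InjectiveResolution.descCompHomotopy e.i e.r I I' I).symm.trans
      (Homotopy.ofEq (by rw [e.retract]))).trans (InjectiveResolution.descIdHomotopy M I)
  have h1 : Mono ((f ≫ g).f n) := (ModuleCat.mono_iff_injective _).2 (injective_of_homotopy hI hfg n)
  -- The composite is a monomorphism out of an injective object, so it has a left inverse, which
  -- corrects `g` to a retraction.
  refine ⟨⟨f.f n, g.f n ≫ Injective.factorThru (𝟙 _) ((f ≫ g).f n), ?_⟩⟩
  rw [← Category.assoc, ← HomologicalComplex.comp_f, Injective.comp_factorThru]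

end Essential

end QuiverAlg

namespace QuiverAlg

/-! ### The adjoint `q` and the interval modules as objects -/

/-- Dimension shift: dropping the first entry passes from a module to its first syzygy or cosyzygy.
-/
theorem stoppedOrbit_succ (f : ℤ → ℤ) (a b : ℤ) (n : ℕ) :
    stoppedOrbit f a b (n + 1) = stoppedOrbit f b (stoppedOrbit f a b 2) n := by
  induction n using Nat.twoStepInduction with
  | zero => rfl
  | one => rfl
  | more n ih1 ih2 => rw [stoppedOrbit, ih1, ih2, ← stoppedOrbit]

namespace NakayamaBasis

variable {k : Type u} {A : Type v} [Field k] [Ring A] [Algebra k A] (B : NakayamaBasis k A)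

/-- The least vertex `s` such that the path from `s` to `b - 1` is nonzero. -/
noncomputable def q (b : ℤ) : ℤ := sInf {s | b ≤ B.p s}

theorem gc : GaloisConnection B.q B.p := by
  intro b a
  have hN : (0 : ℤ) < B.N := by exact_mod_cast B.N_pos
  have hbdd : BddBelow {s | b ≤ B.p s} := by
    -- By periodicity `p` takes at this point the value `p 0 - (|p 0| + |b| + 1) * N`, which is less
    -- than `b`.
    refine ⟨-(|B.p 0| + |b| + 1) * B.N, fun s hs => ?_⟩
    by_contra! h
    have h1 := B.p_mono h.le
    have h2 := B.p_add_mul 0 (-(|B.p 0| + |b| + 1))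
    rw [zero_add] at h2
    have h3 := le_abs_self (B.p 0)
    have h4 := neg_abs_le b
    have h5 : b ≤ B.p s := hs
    nlinarith [abs_nonneg (B.p 0), abs_nonneg b]
  have hmem : b ≤ B.p (B.q b) := Int.csInf_mem (s := {s | b ≤ B.p s}) ⟨b, (B.lt_p b).le⟩ hbdd
  exact ⟨fun h => hmem.trans (B.p_mono h), fun h => csInf_le hbdd h⟩

theorem q_lt (b : ℤ) : B.q b < b := adjoint_lt B.gc B.lt_p b

theorem le_p_q (b : ℤ) : b ≤ B.p (B.q b) := B.gc.le_u_l b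

theorem q_add_mul (b c : ℤ) : B.q (b + c * B.N) = B.q b + c * B.N := by
  refine eq_of_forall_ge_iff fun a => ?_
  obtain ⟨a, rfl⟩ : ∃ a', a = a' + c * B.N := ⟨a - c * B.N, by ring⟩
  rw [B.gc.le_iff_le, p_add_mul, add_le_add_iff_right, add_le_add_iff_right, B.gc.le_iff_le]

/-- The interval modules as objects of the category of right modules. -/
abbrev obj (a b : ℤ) : ModuleCat.{v} Aᵐᵒᵖ := ModuleCat.of Aᵐᵒᵖ (B.Interval a b)

theorem isZero_obj {a b : ℤ} (h : b ≤ a) : Limits.IsZero (B.obj a b) := by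
  have := B.interval_subsingleton h
  exact ModuleCat.isZero_of_subsingleton _

theorem not_isZero_obj {a b : ℤ} (h : a < b) : ¬ Limits.IsZero (B.obj a b) := by
  intro h1
  have := B.interval_nontrivial h
  exact not_subsingleton (B.Interval a b) (ModuleCat.subsingleton_of_isZero h1)

theorem projective_obj {a b : ℤ} (h : b = B.p a ∨ b ≤ a) : Projective (B.obj a b) := by
  rcases h with rfl | h
  · exact (IsProjective.iff_projective _).1 (B.projective_interval a)
  · exact (B.isZero_obj h).projective

theorem injective_obj {a b : ℤ} (h : a = B.q b ∨ b ≤ a) : Injective (B.obj a b) := by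
  rcases h with rfl | h
  · have := B.injective_interval (B.q_lt b) (B.le_p_q b) fun s hs => by
      by_contra! h
      exact absurd ((B.gc _ _).2 h) hs.not_ge
    exact Module.injective_object_of_injective_module _ _
  · exact (B.isZero_obj h).injective

/-- A section of `[a, p a) → [a, b)` must be onto because the kernel is superfluous; hence the
kernel, which contains the path from `a` to `b` if `b < p a`, is zero. -/
theorem eq_p_of_projective {a b : ℤ} (hab : a < b) (hb : b ≤ B.p a)
    (h : Projective (B.obj a b)) : b = B.p a := by
  by_contra hne
  have hP : Module.Projective Aᵐᵒᵖ (B.Interval a b) := (IsProjective.iff_projective _).2 h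
  obtain ⟨s, hs⟩ := Module.projective_lifting_property (B.shift (le_refl a) hb) LinearMap.id
    (B.shift_surjective hb)
  have h1 : LinearMap.range (B.shift hab.le (le_refl (B.p a))) ⊔ LinearMap.range s = ⊤ := by
    rw [eq_top_iff]
    intro x _
    have h2 : B.shift (le_refl a) hb (x - s (B.shift (le_refl a) hb x)) = 0 := by
      rw [map_sub, sub_eq_zero]
      exact (LinearMap.congr_fun hs _).symm
    obtain ⟨w, hw⟩ := (B.shift_exact (le_refl a) hab.le hb (le_refl (B.p a)) rfl hb _).1 h2
    exact Submodule.mem_sup.2 ⟨_, ⟨w, hw⟩, _, ⟨_, rfl⟩, sub_add_cancel _ _⟩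
  have h2 := B.isSuperfluous_range_shift hab.le (le_refl (B.p a)) (Or.inl hab) _ h1
  have h3 : B.cls a (B.p a) (B.y a b) ∈ LinearMap.range s := h2 ▸ Submodule.mem_top
  obtain ⟨w, hw⟩ := h3
  have h4 : B.shift (le_refl a) hb (B.cls a (B.p a) (B.y a b)) = 0 := by
    refine (B.shift_cls_eq_zero le_rfl hb hb).2 fun t h5 h6 => ?_
    rw [χ_y, if_neg (by omega)]
  have h5 : w = 0 := by
    rw [← hw] at h4
    exact (LinearMap.congr_fun hs w).symm.trans h4
  rw [h5, map_zero] at hw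
  have h6 := B.cls_eq_zero.1 hw.symm b hab.le (by omega)
  rw [B.χ_y_self hab.le (by omega)] at h6
  exact one_ne_zero h6

theorem eq_q_of_injective {a b : ℤ} (hab : a < b) (hb : b ≤ B.p a)
    (h : Injective (B.obj a b)) : a = B.q b := by
  have hq : B.q b ≤ a := (B.gc _ _).2 hb
  by_contra hne
  let i : B.obj a b ⟶ B.obj (B.q b) b := ModuleCat.ofHom (B.shift hq (le_refl b))
  have hi : Mono i := (ModuleCat.mono_iff_injective i).2 (B.shift_injective hq (B.le_p_q b))
  let r := Injective.factorThru (𝟙 _) i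
  have hr : ∀ x, r.hom (B.shift hq (le_refl b) x) = x := fun x =>
    LinearMap.congr_fun (congrArg ModuleCat.Hom.hom (Injective.comp_factorThru (𝟙 _) i)) x
  have h1 : LinearMap.ker r.hom = ⊥ := by
    refine B.isEssential_of_socle_subset (S := LinearMap.range (B.shift hq (le_refl b))) ?_ _ ?_
    · rw [← LinearMap.exact_iff.1 (B.shift_exact (le_refl (B.q b)) hq hab.le (le_refl b) rfl
        (hab.le.trans (B.le_p_q b)))]
      exact B.socle_subset_ker_shift _ _ (Or.inl hab) (hab.le.trans (B.le_p_q b)) (B.le_p_q b)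
    · refine (Submodule.eq_bot_iff _).2 ?_
      rintro _ ⟨⟨x, rfl⟩, hx⟩
      rw [← hr x, LinearMap.mem_ker.1 hx, map_zero]
  have h2 : B.shift hq (le_refl b) (r.hom (B.cls _ _ (B.y (B.q b) (B.q b)))) =
      B.cls _ _ (B.y (B.q b) (B.q b)) :=
    LinearMap.ker_eq_bot.1 h1 (hr _)
  obtain ⟨z, hz⟩ := Submodule.Quotient.mk_surjective _ (r.hom (B.cls _ _ (B.y (B.q b) (B.q b))))
  rw [← hz, shift_cls, ← sub_eq_zero] at h2
  have h3 := B.cls_eq_zero.1 h2 (B.q b) le_rfl (B.q_lt b)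
  rw [map_sub, B.χ_y_mul hq, if_neg (by omega), B.χ_y_self le_rfl (B.lt_p _)] at h3
  simp at h3

/-- Two nonzero summands would be submodules with zero intersection, but all nonzero submodules
contain the socle. -/
theorem indecomposable_obj {a b : ℤ} (hab : a < b) (hb : b ≤ B.p a) :
    Indecomposable (B.obj a b) := by
  refine ⟨B.not_isZero_obj hab, fun Y Z e => ?_⟩
  by_contra! h
  have key : ∀ {W : ModuleCat.{v} Aᵐᵒᵖ} (f : W ⟶ B.obj a b) (_ : Mono f),
      ¬ Limits.IsZero W → LinearMap.range f.hom ≠ ⊥ := by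
    intro W f hf hW h1
    refine hW ?_
    rw [LinearMap.range_eq_bot] at h1
    exact Limits.IsZero.of_mono_eq_zero f (ModuleCat.hom_ext h1)
  refine B.inf_ne_bot hab hb (key (Limits.biprod.inl ≫ e.inv) inferInstance h.1)
    (key (Limits.biprod.inr ≫ e.inv) inferInstance h.2) ((Submodule.eq_bot_iff _).2 ?_)
  rintro _ ⟨⟨y, rfl⟩, z, hz⟩
  have h1 : ((Limits.biprod.inr ≫ e.inv) ≫ e.hom ≫ Limits.biprod.fst).hom z =
      ((Limits.biprod.inl ≫ e.inv) ≫ e.hom ≫ Limits.biprod.fst).hom y :=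
    congrArg (e.hom ≫ Limits.biprod.fst).hom hz
  simp only [Category.assoc, Iso.inv_hom_id_assoc, Limits.biprod.inr_fst,
    Limits.biprod.inl_fst] at h1
  have h2 : y = 0 := h1.symm
  rw [h2, map_zero]

/-! ### Homological dimensions -/

theorem stoppedOrbit_p_le {a b : ℤ} (hab : a ≤ b) (hb : b ≤ B.p a) :
    b ≤ stoppedOrbit B.p a b 2 ∧ stoppedOrbit B.p a b 2 ≤ B.p b := by
  have h1 := B.p_mono hab
  have h2 := B.lt_p b
  simp only [stoppedOrbit]
  split_ifs <;> omega

theorem stoppedOrbit_q_le {a b : ℤ} (hb : b ≤ B.p a) :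
    stoppedOrbit B.q b a 2 ≤ a ∧ b ≤ B.p (stoppedOrbit B.q b a 2) := by
  rcases eq_or_ne b a with h | h
  · rw [stoppedOrbit_of_eq (n := 0) h]
    exact ⟨le_rfl, hb⟩
  · rw [stoppedOrbit_of_ne (n := 0) h]
    exact ⟨(B.gc _ _).2 hb, B.le_p_q b⟩

/-- The short exact sequence `0 → [b, c) → [a, c) → [a, b) → 0`. -/
abbrev shiftComplex {a b c : ℤ} (hab : a ≤ b) (hbc : b ≤ c) (hc : c ≤ B.p a) :
    ShortComplex (ModuleCat.{v} Aᵐᵒᵖ) :=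
  ShortComplex.mk (X₁ := B.obj b c) (X₂ := B.obj a c) (X₃ := B.obj a b)
    (ModuleCat.ofHom (B.shift hab (le_refl c))) (ModuleCat.ofHom (B.shift (le_refl a) hbc))
    (comp_eq_zero_of_exact (B.shift_exact (le_refl a) hab hbc (le_refl c) rfl (hbc.trans hc)))

theorem shiftComplex_shortExact {a b c : ℤ} (hab : a ≤ b) (hbc : b ≤ c) (hc : c ≤ B.p a) :
    (B.shiftComplex hab hbc hc).ShortExact where
  exact := shortComplex_exact (B.shift_exact (le_refl a) hab hbc (le_refl c) rfl (hbc.trans hc))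
  mono_f := (ModuleCat.mono_iff_injective _).2 (B.shift_injective hab hc)
  epi_g := (ModuleCat.epi_iff_surjective _).2 (B.shift_surjective hbc)

/-- Dimension shift along `0 → [b, c) → [a, c) → [a, b) → 0`, where `c` is the entry of index 2. The
equality says that the syzygy of degree `n + 1` is zero. For `a = b` all three modules are zero. -/
theorem hasProjectiveDimensionLT_obj_iff {a b : ℤ} (hab : a ≤ b) (hb : b ≤ B.p a) (n : ℕ) :
    HasProjectiveDimensionLT (B.obj a b) (n + 1) ↔
      stoppedOrbit B.p a b (n + 1) = stoppedOrbit B.p a b (n + 2) := by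
  induction n generalizing a b with
  | zero =>
    rw [zero_add, ← projective_iff_hasProjectiveDimensionLT_one]
    rcases eq_or_ne a b with h | h
    · have h1 : stoppedOrbit B.p a b 2 = b := stoppedOrbit_of_eq (n := 0) h
      exact iff_of_true (B.projective_obj (Or.inr h.ge)) h1.symm
    · have h1 : stoppedOrbit B.p a b 2 = B.p a := stoppedOrbit_of_ne (n := 0) h
      rw [zero_add, h1]
      exact ⟨B.eq_p_of_projective (lt_of_le_of_ne hab h) hb, fun h => B.projective_obj (Or.inl h)⟩
  | succ n ih =>
    have h1 := B.stoppedOrbit_p_le hab hb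
    rw [stoppedOrbit_succ _ a b (n + 1), stoppedOrbit_succ _ a b (n + 2), ← ih h1.1 h1.2]
    have h2 : stoppedOrbit B.p a b 2 ≤ B.p a := by
      rcases eq_or_ne a b with h | h
      · exact (stoppedOrbit_of_eq (n := 0) h).trans_le hb
      · exact (stoppedOrbit_of_ne (n := 0) h).le
    refine (B.shiftComplex_shortExact hab h1.1 h2).hasProjectiveDimensionLT_X₃_iff n
      (B.projective_obj ?_)
    rcases eq_or_ne a b with h | h
    · exact Or.inr ((stoppedOrbit_of_eq (n := 0) h).trans_le h.ge)
    · exact Or.inl (stoppedOrbit_of_ne (n := 0) h)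

theorem hasInjectiveDimensionLT_obj_iff {a b : ℤ} (hab : a ≤ b) (hb : b ≤ B.p a) (n : ℕ) :
    HasInjectiveDimensionLT (B.obj a b) (n + 1) ↔
      stoppedOrbit B.q b a (n + 1) = stoppedOrbit B.q b a (n + 2) := by
  induction n generalizing a b with
  | zero =>
    rw [zero_add, ← injective_iff_hasInjectiveDimensionLT_one]
    rcases eq_or_ne b a with h | h
    · have h1 : stoppedOrbit B.q b a 2 = a := stoppedOrbit_of_eq (n := 0) h
      exact iff_of_true (B.injective_obj (Or.inr h.le)) h1.symm
    · have h1 : stoppedOrbit B.q b a 2 = B.q b := stoppedOrbit_of_ne (n := 0) h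
      rw [zero_add, h1]
      exact ⟨B.eq_q_of_injective (lt_of_le_of_ne hab h.symm) hb,
        fun h => B.injective_obj (Or.inl h)⟩
  | succ n ih =>
    have h1 := B.stoppedOrbit_q_le hb
    rw [stoppedOrbit_succ _ b a (n + 1), stoppedOrbit_succ _ b a (n + 2),
      ← ih h1.1 (hab.trans h1.2)]
    refine ((B.shiftComplex_shortExact h1.1 hab h1.2).hasInjectiveDimensionLT_X₃_iff n
      (B.injective_obj ?_)).symm
    rcases eq_or_ne b a with h | h
    · exact Or.inr (h.le.trans (stoppedOrbit_of_eq (n := 0) h).ge)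
    · exact Or.inl (stoppedOrbit_of_ne (n := 0) h)

/-! ### Minimal resolutions -/

theorem stoppedOrbit_p_bounds {a b : ℤ} (hab : a ≤ b) (hb : b ≤ B.p a) (n : ℕ) :
    stoppedOrbit B.p a b n ≤ stoppedOrbit B.p a b (n + 1) ∧
      stoppedOrbit B.p a b (n + 1) ≤ B.p (stoppedOrbit B.p a b n) := by
  induction n generalizing a b with
  | zero => exact ⟨hab, hb⟩
  | succ n ih =>
    have h1 := B.stoppedOrbit_p_le hab hb
    rw [stoppedOrbit_succ _ a b n, stoppedOrbit_succ _ a b (n + 1)]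
    exact ih h1.1 h1.2

theorem stoppedOrbit_q_bounds {a b : ℤ} (hab : a ≤ b) (hb : b ≤ B.p a) (n : ℕ) :
    stoppedOrbit B.q b a (n + 1) ≤ stoppedOrbit B.q b a n ∧
      stoppedOrbit B.q b a n ≤ B.p (stoppedOrbit B.q b a (n + 1)) := by
  induction n generalizing a b with
  | zero => exact ⟨hab, hb⟩
  | succ n ih =>
    have h1 := B.stoppedOrbit_q_le hb
    rw [stoppedOrbit_succ _ b a n, stoppedOrbit_succ _ b a (n + 1)]
    exact ih h1.1 (hab.trans h1.2)

end NakayamaBasis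

end QuiverAlg

namespace QuiverAlg

/-- The dichotomy behind the terms of the resolutions: the interval between entries `n` and `n + 2`
is a full projective or injective, or it is empty. -/
theorem stoppedOrbit_two (f : ℤ → ℤ) (a b : ℤ) (n : ℕ) :
    stoppedOrbit f a b n ≠ stoppedOrbit f a b (n + 1) ∧
      stoppedOrbit f a b (n + 2) = f (stoppedOrbit f a b n) ∨
    stoppedOrbit f a b n = stoppedOrbit f a b (n + 1) ∧
      stoppedOrbit f a b (n + 2) = stoppedOrbit f a b n := by
  by_cases h : stoppedOrbit f a b n = stoppedOrbit f a b (n + 1)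
  · exact Or.inr ⟨h, (stoppedOrbit_of_eq h).trans h.symm⟩
  · exact Or.inl ⟨h, stoppedOrbit_of_ne h⟩

namespace NakayamaBasis

variable {k : Type u} {A : Type v} [Field k] [Ring A] [Algebra k A] (B : NakayamaBasis k A)

section Projective

variable {a b : ℤ} (hab : a ≤ b) (hb : b ≤ B.p a)

/-- The `n`-th term of the minimal projective resolution of `[a, b)`. -/
abbrev projTerm (a b : ℤ) (n : ℕ) : ModuleCat.{v} Aᵐᵒᵖ :=
  B.obj (stoppedOrbit B.p a b n) (stoppedOrbit B.p a b (n + 2))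

include hab hb in
theorem stoppedOrbit_p_mono (n : ℕ) :
    stoppedOrbit B.p a b n ≤ stoppedOrbit B.p a b (n + 1) :=
  (B.stoppedOrbit_p_bounds hab hb n).1

theorem stoppedOrbit_p_le_p (a b : ℤ) (n : ℕ) :
    stoppedOrbit B.p a b (n + 2) ≤ B.p (stoppedOrbit B.p a b n) := by
  rcases stoppedOrbit_two B.p a b n with h | h
  · exact h.2.le
  · exact h.2.trans_le (B.lt_p _).le

theorem projective_projTerm (a b : ℤ) (n : ℕ) : Projective (B.projTerm a b n) :=
  B.projective_obj <| by
    rcases stoppedOrbit_two B.p a b n with h | h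
    · exact Or.inl h.2
    · exact Or.inr h.2.le

/-- The differential of the minimal projective resolution of `[a, b)`. -/
def projDiff (n : ℕ) : B.projTerm a b (n + 1) →ₗ[Aᵐᵒᵖ] B.projTerm a b n :=
  B.shift (B.stoppedOrbit_p_mono hab hb n) (B.stoppedOrbit_p_mono hab hb (n + 2))

/-- The augmentation of the minimal projective resolution of `[a, b)`. -/
def projCounit : B.projTerm a b 0 →ₗ[Aᵐᵒᵖ] B.Interval a b :=
  B.shift (le_refl a) (B.stoppedOrbit_p_mono hab hb 1)

/-- The right end of term `n` is the left end of term `n + 2`, which is the matching condition in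
`shift_exact`. -/
theorem projDiff_exact (n : ℕ) :
    Function.Exact (B.projDiff hab hb (n + 1)) (B.projDiff hab hb n) :=
  B.shift_exact (B.stoppedOrbit_p_mono hab hb n) (B.stoppedOrbit_p_mono hab hb (n + 1))
    (B.stoppedOrbit_p_mono hab hb (n + 2)) (B.stoppedOrbit_p_mono hab hb (n + 3)) rfl
    (B.stoppedOrbit_p_le_p a b n)

theorem projCounit_exact : Function.Exact (B.projDiff hab hb 0) (B.projCounit hab hb) :=
  B.shift_exact (le_refl a) (B.stoppedOrbit_p_mono hab hb 0) (B.stoppedOrbit_p_mono hab hb 1)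
    (B.stoppedOrbit_p_mono hab hb 2) rfl hb

/-- The minimal projective resolution of `[a, b)`. -/
noncomputable def projRes : ProjectiveResolution (B.obj a b) :=
  projectiveResolutionOfExact (B.projTerm a b) (fun n => ModuleCat.ofHom (B.projDiff hab hb n))
    (ModuleCat.ofHom (B.projCounit hab hb)) (B.projective_projTerm a b)
    (B.projDiff_exact hab hb) (B.projCounit_exact hab hb)
    (B.shift_surjective (B.stoppedOrbit_p_mono hab hb 1))

theorem projRes_X (n : ℕ) : (B.projRes hab hb).complex.X n = B.projTerm a b n := rfl

omit [Algebra k A] in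
theorem finite_quotient (N : Submodule Aᵐᵒᵖ A) : Module.Finite Aᵐᵒᵖ (A ⧸ N) := inferInstance

theorem isMinimal_projRes : IsMinimalProjectiveResolution (B.projRes hab hb) :=
  isMinimal_projectiveResolutionOfExact _ _ _ _ _ _ _ (fun n => finite_quotient _) fun n =>
    B.isSuperfluous_range_shift (B.stoppedOrbit_p_mono hab hb n)
        (B.stoppedOrbit_p_mono hab hb (n + 2)) <| by
      rcases stoppedOrbit_two B.p a b n with h | h
      · exact Or.inl (lt_of_le_of_ne (B.stoppedOrbit_p_mono hab hb n) h.1)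
      · exact Or.inr h.2.le

theorem isLastNonzeroTerm_projRes {d : ℕ}
    (h : stoppedOrbit B.p a b d ≠ stoppedOrbit B.p a b (d + 1))
    (h' : stoppedOrbit B.p a b (d + 1) = stoppedOrbit B.p a b (d + 2)) :
    IsLastNonzeroTerm (B.projRes hab hb) d := by
  refine ⟨?_, fun n hn => ?_⟩
  · rw [projRes_X]
    refine B.not_isZero_obj ?_
    rw [← h']
    exact lt_of_le_of_ne (B.stoppedOrbit_p_mono hab hb d) h
  · rw [projRes_X]
    refine B.isZero_obj ?_
    rw [stoppedOrbit_stationary h' (show d + 1 ≤ n + 2 by omega),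
      stoppedOrbit_stationary h' (show d + 1 ≤ n by omega)]

theorem stoppedOrbit_of_isLastNonzeroTerm {d : ℕ}
    (h : IsLastNonzeroTerm (B.projRes hab hb) d) :
    stoppedOrbit B.p a b d ≠ stoppedOrbit B.p a b (d + 1) ∧
      stoppedOrbit B.p a b (d + 1) = stoppedOrbit B.p a b (d + 2) := by
  constructor
  · intro h1
    refine h.1 ?_
    rw [projRes_X]
    exact B.isZero_obj ((stoppedOrbit_of_eq h1).trans_le h1.ge)
  · by_contra h1
    have h2 := h.2 (d + 1) (by omega)
    rw [projRes_X] at h2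
    refine B.not_isZero_obj ?_ h2
    exact (lt_of_le_of_ne (B.stoppedOrbit_p_mono hab hb (d + 1)) h1).trans_le
      (B.stoppedOrbit_p_mono hab hb (d + 2))

end Projective

section Injective

variable {a b : ℤ} (hab : a ≤ b) (hb : b ≤ B.p a)

/-- The `n`-th term of the minimal injective resolution of `[a, b)`. -/
noncomputable abbrev injTerm (a b : ℤ) (n : ℕ) : ModuleCat.{v} Aᵐᵒᵖ :=
  B.obj (stoppedOrbit B.q b a (n + 2)) (stoppedOrbit B.q b a n)

include hab hb in
theorem stoppedOrbit_q_anti (n : ℕ) :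
    stoppedOrbit B.q b a (n + 1) ≤ stoppedOrbit B.q b a n :=
  (B.stoppedOrbit_q_bounds hab hb n).1

theorem stoppedOrbit_q_le_p (a b : ℤ) (n : ℕ) :
    stoppedOrbit B.q b a n ≤ B.p (stoppedOrbit B.q b a (n + 2)) := by
  rcases stoppedOrbit_two B.q b a n with h | h
  · rw [h.2]
    exact B.le_p_q _
  · rw [h.2]
    exact (B.lt_p _).le

theorem injective_injTerm (a b : ℤ) (n : ℕ) : Injective (B.injTerm a b n) :=
  B.injective_obj <| by
    rcases stoppedOrbit_two B.q b a n with h | h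
    · exact Or.inl h.2
    · exact Or.inr h.2.ge

/-- The differential of the minimal injective resolution of `[a, b)`. -/
noncomputable def injDiff (n : ℕ) : B.injTerm a b n →ₗ[Aᵐᵒᵖ] B.injTerm a b (n + 1) :=
  B.shift (B.stoppedOrbit_q_anti hab hb (n + 2)) (B.stoppedOrbit_q_anti hab hb n)

/-- The coaugmentation of the minimal injective resolution of `[a, b)`. -/
noncomputable def injUnit : B.Interval a b →ₗ[Aᵐᵒᵖ] B.injTerm a b 0 :=
  B.shift (B.stoppedOrbit_q_anti hab hb 1) (le_refl b)

theorem injDiff_exact (n : ℕ) : Function.Exact (B.injDiff hab hb n) (B.injDiff hab hb (n + 1)) :=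
  B.shift_exact (B.stoppedOrbit_q_anti hab hb (n + 3)) (B.stoppedOrbit_q_anti hab hb (n + 2))
    (B.stoppedOrbit_q_anti hab hb (n + 1)) (B.stoppedOrbit_q_anti hab hb n) rfl
    (B.stoppedOrbit_q_le_p a b (n + 2))

theorem injUnit_exact : Function.Exact (B.injUnit hab hb) (B.injDiff hab hb 0) :=
  B.shift_exact (B.stoppedOrbit_q_anti hab hb 2) (B.stoppedOrbit_q_anti hab hb 1)
    (B.stoppedOrbit_q_anti hab hb 0) (le_refl b) rfl (B.stoppedOrbit_q_le_p a b 1)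

theorem injUnit_injective : Function.Injective (B.injUnit hab hb) :=
  B.shift_injective _ (B.stoppedOrbit_q_le_p a b 0)

theorem socle_subset_ker_injDiff (n : ℕ) :
    B.socle (B.injTerm a b n) ⊆ LinearMap.ker (B.injDiff hab hb n) := by
  refine B.socle_subset_ker_shift _ _ ?_ (B.stoppedOrbit_q_le_p a b (n + 1))
    (B.stoppedOrbit_q_le_p a b n)
  rcases stoppedOrbit_two B.q b a n with h | h
  · exact Or.inl (lt_of_le_of_ne (B.stoppedOrbit_q_anti hab hb n) h.1.symm)
  · exact Or.inr h.2.ge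

/-- The minimal injective resolution of `[a, b)`. -/
noncomputable def injRes : InjectiveResolution (B.obj a b) :=
  injectiveResolutionOfExact (B.injTerm a b) (fun n => ModuleCat.ofHom (B.injDiff hab hb n))
    (ModuleCat.ofHom (B.injUnit hab hb)) (B.injective_injTerm a b)
    (B.injDiff_exact hab hb) (B.injUnit_exact hab hb) (B.injUnit_injective hab hb)

theorem isMinimal_injRes : IsMinimalInjectiveResolution (B.injRes hab hb) :=
  isMinimal_injectiveResolutionOfExact _ _ _ _ _ _ _ (fun _ => finite_quotient _) fun n =>
    B.isEssential_of_socle_subset (B.socle_subset_ker_injDiff hab hb n)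

end Injective

end NakayamaBasis

/-! ### Finite products of modules -/

section Pi

variable {R : Type u} [Ring R] {ι : Type w} {X Y Z : ι → Type v} [∀ i, AddCommGroup (X i)]
  [∀ i, Module R (X i)] [∀ i, AddCommGroup (Y i)] [∀ i, Module R (Y i)] [∀ i, AddCommGroup (Z i)]
  [∀ i, Module R (Z i)]

theorem piMap_exact {f : ∀ i, X i →ₗ[R] Y i} {g : ∀ i, Y i →ₗ[R] Z i}
    (h : ∀ i, Function.Exact (f i) (g i)) :
    Function.Exact (LinearMap.piMap f) (LinearMap.piMap g) := by
  intro y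
  constructor
  · intro hy
    choose x hx using fun i => (h i (y i)).1 (congrFun hy i)
    exact ⟨x, funext hx⟩
  · rintro ⟨x, rfl⟩
    exact funext fun i => (h i).apply_apply_eq_zero (x i)

theorem piMap_injective {f : ∀ i, X i →ₗ[R] Y i} (h : ∀ i, Function.Injective (f i)) :
    Function.Injective (LinearMap.piMap f) := fun _ _ hxy =>
  funext fun i => h i (congrFun hxy i)

end Pi

section PiObject

variable {R : Type u} [Ring R] {ι : Type} [Fintype ι] [DecidableEq ι] (X : ι → ModuleCat.{u} R)

theorem sum_proj_single : ∑ i, (ModuleCat.ofHom (LinearMap.proj i) :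
      ModuleCat.of R (∀ i, X i) ⟶ X i) ≫ ModuleCat.ofHom (LinearMap.single R (fun i => X i) i) =
    𝟙 (ModuleCat.of R (∀ i, X i)) := by
  refine ModuleCat.hom_ext (LinearMap.ext fun x => ?_)
  rw [ModuleCat.hom_sum, LinearMap.sum_apply]
  exact Finset.univ_sum_single x

theorem hasProjectiveDimensionLT_pi (n : ℕ) (h : ∀ i, HasProjectiveDimensionLT (X i) n) :
    HasProjectiveDimensionLT (ModuleCat.of R (∀ i, X i)) n :=
  hasProjectiveDimensionLT_of_sum_eq_id X _ _ (sum_proj_single X) n h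

theorem hasInjectiveDimensionLT_pi (n : ℕ) (h : ∀ i, HasInjectiveDimensionLT (X i) n) :
    HasInjectiveDimensionLT (ModuleCat.of R (∀ i, X i)) n :=
  hasInjectiveDimensionLT_of_sum_eq_id X _ _ (sum_proj_single X) n h

omit [Fintype ι] [DecidableEq ι] in
theorem injective_pi (h : ∀ i, Injective (X i)) : Injective (ModuleCat.of R (∀ i, X i)) := by
  have := fun i => Module.injective_module_of_injective_object R (X i)
  exact Module.injective_object_of_injective_module _ _

end PiObject

namespace NakayamaBasis

variable {k : Type u} {A : Type v} [Field k] [Ring A] [Algebra k A] (B : NakayamaBasis k A)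

/-! ### The regular module and the Auslander-Gorenstein property -/

section Regular

theorem regularMap_bijective : Function.Bijective
    (LinearMap.pi fun i : Fin B.N => (B.annihilator i (B.p i)).mkQ) := by
  constructor
  · rw [injective_iff_map_eq_zero]
    intro z hz
    rw [B.eq_sum z]
    refine Finset.sum_eq_zero fun i hi => Finset.sum_eq_zero fun t ht => ?_
    rw [Finset.mem_Ico] at ht
    rw [B.cls_eq_zero.1 (congrFun hz ⟨i, Finset.mem_range.1 hi⟩) t ht.1 ht.2, zero_smul]
  · intro x
    choose z hz using fun i => Submodule.Quotient.mk_surjective _ (x i)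
    refine ⟨∑ i : Fin B.N, B.y i i * z i, funext fun j => ?_⟩
    rw [← hz j, LinearMap.pi_apply, Submodule.mkQ_apply, ← sub_eq_zero]
    refine B.cls_eq_zero.2 fun t ht ht' => ?_
    rw [map_sub, map_sum, Finset.sum_eq_single j, B.χ_y_mul le_rfl, if_pos ⟨ht, ht'⟩, sub_self]
    · intro i _ hij
      rw [y_self_mul_eq_sum, map_sum]
      refine Finset.sum_eq_zero fun s _ => ?_
      rw [map_smul, χ_y, if_neg, smul_zero]
      rintro ⟨-, -, h1, -⟩
      have h2 := Int.eq_zero_of_abs_lt_dvd h1 (by rw [abs_lt]; omega)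
      exact hij (Fin.ext (by omega))
    · intro h
      exact absurd (Finset.mem_univ j) h

/-- The decomposition of the regular representation into indecomposable projective modules. -/
noncomputable def regularEquiv :
    A ≃ₗ[Aᵐᵒᵖ] ∀ i : Fin B.N, B.Interval i (B.p i) :=
  LinearEquiv.ofBijective _ B.regularMap_bijective

theorem le_p (i : ℤ) : i ≤ B.p i := (B.lt_p i).le

/-- The minimal injective resolution of the regular representation. -/
noncomputable def regularInjRes : InjectiveResolution (regularRep A) :=
  injectiveResolutionOfExact
    (fun n => ModuleCat.of Aᵐᵒᵖ (∀ i : Fin B.N, B.injTerm i (B.p i) n))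
    (fun n => ModuleCat.ofHom (LinearMap.piMap fun i : Fin B.N =>
      B.injDiff (B.le_p i) (le_refl (B.p i)) n))
    (ModuleCat.ofHom ((LinearMap.piMap fun i : Fin B.N =>
      B.injUnit (B.le_p i) (le_refl (B.p i))) ∘ₗ B.regularEquiv.toLinearMap))
    (fun n => injective_pi (fun i : Fin B.N => B.injTerm i (B.p i) n)
      fun i => B.injective_injTerm i (B.p i) n)
    (fun n => piMap_exact fun i => B.injDiff_exact _ _ n)
    (by
      have h1 := piMap_exact fun i : Fin B.N => B.injUnit_exact (B.le_p i) (le_refl (B.p i))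
      intro x
      refine (h1 x).trans ⟨?_, ?_⟩
      · rintro ⟨z, rfl⟩
        obtain ⟨w, rfl⟩ := B.regularEquiv.surjective z
        exact ⟨w, rfl⟩
      · rintro ⟨w, rfl⟩
        exact ⟨B.regularEquiv w, rfl⟩)
    ((piMap_injective fun i : Fin B.N => B.injUnit_injective (B.le_p i) (le_refl (B.p i))).comp
      B.regularEquiv.injective)

theorem isMinimal_regularInjRes : IsMinimalInjectiveResolution B.regularInjRes := by
  refine isMinimal_injectiveResolutionOfExact _ _ _ _ _ _ _ (fun n => ?_) fun n => ?_
  · exact inferInstanceAs (Module.Finite Aᵐᵒᵖ (∀ i : Fin B.N, B.injTerm i (B.p i) n))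
  · refine B.isEssential_of_socle_subset fun x hx => funext fun i => ?_
    exact B.socle_subset_ker_injDiff (B.le_p i) (le_refl (B.p i)) n
      fun s t hst => congrFun (hx s t hst) i

/-- The module `[a, p a)` is a direct summand of the regular representation. -/
def retractRegular (a : ℤ) : Retract (B.obj a (B.p a)) (regularRep A) where
  i := ModuleCat.ofHom (B.inclusion a)
  r := ModuleCat.ofHom (Submodule.mkQ _)
  retract := ModuleCat.hom_ext (LinearMap.ext fun x => B.mkQ_inclusion a x)

/-- The hypothesis provides a possibly different resolution for every `n`. As `[i, p i)` is a
summand of `A`, the terms of its minimal injective resolution are retracts of the given ones, and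
dimension bounds pass to retracts. -/
theorem numericallyAuslanderGorenstein (h : IsAuslanderGorenstein A) :
    NumericallyAuslanderGorenstein B.p B.q := by
  refine ⟨fun i n hn => ?_, fun i => ?_⟩
  · obtain ⟨I, -, hI⟩ := h.1 (n + 1) (by omega)
    obtain ⟨e⟩ := nonempty_retract_of_minimal (B.retractRegular i)
      (B.isMinimal_injRes (B.le_p i) le_rfl) I n
    have h1 := (projectiveDimension_le_iff _ _).1 (hI n (by omega))
    have h2 : HasProjectiveDimensionLT (B.injTerm i (B.p i) n) (n + 1) :=
      e.hasProjectiveDimensionLT (n + 1)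
    rw [← stoppedOrbit_of_ne hn]
    exact (B.hasProjectiveDimensionLT_obj_iff ((B.stoppedOrbit_q_anti (B.le_p i) le_rfl
      (n + 1)).trans (B.stoppedOrbit_q_anti (B.le_p i) le_rfl n))
      (B.stoppedOrbit_q_le_p i (B.p i) n) n).1 h2
  · obtain ⟨n, hn⟩ : ∃ n : ℕ, HasInjectiveDimensionLT (regularRep A) (n + 1) := by
      obtain ⟨n, hn⟩ := (injectiveDimension_ne_top_iff _).1 h.2.ne
      exact ⟨n, hn⟩
    have h1 := (B.retractRegular i).hasInjectiveDimensionLT (n + 1)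
    exact ⟨n + 1, (B.hasInjectiveDimensionLT_obj_iff (B.le_p i) le_rfl n).1 h1⟩

theorem isAuslanderGorenstein (h : NumericallyAuslanderGorenstein B.p B.q) :
    IsAuslanderGorenstein A := by
  constructor
  · intro n _
    refine ⟨B.regularInjRes, B.isMinimal_regularInjRes, fun m _ => ?_⟩
    refine (projectiveDimension_le_iff _ _).2 (hasProjectiveDimensionLT_pi
      (fun i : Fin B.N => B.injTerm i (B.p i) m) (m + 1) fun i => ?_)
    refine (B.hasProjectiveDimensionLT_obj_iff ((B.stoppedOrbit_q_anti (B.le_p i) le_rfl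
      (m + 1)).trans (B.stoppedOrbit_q_anti (B.le_p i) le_rfl m))
      (B.stoppedOrbit_q_le_p i (B.p i) m) m).2 ?_
    -- After the resolution has stopped the term is an empty interval, whose orbit is constant from
    -- the start.
    by_cases hm : stoppedOrbit B.q (B.p i) i m = stoppedOrbit B.q (B.p i) i (m + 1)
    · have h1 : stoppedOrbit B.q (B.p i) i (m + 2) = stoppedOrbit B.q (B.p i) i m :=
        (stoppedOrbit_of_eq hm).trans hm.symm
      rw [h1, stoppedOrbit_stationary (n := 0) rfl (Nat.zero_le (m + 1)),
        stoppedOrbit_stationary (n := 0) rfl (Nat.zero_le (m + 2))]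
    · rw [stoppedOrbit_of_ne hm]
      exact h.1 i m hm
  · choose n hn using fun i : Fin B.N => h.2 i
    -- The sum of the individual lengths serves as a common bound.
    have h1 : HasInjectiveDimensionLT (ModuleCat.of Aᵐᵒᵖ
        (∀ i : Fin B.N, B.obj i (B.p i))) (∑ i, n i + 1) := by
      refine hasInjectiveDimensionLT_pi (fun i : Fin B.N => B.obj i (B.p i)) _ fun i => ?_
      refine (B.hasInjectiveDimensionLT_obj_iff (B.le_p i) le_rfl _).2 ?_
      have h2 := Finset.single_le_sum (fun j _ => Nat.zero_le (n j)) (Finset.mem_univ i)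
      rw [stoppedOrbit_stationary (hn i) (show n i ≤ ∑ i, n i + 1 by omega),
        stoppedOrbit_stationary (hn i) (show n i ≤ ∑ i, n i + 2 by omega)]
    have h2 : HasInjectiveDimensionLT (regularRep A) (∑ i, n i + 1) :=
      hasInjectiveDimensionLT_of_iso B.regularEquiv.symm.toModuleIso _
    exact lt_of_lt_of_le (injectiveDimension_lt_iff.2 h2) le_top

theorem isAuslanderGorenstein_iff :
    IsAuslanderGorenstein A ↔ NumericallyAuslanderGorenstein B.p B.q :=
  ⟨B.numericallyAuslanderGorenstein, B.isAuslanderGorenstein⟩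

end Regular

end NakayamaBasis

end QuiverAlg

namespace QuiverAlg

namespace NakayamaBasis

variable {k : Type u} {A : Type v} [Field k] [Ring A] [Algebra k A] (B : NakayamaBasis k A)

/-! ### Indecomposable projective and injective modules -/

theorem χ_add_mul (s t c : ℤ) (z : A) : B.χ (s + c * B.N) (t + c * B.N) z = B.χ s t z := by
  induction z using B.induction with
  | zero => simp
  | add x y hx hy => rw [map_add, map_add, hx, hy]
  | y r a b _ _ =>
    have h : (B.N : ℤ) ∣ a - (s + c * B.N) ↔ (B.N : ℤ) ∣ a - s := by
      rw [← sub_sub]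
      exact dvd_sub_left (dvd_mul_left _ _)
    simp only [map_smul, χ_y, p_add_mul, h, add_le_add_iff_right, add_lt_add_iff_right,
      add_sub_add_right_eq_sub]

theorem annihilator_add_mul (a b c : ℤ) :
    B.annihilator (a + c * B.N) (b + c * B.N) = B.annihilator a b := by
  ext z
  constructor
  · intro h t ht ht'
    rw [← B.χ_add_mul a t c]
    exact h _ (by omega) (by omega)
  · intro h t ht ht'
    obtain ⟨t, rfl⟩ : ∃ t', t = t' + c * B.N := ⟨t - c * B.N, by ring⟩
    rw [χ_add_mul]
    exact h _ (by omega) (by omega)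

theorem obj_add_mul (a b c : ℤ) : B.obj (a + c * B.N) (b + c * B.N) = B.obj a b :=
  congrArg (fun S : Submodule Aᵐᵒᵖ A => ModuleCat.of Aᵐᵒᵖ (A ⧸ S)) (B.annihilator_add_mul a b c)

theorem op_smul_cls_self {a b : ℤ} (z : A) :
    MulOpposite.op z • B.cls a b (B.y a a) = B.cls a b z := by
  rw [op_smul_cls, ← sub_eq_zero]
  refine B.cls_eq_zero.2 fun t ht ht' => ?_
  rw [map_sub, B.χ_y_mul le_rfl]
  split_ifs with h
  · exact sub_self _
  · rw [B.χ_eq_zero (by omega), sub_self]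

/-- The vertex of the generator is an invariant: composing down to the simple module `[a', a' + 1)`
gives a nonzero module on which `y a a` would act as zero. -/
theorem dvd_of_surjective {a b a' b' : ℤ} (h : a' < b')
    {f : B.Interval a b →ₗ[Aᵐᵒᵖ] B.Interval a' b'} (hf : Function.Surjective f) :
    (B.N : ℤ) ∣ a - a' := by
  by_contra hN
  have key : ∀ x : B.Interval a' (a' + 1), MulOpposite.op (B.y a a) • x = 0 := by
    intro x
    obtain ⟨w, rfl⟩ := Submodule.Quotient.mk_surjective _ x
    rw [op_smul_cls]
    refine B.cls_eq_zero.2 fun t ht ht' => ?_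
    obtain rfl : t = a' := by omega
    exact B.χ_mul_y_eq_zero hN _
  obtain ⟨g, hg⟩ : ∃ g : B.Interval a b →ₗ[Aᵐᵒᵖ] B.Interval a' (a' + 1), Function.Surjective g :=
    ⟨B.shift (le_refl a') h ∘ₗ f, by
      rw [LinearMap.coe_comp]
      exact (B.shift_surjective h).comp hf⟩
  have := B.interval_nontrivial (show a' < a' + 1 by omega)
  obtain ⟨x, hx⟩ := exists_ne (0 : B.Interval a' (a' + 1))
  obtain ⟨z, rfl⟩ := hg x
  obtain ⟨z, rfl⟩ := Submodule.Quotient.mk_surjective _ z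
  refine hx ?_
  change g (B.cls a b z) = 0
  rw [← op_smul_cls_self, map_smul, ← B.op_smul_cls_self (B.y a a), map_smul, key, smul_zero]

theorem dvd_of_mem_socle {a b : ℤ} (hb : b ≤ B.p a) {x : B.Interval a b}
    (hx : x ∈ B.socle (B.Interval a b)) (hx0 : x ≠ 0) {t : ℤ}
    (ht : MulOpposite.op (B.y t t) • x = x) : (B.N : ℤ) ∣ t - (b - 1) := by
  by_contra hN
  obtain ⟨z, rfl⟩ := Submodule.Quotient.mk_surjective _ x
  refine hx0 ?_
  rw [← ht]
  refine B.cls_eq_zero.2 fun s hs hs' => ?_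
  rcases eq_or_lt_of_le (show s ≤ b - 1 by omega) with rfl | h
  · exact B.χ_mul_y_eq_zero hN z
  · rw [← ht] at hx
    exact B.χ_eq_zero_of_mem_socle hb hx h

/-- An injective map sends the socle, located at the vertex `b - 1`, to the socle at `b' - 1`. -/
theorem dvd_of_injective {a b a' b' : ℤ} (hab : a < b) (hb : b ≤ B.p a) (hb' : b' ≤ B.p a')
    {f : B.Interval a b →ₗ[Aᵐᵒᵖ] B.Interval a' b'} (hf : Function.Injective f) :
    (B.N : ℤ) ∣ b - b' := by
  have := B.interval_nontrivial hab
  obtain ⟨x, -, hx0, hx, t, ht⟩ :=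
    B.exists_mem_socle (X := B.Interval a b) (L := ⊤) top_ne_bot
  have h1 := B.dvd_of_mem_socle hb hx hx0 ht
  have h2 : (B.N : ℤ) ∣ t - (b' - 1) := by
    refine B.dvd_of_mem_socle hb' (x := f x) (fun s u hsu => ?_) (fun h => ?_) ?_
    · rw [← map_smul, hx s u hsu, map_zero]
    · exact hx0 (hf (h.trans (map_zero f).symm))
    · rw [← map_smul, ht]
  have h3 := dvd_sub h2 h1
  rwa [show t - (b' - 1) - (t - (b - 1)) = b - b' by ring] at h3

theorem nonempty_iso_projective_iff {a a' : ℤ} :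
    Nonempty (B.obj a (B.p a) ≅ B.obj a' (B.p a')) ↔ (B.N : ℤ) ∣ a - a' := by
  constructor
  · rintro ⟨e⟩
    exact B.dvd_of_surjective (B.lt_p a') e.toLinearEquiv.surjective
  · rintro ⟨c, hc⟩
    obtain rfl : a = a' + c * B.N := by linarith
    rw [p_add_mul, obj_add_mul]
    exact ⟨Iso.refl _⟩

theorem nonempty_iso_injective_iff {b b' : ℤ} :
    Nonempty (B.obj (B.q b) b ≅ B.obj (B.q b') b') ↔ (B.N : ℤ) ∣ b - b' := by
  constructor
  · rintro ⟨e⟩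
    exact B.dvd_of_injective (B.q_lt b) (B.le_p_q b) (B.le_p_q b') e.toLinearEquiv.injective
  · rintro ⟨c, hc⟩
    obtain rfl : b = b' + c * B.N := by linarith
    rw [q_add_mul, obj_add_mul]
    exact ⟨Iso.refl _⟩

theorem exists_op_smul_notMem {X : Type w} [AddCommGroup X] [Module Aᵐᵒᵖ X]
    {L : Submodule Aᵐᵒᵖ X} {x : X} (hx : x ∉ L) : ∃ i : ℤ, MulOpposite.op (B.y i i) • x ∉ L := by
  by_contra! h
  refine hx ?_
  have h1 : orbitMap x (1 : A) = x := one_smul _ x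
  rw [← h1, ← B.one, map_sum]
  exact L.sum_mem fun i _ => h i

/-- Every finitely generated indecomposable projective module is some `[a, p a)`. -/
theorem exists_iso_of_projective {P : ModuleCat.{v} Aᵐᵒᵖ} (hf : Module.Finite Aᵐᵒᵖ P)
    (hi : Indecomposable P) (hp : Projective P) : ∃ a, Nonempty (P ≅ B.obj a (B.p a)) := by
  have hP : Module.Projective Aᵐᵒᵖ P := (IsProjective.iff_projective _).2 hp
  have hnt : Nontrivial P := by
    by_contra h
    rw [not_nontrivial_iff_subsingleton] at h
    exact hi.1 (ModuleCat.isZero_of_subsingleton P)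
  -- A maximal submodule exists since `P` is finitely generated. The interval `[a, p a)` then covers
  -- the simple quotient `P / L`, and projectivity of `P` lifts the quotient map to `h : P → [a, p
  -- a)`.
  obtain ⟨L, hL, -⟩ := (eq_top_or_exists_le_coatom (⊥ : Submodule Aᵐᵒᵖ P)).resolve_left bot_ne_top
  obtain ⟨x, -, hx⟩ := SetLike.exists_of_lt hL.lt_top
  obtain ⟨a, ha⟩ := B.exists_op_smul_notMem hx
  set x' := MulOpposite.op (B.y a a) • x with hx'
  have hx2 : MulOpposite.op (B.y a a) • x' = x' := by
    rw [hx', ← mul_smul, ← MulOpposite.op_mul, B.y_mul a a a le_rfl le_rfl]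
  let g : B.Interval a (B.p a) →ₗ[Aᵐᵒᵖ] P := B.lift x' hx2 fun t ht => by
    rw [B.y_eq_zero_of_p_le ht, MulOpposite.op_zero, zero_smul]
  have hgx : g (B.cls _ _ (B.y a a)) = x' := hx2
  have hs : Function.Surjective (L.mkQ ∘ₗ g) := by
    have h1 : LinearMap.range g ⊔ L = ⊤ := by
      refine hL.2 _ (lt_of_le_of_ne le_sup_right fun h => ha ?_)
      rw [h, ← hgx]
      exact Submodule.mem_sup_left ⟨_, rfl⟩
    intro z
    obtain ⟨z, rfl⟩ := Submodule.Quotient.mk_surjective _ z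
    obtain ⟨_, ⟨w, rfl⟩, l, hl, hz⟩ := Submodule.mem_sup.1 (h1 ▸ Submodule.mem_top (x := z))
    refine ⟨w, ?_⟩
    rw [← hz, Submodule.Quotient.mk_add, (Submodule.Quotient.mk_eq_zero L).2 hl, add_zero]
    rfl
  obtain ⟨h, hh⟩ := Module.projective_lifting_property (L.mkQ ∘ₗ g) L.mkQ hs
  obtain ⟨w, hw⟩ := Submodule.Quotient.mk_surjective _ (h x')
  have hker : B.cls _ _ (B.y a a - w) ∈ LinearMap.ker (L.mkQ ∘ₗ g) := by
    rw [LinearMap.mem_ker]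
    change (L.mkQ ∘ₗ g) (B.cls _ _ (B.y a a) - B.cls _ _ w) = 0
    have h1 : (L.mkQ ∘ₗ g) (B.cls a (B.p a) w) = L.mkQ x' := by
      rw [← LinearMap.congr_fun hh x']
      exact congrArg (L.mkQ ∘ₗ g) hw
    rw [map_sub, h1, LinearMap.comp_apply, hgx, sub_self]
  -- Otherwise `y a a - w` would generate `[a, p a)` while lying in the kernel, forcing `x' ∈ L`.
  have hw0 : B.χ a a w ≠ 0 := by
    intro h0
    have h1 := B.eq_top_of_χ_ne_zero hker (by
      rw [map_sub, h0, B.χ_y_self le_rfl (B.lt_p a), sub_zero]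
      exact one_ne_zero)
    have h2 : B.cls _ _ (B.y a a) ∈ LinearMap.ker (L.mkQ ∘ₗ g) := h1 ▸ Submodule.mem_top
    rw [LinearMap.mem_ker, LinearMap.comp_apply, hgx] at h2
    exact ha ((Submodule.Quotient.mk_eq_zero L).1 h2)
  have hsurj : Function.Surjective h :=
    LinearMap.range_eq_top.1 (B.eq_top_of_χ_ne_zero (w := w) ⟨x', hw.symm⟩ hw0)
  obtain ⟨s, hs⟩ := Module.projective_lifting_property h LinearMap.id hsurj
  exact ⟨a, nonempty_iso_of_retract hi (B.not_isZero_obj (B.lt_p a))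
    ⟨ModuleCat.ofHom s, ModuleCat.ofHom h, ModuleCat.hom_ext hs⟩⟩

theorem isEssential_range_shift {a' a b : ℤ} (ha : a' ≤ a) (hab : a < b) (hb : b ≤ B.p a') :
    IsEssential (LinearMap.range (B.shift ha (le_refl b))) := by
  refine B.isEssential_of_socle_subset ?_
  rw [← LinearMap.exact_iff.1 (B.shift_exact (le_refl a') ha hab.le (le_refl b) rfl
    (hab.le.trans hb))]
  exact B.socle_subset_ker_shift _ _ (Or.inl hab) (hab.le.trans hb) hb

/-- Every indecomposable injective module is some `[q b, b)`. -/
theorem exists_iso_of_injective {E : ModuleCat.{v} Aᵐᵒᵖ} (hi : Indecomposable E)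
    (hE : Injective E) : ∃ b, Nonempty (E ≅ B.obj (B.q b) b) := by
  have hnt : Nontrivial E := by
    by_contra h
    rw [not_nontrivial_iff_subsingleton] at h
    exact hi.1 (ModuleCat.isZero_of_subsingleton E)
  obtain ⟨x, -, hx0, hx, t, ht⟩ := B.exists_mem_socle (X := E) (L := ⊤) top_ne_bot
  -- The simple module spanned by a socle element of `E`. Its inclusion extends to `[q (t + 1), t +
  -- 1)`, and the extension stays injective because the simple submodule is essential there.
  let g : B.Interval t (t + 1) →ₗ[Aᵐᵒᵖ] E := B.lift x ht fun s hs => hx t s (by omega)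
  have hg : Function.Injective g := by
    rw [injective_iff_map_eq_zero]
    intro z hz
    obtain ⟨z, rfl⟩ := Submodule.Quotient.mk_surjective _ z
    refine B.cls_eq_zero.2 fun s hs hs' => ?_
    obtain rfl : s = t := by omega
    by_contra h0
    have h1 := B.eq_top_of_χ_ne_zero (L := LinearMap.ker g) (w := z) hz h0
    have h2 : B.cls s (s + 1) (B.y s s) ∈ LinearMap.ker g := h1 ▸ Submodule.mem_top
    exact hx0 (ht.symm.trans h2)
  have hq : B.q (t + 1) ≤ t := (B.gc _ _).2 (B.lt_p t)
  let i : B.obj t (t + 1) ⟶ B.obj (B.q (t + 1)) (t + 1) :=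
    ModuleCat.ofHom (B.shift hq (le_refl (t + 1)))
  have : Mono i := (ModuleCat.mono_iff_injective i).2 (B.shift_injective hq (B.le_p_q _))
  let h : B.obj (B.q (t + 1)) (t + 1) ⟶ E := Injective.factorThru (ModuleCat.ofHom g) i
  have hh : ∀ z, h.hom (B.shift hq (le_refl (t + 1)) z) = g z := fun z =>
    LinearMap.congr_fun (congrArg ModuleCat.Hom.hom
      (Injective.comp_factorThru (ModuleCat.ofHom g) i)) z
  have : Mono h := by
    refine (ModuleCat.mono_iff_injective h).2 (LinearMap.ker_eq_bot.1 ?_)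
    refine B.isEssential_range_shift hq (show t < t + 1 by omega) (B.le_p_q _) _
      ((Submodule.eq_bot_iff _).2 ?_)
    rintro _ ⟨⟨z, rfl⟩, hz⟩
    have hz' := hh z
    rw [LinearMap.mem_ker.1 hz] at hz'
    rw [hg (hz'.symm.trans (map_zero g).symm), map_zero]
  have := B.injective_obj (a := B.q (t + 1)) (b := t + 1) (Or.inl rfl)
  exact ⟨t + 1, nonempty_iso_of_retract hi (B.not_isZero_obj (B.q_lt _))
    ⟨h, Injective.factorThru (𝟙 _) h, Injective.comp_factorThru _ _⟩⟩

end NakayamaBasis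

end QuiverAlg

namespace QuiverAlg

/-! ### The Auslander-Reiten map -/

theorem IsARPair.unique {p q : ℤ → ℤ} {j i i' : ℤ} {d d' : ℕ} (h : IsARPair p q j i d)
    (h' : IsARPair p q j i' d') : i = i' := by
  have key : ∀ {d d' : ℕ} {i i' : ℤ}, IsARPair p q j i d → IsARPair p q j i' d' → d' ≤ d := by
    intro d d' i i' h h'
    by_contra! hlt
    exact stoppedOrbit_ne_of_le h'.1 (show d + 1 ≤ d' by omega) h.2.1
  obtain rfl := le_antisymm (key h' h) (key h h')
  exact h.2.2.symm.trans h'.2.2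

theorem stoppedOrbit_add {f : ℤ → ℤ} {c : ℤ} (hf : ∀ s, f (s + c) = f s + c) (a b : ℤ) (n : ℕ) :
    stoppedOrbit f (a + c) (b + c) n = stoppedOrbit f a b n + c := by
  induction n using Nat.twoStepInduction with
  | zero => rfl
  | one => rfl
  | more n ih1 ih2 =>
    rw [stoppedOrbit, stoppedOrbit, ih1, ih2, hf]
    simp only [add_left_inj]
    split_ifs <;> rfl

theorem IsARPair.add {p q : ℤ → ℤ} {c : ℤ} (hp : ∀ s, p (s + c) = p s + c)
    (hq : ∀ s, q (s + c) = q s + c) {j i : ℤ} {d : ℕ} (h : IsARPair p q j i d) :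
    IsARPair p q (j + c) (i + c) d := by
  simp only [IsARPair, hq, stoppedOrbit_add hp]
  exact ⟨fun h1 => h.1 (add_right_cancel h1), by rw [h.2.1], by rw [h.2.2]⟩

/-- A functional relation on `ℤ` which is invariant under translation by `N` and surjective
induces a bijection of residue classes modulo `N`. -/
theorem exists_of_equivariant {N : ℕ} (hN : 0 < N) {R : ℤ → ℤ → Prop}
    (hfun : ∀ j i i', R j i → R j i' → i = i')
    (hadd : ∀ j i c, R j i → R (j + c * N) (i + c * N)) (hsurj : ∀ i, ∃ j, R j i) :
    (∀ j, ∃ i, R j i) ∧ ∀ j j' i, R j i → R j' i → (N : ℤ) ∣ j - j' := by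
  have hN' : (0 : ℤ) < N := by exact_mod_cast hN
  choose σ hσ using hsurj
  let r : ℤ → Fin N := fun j => ⟨(j % N).toNat, by
    have := Int.emod_lt_of_pos j hN'
    have := Int.emod_nonneg j hN'.ne'
    omega⟩
  have hr : ∀ j j', r j = r j' → ∃ c : ℤ, j = j' + c * N := by
    intro j j' h
    have h1 : (j % N).toNat = (j' % N).toNat := congrArg Fin.val h
    have h2 : j % N = j' % N := by
      have := Int.emod_nonneg j hN'.ne'
      have := Int.emod_nonneg j' hN'.ne'
      omega
    obtain ⟨c, hc⟩ := Int.ModEq.dvd (show j' ≡ j [ZMOD N] from h2.symm)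
    exact ⟨c, by linarith⟩
  -- The residue of a chosen preimage determines `i`. As an injective self-map of `Fin N` is
  -- surjective, every `j` is a translate of a chosen preimage.
  have hτ : Function.Injective fun i : Fin N => r (σ i) := by
    intro i i' h
    obtain ⟨c, hc⟩ := hr _ _ h
    have h1 := hadd _ _ c (hσ i')
    rw [← hc] at h1
    have h2 := hfun _ _ _ (hσ i) h1
    have h3 : (N : ℤ) ∣ i - i' := ⟨c, by linarith⟩
    have h4 := Int.eq_zero_of_abs_lt_dvd h3 (by rw [abs_lt]; omega)
    exact Fin.ext (by omega)
  have key : ∀ j, ∃ (i : Fin N) (c : ℤ), j = σ i + c * N ∧ R j (i + c * N) := by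
    intro j
    obtain ⟨i, hi⟩ := (Finite.surjective_of_injective hτ) (r j)
    obtain ⟨c, hc⟩ := hr _ _ hi.symm
    exact ⟨i, c, hc, hc ▸ hadd _ _ c (hσ i)⟩
  refine ⟨fun j => ?_, fun j j' i h h' => ?_⟩
  · obtain ⟨i, c, -, h⟩ := key j
    exact ⟨_, h⟩
  · obtain ⟨i₁, c₁, h1, h2⟩ := key j
    obtain ⟨i₂, c₂, h3, h4⟩ := key j'
    have h5 := hfun _ _ _ h h2
    have h6 := hfun _ _ _ h' h4
    have h7 : (N : ℤ) ∣ i₁ - i₂ := ⟨c₂ - c₁, by linarith⟩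
    have h8 := Int.eq_zero_of_abs_lt_dvd h7 (by rw [abs_lt]; omega)
    obtain rfl : i₁ = i₂ := Fin.ext (by omega)
    exact ⟨c₁ - c₂, by rw [h1, h3]; ring⟩

section Transport

variable {R : Type u} [Ring R] {M M' : ModuleCat.{u} R}

/-- A projective resolution of `M` as a resolution of an isomorphic module. -/
noncomputable def transportResolution (P : ProjectiveResolution M) (e : M ≅ M') :
    ProjectiveResolution M' where
  complex := P.complex
  projective := P.projective
  π := P.π ≫ (ChainComplex.single₀ _).map e.hom

theorem isMinimal_transportResolution {P : ProjectiveResolution M}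
    (hP : IsMinimalProjectiveResolution P) (e : M ≅ M') :
    IsMinimalProjectiveResolution (transportResolution P e) :=
  ⟨hP.finite, hP.superfluous⟩

end Transport

namespace NakayamaBasis

variable {k : Type u} {A : Type v} [Field k] [Ring A] [Algebra k A] (B : NakayamaBasis k A)

/-- The indecomposable projective module `[i, p i)`. -/
def indecProjective (i : ℤ) : IndecProjective A :=
  ⟨B.obj i (B.p i), finite_quotient _, B.indecomposable_obj (B.lt_p i) le_rfl,
    B.projective_obj (Or.inl rfl)⟩

/-- The indecomposable injective module `[q j, j)`. -/
noncomputable def indecInjective (j : ℤ) : IndecInjective A :=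
  ⟨B.obj (B.q j) j, finite_quotient _, B.indecomposable_obj (B.q_lt j) (B.le_p_q j),
    B.injective_obj (Or.inl rfl)⟩

theorem mk_indecProjective_eq_iff {i i' : ℤ} :
    (⟦B.indecProjective i⟧ : IndecProjectiveClass A) = ⟦B.indecProjective i'⟧ ↔
      (B.N : ℤ) ∣ i - i' :=
  Quotient.eq.trans B.nonempty_iso_projective_iff

theorem mk_indecInjective_eq_iff {j j' : ℤ} :
    (⟦B.indecInjective j⟧ : IndecInjectiveClass A) = ⟦B.indecInjective j'⟧ ↔
      (B.N : ℤ) ∣ j - j' :=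
  Quotient.eq.trans B.nonempty_iso_injective_iff

theorem exists_eq_mk_indecProjective (c : IndecProjectiveClass A) :
    ∃ i, c = ⟦B.indecProjective i⟧ := by
  induction c using Quotient.inductionOn with
  | h M =>
    obtain ⟨i, hi⟩ := B.exists_iso_of_projective M.2.1 M.2.2.1 M.2.2.2
    exact ⟨i, Quotient.sound hi⟩

theorem exists_eq_mk_indecInjective (c : IndecInjectiveClass A) :
    ∃ j, c = ⟦B.indecInjective j⟧ := by
  induction c using Quotient.inductionOn with
  | h M =>
    obtain ⟨j, hj⟩ := B.exists_iso_of_injective M.2.2.1 M.2.2.2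
    exact ⟨j, Quotient.sound hj⟩

/-- The minimal projective resolution of the indecomposable injective module `[q j, j)`. -/
noncomputable abbrev injectiveProjRes (j : ℤ) : ProjectiveResolution (B.obj (B.q j) j) :=
  B.projRes (B.q_lt j).le (B.le_p_q j)

theorem injectiveProjRes_X {j i : ℤ} {d : ℕ} (h : IsARPair B.p B.q j i d) :
    (B.injectiveProjRes j).complex.X d = B.obj i (B.p i) := by
  rw [projRes_X, projTerm, stoppedOrbit_of_ne h.1, h.2.2]

theorem hasWellDefinedARMap (h : ∀ j, ∃ i d, IsARPair B.p B.q j i d) :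
    HasWellDefinedARMap A := by
  intro M
  obtain ⟨j, ⟨e⟩⟩ := B.exists_iso_of_injective M.2.2.1 M.2.2.2
  obtain ⟨i, d, hd⟩ := h j
  refine ⟨transportResolution (B.injectiveProjRes j) e.symm, d,
    isMinimal_transportResolution (B.isMinimal_projRes _ _) _,
    B.isLastNonzeroTerm_projRes (B.q_lt j).le (B.le_p_q j) hd.1 hd.2.1, ?_⟩
  change Indecomposable ((B.injectiveProjRes j).complex.X d)
  rw [B.injectiveProjRes_X hd]
  exact B.indecomposable_obj (B.lt_p i) le_rfl

/-- The resolution selected by choice is compared with the explicit one through uniqueness of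
minimal resolutions. -/
theorem exists_isARPair (h : HasWellDefinedARMap A) (j : ℤ) :
    ∃ i d, IsARPair B.p B.q j i d ∧
      auslanderReitenMap h ⟦B.indecInjective j⟧ = ⟦B.indecProjective i⟧ := by
  obtain ⟨hmin, hlast, -⟩ := (h (B.indecInjective j)).choose_spec.choose_spec
  have hiso := fun n => iso_of_minimal (Iso.refl _) hmin
    (B.isMinimal_projRes (B.q_lt j).le (B.le_p_q j)) n
  have hlast' : IsLastNonzeroTerm (B.injectiveProjRes j)
      (h (B.indecInjective j)).choose_spec.choose := by
    refine ⟨fun h0 => hlast.1 ?_, fun n hn => ?_⟩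
    · obtain ⟨e⟩ := hiso (h (B.indecInjective j)).choose_spec.choose
      exact h0.of_iso e
    · obtain ⟨e⟩ := hiso n
      exact (hlast.2 n hn).of_iso e.symm
  obtain ⟨h1, h2⟩ := B.stoppedOrbit_of_isLastNonzeroTerm _ _ hlast'
  have hd : IsARPair B.p B.q j _ _ := ⟨h1, h2, rfl⟩
  refine ⟨_, _, hd, Quotient.sound ?_⟩
  have h3 := hiso (h (B.indecInjective j)).choose_spec.choose
  rw [B.injectiveProjRes_X hd] at h3
  exact h3

theorem auslanderReitenMap_mk (h : HasWellDefinedARMap A) {j i : ℤ} {d : ℕ}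
    (hd : IsARPair B.p B.q j i d) :
    auslanderReitenMap h ⟦B.indecInjective j⟧ = ⟦B.indecProjective i⟧ := by
  obtain ⟨i', d', hd', h'⟩ := B.exists_isARPair h j
  rw [h', hd.unique hd']

theorem isARPair_add_mul {j i : ℤ} {d : ℕ} (h : IsARPair B.p B.q j i d) (c : ℤ) :
    IsARPair B.p B.q (j + c * B.N) (i + c * B.N) d :=
  h.add (fun s => B.p_add_mul s c) fun s => B.q_add_mul s c

/-- The right side expresses surjectivity only; definedness and injectivity follow by counting
residue classes. -/
theorem bijective_auslanderReitenMap_iff :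
    (∃ h : HasWellDefinedARMap A, Function.Bijective (auslanderReitenMap h)) ↔
      ∀ i, ∃ j d, IsARPair B.p B.q j i d := by
  constructor
  · rintro ⟨h, -, hs⟩ i
    obtain ⟨c, hc⟩ := hs ⟦B.indecProjective i⟧
    obtain ⟨j, rfl⟩ := B.exists_eq_mk_indecInjective c
    obtain ⟨i', d, hd, h'⟩ := B.exists_isARPair h j
    rw [h', mk_indecProjective_eq_iff] at hc
    obtain ⟨m, hm⟩ := hc
    obtain rfl : i' = i + m * B.N := by linarith
    have h1 := B.isARPair_add_mul hd (-m)
    rw [neg_mul, add_neg_cancel_right] at h1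
    exact ⟨_, d, h1⟩
  · intro H
    obtain ⟨h1, h2⟩ := exists_of_equivariant B.N_pos (R := fun j i => ∃ d, IsARPair B.p B.q j i d)
      (fun j i i' ⟨d, hd⟩ ⟨d', hd'⟩ => hd.unique hd')
      (fun j i c ⟨d, hd⟩ => ⟨d, B.isARPair_add_mul hd c⟩) H
    refine ⟨B.hasWellDefinedARMap h1, fun c c' hcc => ?_, fun c => ?_⟩
    · obtain ⟨j, rfl⟩ := B.exists_eq_mk_indecInjective c
      obtain ⟨j', rfl⟩ := B.exists_eq_mk_indecInjective c'
      obtain ⟨i, d, hd⟩ := h1 j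
      obtain ⟨i', d', hd'⟩ := h1 j'
      rw [B.auslanderReitenMap_mk _ hd, B.auslanderReitenMap_mk _ hd',
        mk_indecProjective_eq_iff] at hcc
      obtain ⟨m, hm⟩ := hcc
      obtain rfl : i = i' + m * B.N := by linarith
      obtain ⟨l, hl⟩ := h2 _ _ _ ⟨d, hd⟩ ⟨d', B.isARPair_add_mul hd' m⟩
      rw [mk_indecInjective_eq_iff]
      exact ⟨l + m, by linarith⟩
    · obtain ⟨i, rfl⟩ := B.exists_eq_mk_indecProjective c
      obtain ⟨j, d, hd⟩ := H i
      exact ⟨_, B.auslanderReitenMap_mk _ hd⟩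

include B in
/-- An algebra with a Nakayama basis is Auslander-Gorenstein if and only if its Auslander-Reiten
map is well-defined and bijective. -/
theorem isAuslanderGorenstein_iff_bijective :
    IsAuslanderGorenstein A ↔
      ∃ h : HasWellDefinedARMap A, Function.Bijective (auslanderReitenMap h) := by
  rw [B.isAuslanderGorenstein_iff, B.bijective_auslanderReitenMap_iff,
    numericallyAuslanderGorenstein_iff B.gc B.lt_p]

end NakayamaBasis

end QuiverAlg

namespace QuiverAlg

/-! ### Nakayama algebras -/

/-- A labelling of the vertices of a quiver by `ℤ / N` (written as an `N`-periodic family) such that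
there is at most one arrow out of each vertex, and every arrow out of `s` ends at `s + 1`. -/
structure CyclicLabelling (V : Type v) [Quiver.{w} V] where
  N : ℕ
  N_pos : 0 < N
  vertex : ℤ → V
  vertex_eq_iff : ∀ s t, vertex s = vertex t ↔ (N : ℤ) ∣ s - t
  exists_vertex_eq : ∀ a, ∃ s, vertex s = a
  subsingleton_hom : ∀ a b : V, Subsingleton (a ⟶ b)
  eq_of_hom : ∀ s b, (vertex s ⟶ b) → b = vertex (s + 1)

/-- A line is treated as a cycle with one arrow missing. Only an upper bound on the arrows is kept,
and nonexistent paths will simply count as zero. -/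
theorem IsLinearQuiver.hom_mod {V : Type v} [Quiver.{w} V] (h : IsLinearQuiver V) :
    ∃ N : ℕ, 1 ≤ N ∧ ∃ e : Fin N ≃ V, (∀ i j, Subsingleton (e i ⟶ e j)) ∧
      ∀ i j, (e i ⟶ e j) → ((i : ℕ) + 1) % N = j := by
  obtain ⟨N, hN, e, he⟩ := h
  refine ⟨N, hN, e, fun i j => ?_, fun i j f => ?_⟩
  · obtain ⟨g⟩ := he i j
    exact g.subsingleton
  · obtain ⟨g⟩ := he i j
    have h1 := (g f).down
    rw [h1]
    exact Nat.mod_eq_of_lt j.2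

theorem IsCyclicQuiver.hom_mod {V : Type v} [Quiver.{w} V] (h : IsCyclicQuiver V) :
    ∃ N : ℕ, 1 ≤ N ∧ ∃ e : Fin N ≃ V, (∀ i j, Subsingleton (e i ⟶ e j)) ∧
      ∀ i j, (e i ⟶ e j) → ((i : ℕ) + 1) % N = j := by
  obtain ⟨N, hN, e, he⟩ := h
  refine ⟨N, hN, e, fun i j => ?_, fun i j f => ?_⟩
  · obtain ⟨g⟩ := he i j
    exact g.subsingleton
  · obtain ⟨g⟩ := he i j
    exact (g f).down

theorem nonempty_cyclicLabelling {V : Type v} [Quiver.{w} V] {N : ℕ} (hN : 1 ≤ N) (e : Fin N ≃ V)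
    (h : ∀ i j, Subsingleton (e i ⟶ e j)) (h' : ∀ i j, (e i ⟶ e j) → ((i : ℕ) + 1) % N = j) :
    Nonempty (CyclicLabelling V) := by
  have hN' : (0 : ℤ) < N := by exact_mod_cast hN
  let r : ℤ → Fin N := fun j => ⟨(j % N).toNat, by
    have := Int.emod_lt_of_pos j hN'
    have := Int.emod_nonneg j hN'.ne'
    omega⟩
  have hr : ∀ j, ((r j : ℕ) : ℤ) = j % N := fun j => Int.toNat_of_nonneg (Int.emod_nonneg j hN'.ne')
  refine ⟨⟨N, hN, fun s => e (r s), fun s t => ?_, fun a => ?_, fun a b => ?_, fun s b f => ?_⟩⟩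
  · rw [e.apply_eq_iff_eq, Fin.ext_iff, ← Nat.cast_inj (R := ℤ), hr, hr]
    exact ⟨fun h1 => Int.ModEq.dvd (show t ≡ s [ZMOD N] from h1.symm),
      fun h1 => (Int.modEq_iff_dvd.2 h1).symm⟩
  · obtain ⟨i, rfl⟩ := e.surjective a
    refine ⟨i, congrArg e (Fin.ext ?_)⟩
    rw [← Nat.cast_inj (R := ℤ), hr]
    exact Int.emod_eq_of_lt (by omega) (by omega)
  · obtain ⟨i, rfl⟩ := e.surjective a
    obtain ⟨j, rfl⟩ := e.surjective b
    exact h i j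
  · obtain ⟨j, rfl⟩ := e.surjective b
    have h1 := h' _ _ f
    refine congrArg e (Fin.ext ?_)
    rw [← h1, ← Nat.cast_inj (R := ℤ), hr]
    push_cast
    rw [hr, Int.emod_add_emod]

/-! ### Paths in the universal cover -/

namespace CyclicLabelling

variable {V : Type v} [Quiver.{w} V] (C : CyclicLabelling V)

theorem end_eq {a b : V} (P : Quiver.Path a b) {s : ℤ} (hs : C.vertex s = a) :
    b = C.vertex (s + P.length) := by
  induction P with
  | nil => simp [hs]
  | @cons b c P f ih =>
    have g : C.vertex (s + P.length) ⟶ c := ih ▸ f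
    refine (C.eq_of_hom _ _ g).trans (congrArg C.vertex ?_)
    rw [Quiver.Path.length_cons]
    push_cast
    ring

include C in
/-- A path is determined by its starting point and its length. -/
theorem totalPath_ext {P Q : TotalPath V} (h : P.1 = Q.1) (h' : P.length = Q.length) : P = Q := by
  obtain ⟨a, b, P⟩ := P
  obtain ⟨a', b', Q⟩ := Q
  obtain rfl : a = a' := h
  obtain ⟨s, hs⟩ := C.exists_vertex_eq a
  replace h' : P.length = Q.length := h'
  have hb : b = b' := by rw [C.end_eq P hs, C.end_eq Q hs, h']
  subst hb
  obtain rfl : P = Q := by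
    clear hs s
    induction P with
    | nil => exact (Quiver.Path.eq_nil_of_length_zero Q h'.symm).symm
    | cons P f ih =>
      cases Q with
      | nil => simp at h'
      | cons Q g =>
        obtain ⟨s, hs⟩ := C.exists_vertex_eq a
        rw [Quiver.Path.length_cons, Quiver.Path.length_cons, add_left_inj] at h'
        have hc := C.end_eq P hs
        rw [h', ← C.end_eq Q hs] at hc
        subst hc
        rw [ih Q h', (C.subsingleton_hom _ _).elim f g]
  rfl

/-- `P` is a path from `s` to `t` in the universal cover. -/
def IsPath (s t : ℤ) (P : TotalPath V) : Prop := C.vertex s = P.1 ∧ s + P.length = t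

variable {C} in
theorem IsPath.end_eq {s t : ℤ} {P : TotalPath V} (h : C.IsPath s t P) : P.2.1 = C.vertex t := by
  rw [← h.2]
  exact C.end_eq P.2.2 h.1

variable {C} in
theorem IsPath.unique {s t : ℤ} {P Q : TotalPath V} (hP : C.IsPath s t P) (hQ : C.IsPath s t Q) :
    P = Q :=
  C.totalPath_ext (hP.1.symm.trans hQ.1) (by have := hP.2; have := hQ.2; omega)

variable {C} in
theorem IsPath.le {s t : ℤ} {P : TotalPath V} (h : C.IsPath s t P) : s ≤ t := by
  have := h.2
  omega

theorem isPath_nil (s : ℤ) : C.IsPath s s ⟨C.vertex s, C.vertex s, Quiver.Path.nil⟩ :=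
  ⟨rfl, by simp [TotalPath.length]⟩

theorem exists_isPath (P : TotalPath V) : ∃ s t, C.IsPath s t P := by
  obtain ⟨s, hs⟩ := C.exists_vertex_eq P.1
  exact ⟨s, _, hs, rfl⟩

variable {C} in
theorem IsPath.add {s t : ℤ} {P : TotalPath V} (h : C.IsPath s t P) (c : ℤ) :
    C.IsPath (s + c * C.N) (t + c * C.N) P := by
  refine ⟨((C.vertex_eq_iff _ _).2 ?_).trans h.1, ?_⟩
  · rw [add_sub_cancel_left]
    exact dvd_mul_left _ _
  · rw [← h.2]
    ring

variable {C} in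
theorem IsPath.exists_split {s t u : ℤ} {R : TotalPath V} (h : C.IsPath s u R) (hst : s ≤ t)
    (htu : t ≤ u) : ∃ P Q, C.IsPath s t P ∧ C.IsPath t u Q := by
  obtain ⟨a, b, R⟩ := R
  have h2 : s + R.length = u := h.2
  obtain ⟨c, P, Q, rfl, hP⟩ := R.exists_eq_comp_of_le_length (n := (t - s).toNat) (by omega)
  have hP' : C.IsPath s t ⟨a, c, P⟩ := ⟨h.1, by
    change s + (P.length : ℤ) = t
    omega⟩
  refine ⟨⟨a, c, P⟩, ⟨c, b, Q⟩, hP', hP'.end_eq.symm, ?_⟩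
  change t + (Q.length : ℤ) = u
  rw [Quiver.Path.length_comp] at h2
  push_cast at h2
  omega

section PathAlgebra

open PathAlgebra

variable {k : Type u} [Field k] [DecidableEq V]

variable {C} in
theorem ofPath_mul_ofPath_of_isPath {s t u : ℤ} {P Q : TotalPath V} (hP : C.IsPath s t P)
    (hQ : C.IsPath t u Q) :
    ∃ R, C.IsPath s u R ∧ (ofPath k P * ofPath k Q : PathAlgebra k V) = ofPath k R := by
  have h : Q.1 = P.2.1 := hQ.1.symm.trans hP.end_eq.symm
  have hP2 := hP.2
  have hQ2 := hQ.2
  obtain ⟨a, b, P⟩ := P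
  obtain ⟨b', c, Q⟩ := Q
  obtain rfl : b' = b := h
  refine ⟨⟨a, c, P.comp Q⟩, ⟨hP.1, ?_⟩, ?_⟩
  · change s + ((P.comp Q).length : ℤ) = u
    change s + (P.length : ℤ) = t at hP2
    change t + (Q.length : ℤ) = u at hQ2
    rw [Quiver.Path.length_comp]
    push_cast
    omega
  · rw [ofPath_mul_ofPath, pathMul, dif_pos rfl]
    simp

variable {C} in
theorem ofPath_mul_ofPath_eq_zero {s t t' u : ℤ} {P Q : TotalPath V} (hP : C.IsPath s t P)
    (hQ : C.IsPath t' u Q) (h : ¬ (C.N : ℤ) ∣ t' - t) :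
    (ofPath k P * ofPath k Q : PathAlgebra k V) = 0 := by
  rw [ofPath_mul_ofPath, pathMul, dif_neg]
  intro h1
  rw [← hQ.1, hP.end_eq, C.vertex_eq_iff] at h1
  exact h h1

end PathAlgebra

end CyclicLabelling

end QuiverAlg

namespace QuiverAlg

/-! ### The Nakayama basis of a bound path algebra -/

namespace CyclicLabelling

open PathAlgebra

variable {V : Type v} [Quiver.{w} V] (C : CyclicLabelling V) {k : Type u} [Field k]
  [Fintype V] [DecidableEq V] (I : Ideal (PathAlgebra k V)) [I.IsTwoSided]

open Classical in
/-- The class of the path from `s` to `t`, and zero if there is none. -/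
noncomputable def pathClass (s t : ℤ) : PathAlgebra k V ⧸ I :=
  if h : ∃ P, C.IsPath s t P then Ideal.Quotient.mk I (ofPath k h.choose) else 0

variable {C} in
theorem IsPath.pathClass_eq {s t : ℤ} {P : TotalPath V} (h : C.IsPath s t P) :
    C.pathClass I s t = Ideal.Quotient.mk I (ofPath k P) := by
  have h' : ∃ P, C.IsPath s t P := ⟨P, h⟩
  rw [pathClass, dif_pos h', h'.choose_spec.unique h]

theorem pathClass_eq_zero {s t : ℤ} (h : ¬ ∃ P, C.IsPath s t P) : C.pathClass I s t = 0 :=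
  dif_neg h

theorem pathClass_add_mul (s t c : ℤ) :
    C.pathClass I (s + c * C.N) (t + c * C.N) = C.pathClass I s t := by
  by_cases h : ∃ P, C.IsPath s t P
  · obtain ⟨P, hP⟩ := h
    rw [hP.pathClass_eq I, (hP.add c).pathClass_eq I]
  · rw [C.pathClass_eq_zero I h, pathClass_eq_zero]
    rintro ⟨P, hP⟩
    have h1 := hP.add (-c)
    rw [neg_mul, add_neg_cancel_right, add_neg_cancel_right] at h1
    exact h ⟨P, h1⟩

/-- If one of the two paths does not exist, neither does their composite, since every path splits at
each intermediate vertex. -/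
theorem pathClass_mul {s t u : ℤ} (hst : s ≤ t) (htu : t ≤ u) :
    C.pathClass I s t * C.pathClass I t u = C.pathClass I s u := by
  by_cases hP : ∃ P, C.IsPath s t P
  · by_cases hQ : ∃ Q, C.IsPath t u Q
    · obtain ⟨P, hP⟩ := hP
      obtain ⟨Q, hQ⟩ := hQ
      obtain ⟨R, hR, h⟩ := ofPath_mul_ofPath_of_isPath (k := k) hP hQ
      rw [hP.pathClass_eq I, hQ.pathClass_eq I, hR.pathClass_eq I, ← map_mul, h]
    · rw [C.pathClass_eq_zero I hQ, mul_zero, pathClass_eq_zero]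
      rintro ⟨R, hR⟩
      obtain ⟨P, Q, -, h⟩ := hR.exists_split hst htu
      exact hQ ⟨Q, h⟩
  · rw [C.pathClass_eq_zero I hP, zero_mul, pathClass_eq_zero]
    rintro ⟨R, hR⟩
    obtain ⟨P, Q, h, -⟩ := hR.exists_split hst htu
    exact hP ⟨P, h⟩

theorem pathClass_mul_eq_zero {s t t' u : ℤ} (h : ¬ (C.N : ℤ) ∣ t' - t) :
    C.pathClass I s t * C.pathClass I t' u = 0 := by
  by_cases hP : ∃ P, C.IsPath s t P
  · by_cases hQ : ∃ Q, C.IsPath t' u Q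
    · obtain ⟨P, hP⟩ := hP
      obtain ⟨Q, hQ⟩ := hQ
      rw [hP.pathClass_eq I, hQ.pathClass_eq I, ← map_mul, ofPath_mul_ofPath_eq_zero hP hQ h, map_zero]
    · rw [C.pathClass_eq_zero I hQ, mul_zero]
  · rw [C.pathClass_eq_zero I hP, zero_mul]

theorem sum_pathClass : ∑ i ∈ Finset.range C.N, C.pathClass I i i = 1 := by
  have hN : (0 : ℤ) < C.N := by exact_mod_cast C.N_pos
  have h1 : (1 : PathAlgebra k V) = ∑ a : V, ofPath k ⟨a, a, Quiver.Path.nil⟩ := rfl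
  rw [← map_one (Ideal.Quotient.mk I), h1, map_sum]
  refine Finset.sum_bij (fun i _ => C.vertex i) (fun _ _ => Finset.mem_univ _)
    (fun i hi j hj hij => ?_) (fun a _ => ?_) fun i _ => (C.isPath_nil i).pathClass_eq I
  · rw [Finset.mem_range] at hi hj
    have h2 := Int.eq_zero_of_abs_lt_dvd ((C.vertex_eq_iff _ _).1 hij) (by rw [abs_lt]; omega)
    omega
  · obtain ⟨s, rfl⟩ := C.exists_vertex_eq a
    have h2 := Int.emod_nonneg s hN.ne'
    have h3 := Int.emod_lt_of_pos s hN
    refine ⟨(s % C.N).toNat, Finset.mem_range.2 (by omega), ?_⟩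
    rw [Int.toNat_of_nonneg h2, C.vertex_eq_iff]
    exact Int.ModEq.dvd (Int.mod_modEq s C.N).symm

theorem span_pathClass :
    Submodule.span k (Set.range fun s : ℤ × ℤ => C.pathClass I s.1 s.2) = ⊤ := by
  rw [eq_top_iff]
  intro z _
  obtain ⟨z, rfl⟩ := Ideal.Quotient.mk_surjective z
  induction z using PathAlgebra.induction_on with
  | zero =>
    rw [map_zero]
    exact Submodule.zero_mem _
  | add x y hx hy =>
    rw [map_add]
    exact Submodule.add_mem _ (hx trivial) (hy trivial)
  | path c P =>
    obtain ⟨s, t, hP⟩ := C.exists_isPath P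
    rw [← Ideal.Quotient.mkₐ_eq_mk k, map_smul, Ideal.Quotient.mkₐ_eq_mk, ← hP.pathClass_eq I]
    exact Submodule.smul_mem _ _ (Submodule.subset_span ⟨(s, t), rfl⟩)

open Classical in
/-- The coefficient of the path from `s` to `t`. -/
noncomputable def coeff (s t : ℤ) : PathAlgebra k V →ₗ[k] k :=
  if h : ∃ P, C.IsPath s t P then (basis k V).coord h.choose else 0

open Classical in
theorem coeff_ofPath (s t : ℤ) (P : TotalPath V) :
    C.coeff s t (ofPath k P) = if C.IsPath s t P then 1 else 0 := by
  by_cases h : ∃ P, C.IsPath s t P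
  · rw [coeff, dif_pos h, ofPath, Module.Basis.coord_apply, Module.Basis.repr_self,
      Finsupp.single_apply]
    refine if_congr ⟨fun h1 => h1 ▸ h.choose_spec, fun h1 => h1.unique h.choose_spec⟩ rfl rfl
  · rw [coeff, dif_neg h, if_neg fun h1 => h ⟨P, h1⟩]
    rfl

variable {I} (hI : IsAdmissible I)

include hI in
-- Elements of `I ⊆ J ^ 2` have no coefficient at paths of length zero.
theorem pathClass_self_ne_zero (s : ℤ) : C.pathClass I s s ≠ 0 := by
  rw [(C.isPath_nil s).pathClass_eq I, Ne, Ideal.Quotient.eq_zero_iff_mem]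
  intro h
  have h1 : ∀ z ∈ arrowIdealPow (V := V) k 2, C.coeff s s z = 0 := by
    intro z hz
    induction hz using Submodule.span_induction with
    | mem z hz =>
      obtain ⟨P, hP, rfl⟩ := hz
      rw [coeff_ofPath, if_neg]
      intro h2
      have := h2.2
      omega
    | zero => exact map_zero _
    | add x y _ _ hx hy => rw [map_add, hx, hy, add_zero]
    | smul c x _ hx => rw [map_smul, hx, smul_zero]
  have h2 := h1 _ (hI.2 h)
  rw [coeff_ofPath, if_pos (C.isPath_nil s)] at h2
  exact one_ne_zero h2

include hI in
theorem exists_pathClass_eq_zero (s : ℤ) : ∃ n : ℕ, C.pathClass I s (s + n) = 0 := by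
  obtain ⟨⟨m, -, hm⟩, -⟩ := hI
  refine ⟨m, ?_⟩
  by_cases h : ∃ P, C.IsPath s (s + m) P
  · obtain ⟨P, hP⟩ := h
    rw [hP.pathClass_eq I, Ideal.Quotient.eq_zero_iff_mem]
    have h1 := hP.2
    exact hm (Submodule.subset_span ⟨P, by omega, rfl⟩)
  · exact C.pathClass_eq_zero I h

open Classical in
/-- The path from `s` to `t` is zero in the quotient if and only if `pathBound s ≤ t`. -/
noncomputable def pathBound (s : ℤ) : ℤ := s + Nat.find (C.exists_pathClass_eq_zero hI s)

theorem pathClass_pathBound (s : ℤ) : C.pathClass I s (C.pathBound hI s) = 0 := by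
  classical
  exact Nat.find_spec (C.exists_pathClass_eq_zero hI s)

theorem pathClass_ne_zero {s t : ℤ} (h : s ≤ t) (h' : t < C.pathBound hI s) :
    C.pathClass I s t ≠ 0 := by
  classical
  obtain ⟨n, rfl⟩ := Int.le.dest h
  exact Nat.find_min (C.exists_pathClass_eq_zero hI s) (by
    rw [pathBound] at h'
    omega)

theorem lt_pathBound (s : ℤ) : s < C.pathBound hI s := by
  classical
  have h : 0 < Nat.find (C.exists_pathClass_eq_zero hI s) := by
    rw [Nat.find_pos]
    simpa using C.pathClass_self_ne_zero hI s
  rw [pathBound]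
  omega

theorem pathClass_eq_zero_of_not {s t : ℤ} (h : ¬ (s ≤ t ∧ t < C.pathBound hI s)) :
    C.pathClass I s t = 0 := by
  by_cases hst : s ≤ t
  · rw [← C.pathClass_mul I (C.lt_pathBound hI s).le (show C.pathBound hI s ≤ t by omega),
      pathClass_pathBound, zero_mul]
  · exact C.pathClass_eq_zero I fun ⟨P, hP⟩ => hst hP.le

theorem pathBound_add (s : ℤ) : C.pathBound hI (s + C.N) = C.pathBound hI s + C.N := by
  have h1 := C.lt_pathBound hI s
  have h2 := C.lt_pathBound hI (s + C.N)
  have h3 : ∀ t, C.pathClass I (s + C.N) (t + C.N) = C.pathClass I s t := fun t => by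
    have := C.pathClass_add_mul I s t 1
    rwa [one_mul] at this
  refine le_antisymm ?_ ?_
  · by_contra! h
    exact C.pathClass_ne_zero hI (s := s + C.N) (t := C.pathBound hI s + C.N) (by omega) h
      (by rw [h3, pathClass_pathBound])
  · by_contra! h
    refine C.pathClass_ne_zero hI (s := s) (t := C.pathBound hI (s + C.N) - C.N) (by omega)
      (by omega) ?_
    rw [← h3, sub_add_cancel, pathClass_pathBound]

theorem pathClass_self_mul (s : ℤ) (z : PathAlgebra k V) :
    C.pathClass I s s * Ideal.Quotient.mk I z =
      ∑ t ∈ Finset.Ico s (C.pathBound hI s), C.coeff s t z • C.pathClass I s t := by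
  induction z using PathAlgebra.induction_on with
  | zero => simp
  | add x y hx hy => simp only [map_add, mul_add, add_smul, Finset.sum_add_distrib, hx, hy]
  | path c P =>
    rw [← Ideal.Quotient.mkₐ_eq_mk k, map_smul, Ideal.Quotient.mkₐ_eq_mk, mul_smul_comm]
    simp only [map_smul, smul_assoc, ← Finset.smul_sum]
    congr 1
    by_cases h : C.vertex s = P.1
    · have hP : C.IsPath s (s + P.length) P := ⟨h, rfl⟩
      rw [← hP.pathClass_eq I, pathClass_mul _ _ le_rfl hP.le,
        Finset.sum_eq_single (s + P.length : ℤ), coeff_ofPath, if_pos hP, one_smul]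
      · intro t _ ht
        rw [coeff_ofPath, if_neg fun h1 => ht h1.2.symm, zero_smul]
      · intro h1
        rw [Finset.mem_Ico] at h1
        rw [C.pathClass_eq_zero_of_not hI h1, smul_zero]
    · obtain ⟨s', t', hP⟩ := C.exists_isPath P
      rw [← hP.pathClass_eq I, pathClass_mul_eq_zero, Finset.sum_eq_zero]
      · intro t _
        rw [coeff_ofPath, if_neg fun h1 => h h1.1, zero_smul]
      · rw [← C.vertex_eq_iff, hP.1]
        exact fun h1 => h h1.symm

/-- Admissible ideals are monomial here. An element `z` of `I` gives a vanishing combination of the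
classes of paths from `s`; multiplying by the path from `s + n` to the last nonzero position
isolates the coefficient at `s + n`. -/
theorem coeff_eq_zero {z : PathAlgebra k V} (hz : z ∈ I) {s t : ℤ} (h : s ≤ t)
    (h' : t < C.pathBound hI s) : C.coeff s t z = 0 := by
  have h0 := C.pathClass_self_mul hI s z
  rw [Ideal.Quotient.eq_zero_iff_mem.2 hz, mul_zero] at h0
  obtain ⟨n, rfl⟩ := Int.le.dest h
  induction n using Nat.strong_induction_on with
  | _ n ih =>
  have h1 := congrArg (· * C.pathClass I (s + n) (C.pathBound hI s - 1)) h0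
  simp only [zero_mul, Finset.sum_mul, smul_mul_assoc] at h1
  rw [Finset.sum_eq_single (s + n : ℤ), pathClass_mul _ _ h (by omega)] at h1
  · exact (smul_eq_zero.1 h1.symm).resolve_right (C.pathClass_ne_zero hI (by omega) (by omega))
  · intro t ht hne
    rw [Finset.mem_Ico] at ht
    rcases lt_or_gt_of_ne hne with hlt | hgt
    -- Shorter paths have zero coefficient by induction. Longer ones are either not composable or,
    -- after translation, yield a path reaching beyond `pathBound`.
    · obtain ⟨m, rfl⟩ := Int.le.dest ht.1
      rw [ih m (by omega) ht.1 ht.2, zero_smul]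
    · by_cases hN : (C.N : ℤ) ∣ s + n - t
      · obtain ⟨c, hc⟩ := hN
        rw [show s + n = t + c * C.N by linarith,
          show C.pathBound hI s - 1 = C.pathBound hI s - 1 - c * C.N + c * C.N by ring,
          pathClass_add_mul, pathClass_mul _ _ ht.1 (by linarith),
          C.pathClass_eq_zero_of_not hI (by
            have : c * C.N < 0 := by linarith
            omega), smul_zero]
      · rw [C.pathClass_mul_eq_zero I hN, smul_zero]
  · intro h2
    exact absurd (Finset.mem_Ico.2 ⟨h, h'⟩) h2

/-- The coefficient of the path from `s` to `t` as a functional on the quotient. -/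
noncomputable def quotientCoeff (s t : ℤ) : PathAlgebra k V ⧸ I →ₗ[k] k :=
  if h : s ≤ t ∧ t < C.pathBound hI s then
    ((I.restrictScalars k).liftQ (C.coeff s t) fun _ hz => C.coeff_eq_zero hI hz h.1 h.2) ∘ₗ
      (Submodule.Quotient.restrictScalarsEquiv k I).symm.toLinearMap
  else 0

theorem quotientCoeff_mk {s t : ℤ} (h : s ≤ t) (h' : t < C.pathBound hI s) (z : PathAlgebra k V) :
    C.quotientCoeff hI s t (Ideal.Quotient.mk I z) = C.coeff s t z := by
  rw [quotientCoeff, dif_pos ⟨h, h'⟩]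
  rfl

theorem quotientCoeff_pathClass (s t s' t' : ℤ) :
    C.quotientCoeff hI s t (C.pathClass I s' t') =
      if s ≤ t ∧ t < C.pathBound hI s ∧ (C.N : ℤ) ∣ s' - s ∧ t' - s' = t - s then 1 else 0 := by
  classical
  by_cases h : s ≤ t ∧ t < C.pathBound hI s
  · by_cases hP : ∃ P, C.IsPath s' t' P
    · obtain ⟨P, hP⟩ := hP
      rw [hP.pathClass_eq I, C.quotientCoeff_mk hI h.1 h.2, coeff_ofPath]
      have h1 := hP.2
      refine if_congr ?_ rfl rfl
      rw [IsPath, ← hP.1, ← C.vertex_eq_iff, eq_comm (a := C.vertex s)]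
      constructor
      · exact fun h2 => ⟨h.1, h.2, h2.1, by omega⟩
      · exact fun h2 => ⟨h2.2.2.1, by omega⟩
    · rw [C.pathClass_eq_zero I hP, map_zero, if_neg]
      rintro ⟨-, -, ⟨c, hc⟩, h1⟩
      refine C.pathClass_ne_zero hI h.1 h.2 ?_
      rw [← C.pathClass_add_mul I s t c, show s + c * C.N = s' by linarith,
        show t + c * C.N = t' by linarith, C.pathClass_eq_zero I hP]
  · rw [quotientCoeff, dif_neg h, if_neg fun h1 => h ⟨h1.1, h1.2.1⟩]
    rfl

/-- A Nakayama algebra has a Nakayama basis. -/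
noncomputable def nakayamaBasis : NakayamaBasis k (PathAlgebra k V ⧸ I) where
  N := C.N
  N_pos := C.N_pos
  p := C.pathBound hI
  lt_p := C.lt_pathBound hI
  p_add := C.pathBound_add hI
  y := C.pathClass I
  y_add s t := by
    have := C.pathClass_add_mul I s t 1
    rwa [one_mul] at this
  y_eq_zero _ _ := C.pathClass_eq_zero_of_not hI
  y_mul _ _ _ := C.pathClass_mul I
  y_mul_zero _ _ _ _ := C.pathClass_mul_eq_zero I
  one := C.sum_pathClass I
  span := C.span_pathClass I
  χ := C.quotientCoeff hI
  χ_y := C.quotientCoeff_pathClass hI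

end CyclicLabelling

theorem nonempty_cyclicLabelling_of_isLinearQuiver_or_isCyclicQuiver {V : Type v} [Quiver.{w} V]
    (h : IsLinearQuiver V ∨ IsCyclicQuiver V) : Nonempty (CyclicLabelling V) := by
  obtain ⟨N, hN, e, h1, h2⟩ := h.elim IsLinearQuiver.hom_mod IsCyclicQuiver.hom_mod
  exact nonempty_cyclicLabelling hN e h1 h2

end QuiverAlg

theorem mainTheorem8 {k : Type u} [Field k] {V : Type v} [Quiver.{w} V] [Fintype V]
    [DecidableEq V] (hV : QuiverAlg.IsLinearQuiver V ∨ QuiverAlg.IsCyclicQuiver V)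
    (I : Ideal (QuiverAlg.PathAlgebra k V)) [I.IsTwoSided] (hI : QuiverAlg.IsAdmissible I) :
    QuiverAlg.IsAuslanderGorenstein (QuiverAlg.PathAlgebra k V ⧸ I) ↔
      ∃ h : QuiverAlg.HasWellDefinedARMap (QuiverAlg.PathAlgebra k V ⧸ I),
        Function.Bijective (QuiverAlg.auslanderReitenMap h) := by
  obtain ⟨C⟩ := QuiverAlg.nonempty_cyclicLabelling_of_isLinearQuiver_or_isCyclicQuiver hV
  exact (C.nakayamaBasis hI).isAuslanderGorenstein_iff_bijective
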